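/- Let $n\ge 0$, $d=2^n$, and let $O_1,\dots,O_M$ ($M\ge 2$) be observables (Hermitian operators) on $n$ qubits, each of rank at most $r$ and with all eigenvalues bounded in absolute value by $\lambda$. Let $\rho$ be an unknown mixed state on $n$ qubits, $o_j=\operatorname{tr}(O_j\rho)$, $\epsilon>0$ and $\delta\in(0,1)$. Suppose that each $O_j$ is implemented by a circuit $V_j$ of at most $F$ one- and two-qubit gates followed by a measurement of all qubits in the computational basis, i.e. $O_j=V_j^\dagger\,\mathrm{diag}(a_j)\,V_j$ with real labels $a_j(x)$, $x\in\{0,1\}^n$. The Clifford QCQC procedure with $N=KB$ copies of $\rho$ ($K$ odd) is the following. For each copy $i\in[N]$, draw a uniformly random $n$-qubit Clifford unitary $U_i$ (up to global phase, as a circuit of Hadamard, phase and CNOT gates produced by an explicit classical randomized algorithm), apply it to the copy, measure in the computational basis, and store the outcome $b_i$ and a circuit for $U_i^\dagger$. For each $i\in[N]$ and $j\in[M]$, let $X_{i,j}$ be the average outcome of $m=2(d+1)$ measurements of $O_j$ on freshly prepared states $U_i^\dagger|b_i\rangle$, and put $Y_{i,j}=(d+1)X_{i,j}-\operatorname{tr}(O_j)$.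 For each $j$ output $\hat o_j$, the median of the averages of $Y_{i,j}$ over $K$ groups of $B$ copies. There is an absolute constant $C$ such that, for suitable $K$ and $B\geq 1$ depending only on $M,r,\lambda,\epsilon,\delta$, the procedure satisfies, for all $n$, $F$, $O_j$, $V_j$ and $\rho$ as above, $$\Pr\big[\,|\hat o_j-o_j|\le\epsilon\ \text{ for all } j\in[M]\,\big]\ \ge\ 1-\delta ,$$ and in every run, with $R=\max\{1,\,r\lambda^2/\epsilon^2\}$, * it uses at most $C\,R\,\log(M/\delta)$ copies of $\rho$; * it takes at most $C\,d\,R\,M\log(M/\delta)$ steps, a step being an elementary classical operation (including those that sample the Clifford circuits, compute the traces and compute the medians) or the execution of one quantum circuit with its measurement; * the executed circuits consist altogether of at most $C\,d\,R\,M\log(M/\delta)\,\big(F+(n+1)^2\big)$ elementary quantum operations (qubit preparations, gates, qubit readouts). Thus, for fixed $\epsilon,\delta$ and $r\lambda^2\ge\epsilon^2$, shadow tomography is solved with $O(r\lambda^2\log M)$ copies in $O(d\,r\,\lambda^2M\log M)$ time, where the time is counted in classical operations and circuit executions; counted in elementary gates it is larger by the factor $F+O(\log^2 d)$ at most. -/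

import Mathlib

noncomputable section

open scoped Matrix Kronecker ComplexOrder

namespace QCQC

/-! ### Qubits, gates and circuits -/

/-- Labels of the computational basis of `n` qubits; the dimension is `d = 2 ^ n`. -/
abbrev Bits (n : ℕ) : Type := Fin n → Bool

/-- Operators on `n` qubits. -/
abbrev Op (n : ℕ) : Type := Matrix (Bits n) (Bits n) ℂ

/-- Split off the coordinates `i` and `j`. -/
def splitTwo {n : ℕ} (i j : Fin n) (h : j ≠ i) :
    Bits n ≃ (Bool × Bool) × ({k : {k : Fin n // k ≠ i} // k ≠ ⟨j, h⟩} → Bool) :=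
  (Equiv.funSplitAt i Bool).trans
    (((Equiv.refl Bool).prodCongr
      (Equiv.funSplitAt (⟨j, h⟩ : {k : Fin n // k ≠ i}) Bool)).trans
      (Equiv.prodAssoc Bool Bool _).symm)

/-- Elementary quantum gates: arbitrary unitaries on one qubit, or on two distinct qubits. -/
inductive Gate (n : ℕ) : Type
  | one (i : Fin n) (u : Matrix.unitaryGroup Bool ℂ) : Gate n
  | two (i j : Fin n) (h : j ≠ i) (u : Matrix.unitaryGroup (Bool × Bool) ℂ) : Gate n

/-- The operator of a gate: the small unitary on its qubits, the identity on the others. -/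
def Gate.toMatrix {n : ℕ} : Gate n → Op n
  | .one i u =>
      ((u : Matrix Bool Bool ℂ) ⊗ₖ (1 : Matrix ({k : Fin n // k ≠ i} → Bool) _ ℂ)).submatrix
        (Equiv.funSplitAt i Bool) (Equiv.funSplitAt i Bool)
  | .two i j h u =>
      ((u : Matrix (Bool × Bool) (Bool × Bool) ℂ) ⊗ₖ (1 : Matrix
        ({k : {k : Fin n // k ≠ i} // k ≠ ⟨j, h⟩} → Bool) _ ℂ)).submatrix
        (splitTwo i j h) (splitTwo i j h)

/-- The inverse gate. -/
def Gate.dagger {n : ℕ} : Gate n → Gate n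
  | .one i u => .one i u⁻¹
  | .two i j h u => .two i j h u⁻¹

/-- The same gate on the last `n` of `n + 1` qubits. -/
def Gate.shift {n : ℕ} : Gate n → Gate (n + 1)
  | .one i u => .one i.succ u
  | .two i j h u => .two i.succ j.succ (fun e => h (Fin.succ_injective n e)) u

/-- A circuit is the list of its gates; the head of the list is applied first. -/
abbrev Circuit (n : ℕ) : Type := List (Gate n)

/-- The unitary that a circuit implements. -/
def Circuit.toMatrix {n : ℕ} : Circuit n → Op n
  | [] => 1
  | g :: c => Circuit.toMatrix c * g.toMatrix

/-- The inverse circuit. -/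
def Circuit.dagger {n : ℕ} (c : Circuit n) : Circuit n := (c.map Gate.dagger).reverse

theorem submatrix_mem_unitary {α β : Type} [Fintype α] [DecidableEq α] [Fintype β]
    [DecidableEq β] (e : α ≃ β) {A : Matrix β β ℂ} (hA : A ∈ unitary (Matrix β β ℂ)) :
    A.submatrix e e ∈ unitary (Matrix α α ℂ) := by
  rw [Unitary.mem_iff] at hA ⊢
  constructor
  · rw [Matrix.star_eq_conjTranspose, Matrix.conjTranspose_submatrix, Matrix.submatrix_mul_equiv,
      ← Matrix.star_eq_conjTranspose, hA.1, Matrix.submatrix_one_equiv]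
  · rw [Matrix.star_eq_conjTranspose, Matrix.conjTranspose_submatrix, Matrix.submatrix_mul_equiv,
      ← Matrix.star_eq_conjTranspose, hA.2, Matrix.submatrix_one_equiv]

theorem Gate.toMatrix_mem {n : ℕ} (g : Gate n) : g.toMatrix ∈ unitary (Op n) := by
  cases g with
  | one i u =>
    exact submatrix_mem_unitary _ (Matrix.kronecker_mem_unitary u.2 (one_mem _))
  | two i j h u =>
    exact submatrix_mem_unitary _ (Matrix.kronecker_mem_unitary u.2 (one_mem _))

theorem Circuit.toMatrix_mem {n : ℕ} (c : Circuit n) : c.toMatrix ∈ unitary (Op n) := by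
  induction c with
  | nil => exact one_mem _
  | cons g c ih => exact mul_mem ih g.toMatrix_mem

/-! ### States and measurements -/

/-- Mixed states of `n` qubits. -/
structure DensityMatrix (n : ℕ) where
  mat : Op n
  posSemidef : mat.PosSemidef
  trace_eq_one : mat.trace = 1

/-- The pure state `|b⟩⟨b|`. -/
def basisState {n : ℕ} (b : Bits n) : DensityMatrix n where
  mat := Matrix.diagonal (Pi.single b 1)
  posSemidef := by
    refine Matrix.PosSemidef.diagonal (fun x => ?_)
    by_cases h : x = b
    · subst h; simp
    · simp [h]
  trace_eq_one := by simp [Matrix.trace_diagonal]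

/-- Born's rule: the law of the outcome when the circuit `c` acts on `ρ` and all qubits are
then measured in the computational basis; `x` has probability `⟨x| U ρ U† |x⟩`. -/
def born {n : ℕ} (ρ : DensityMatrix n) (c : Circuit n) : PMF (Bits n) :=
  PMF.ofFintype (fun x => ENNReal.ofReal ((c.toMatrix * ρ.mat * c.toMatrixᴴ) x x).re) (by
    have hp : (c.toMatrix * ρ.mat * c.toMatrixᴴ).PosSemidef :=
      ρ.posSemidef.mul_mul_conjTranspose_same _
    have hu : c.toMatrixᴴ * c.toMatrix = 1 := (Unitary.mem_iff.1 c.toMatrix_mem).1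
    have ht : (c.toMatrix * ρ.mat * c.toMatrixᴴ).trace = 1 := by
      rw [Matrix.trace_mul_comm, ← Matrix.mul_assoc, hu, Matrix.one_mul, ρ.trace_eq_one]
    rw [← ENNReal.ofReal_sum_of_nonneg
      (fun x _ => (Complex.le_def.1 (hp.diag_nonneg (i := x))).1), ← Complex.re_sum]
    have h2 : (∑ x, (c.toMatrix * ρ.mat * c.toMatrixᴴ) x x) = 1 := ht
    rw [h2]; simp)

/-- A circuit implementation of an observable: apply `circuit`, measure all qubits in the
computational basis and report the number attached to the outcome. -/
structure ObservableCircuit (n : ℕ) where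
  circuit : Circuit n
  label : Bits n → ℝ

/-- The observable `V† diag(label) V` that is measured in this way. -/
def ObservableCircuit.observable {n : ℕ} (V : ObservableCircuit n) : Op n :=
  V.circuit.toMatrixᴴ * Matrix.diagonal (fun x => (V.label x : ℂ)) * V.circuit.toMatrix

/-! ### Randomized quantum-classical programs with a resource meter -/

/-- Resources used: copies of the unknown state; `steps`, the number of elementary classical
operations (arithmetic operations and comparisons of numbers, accesses to words of memory, random
bits, loop steps, gates written into the description of a circuit) and of circuit executions; and
`gates`, the number of elementary quantum operations (preparation of a qubit in `|0⟩` or `|1⟩`,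
gate, readout of a qubit) made in those executions. -/
structure Meter where
  copies : ℕ
  steps : ℕ
  gates : ℕ

/-- Programs: random computations that update the meter. -/
abbrev Prog (α : Type) : Type := StateT Meter PMF α

/-- The joint law of the output of a program and of the resources it uses. -/
def Prog.law {α : Type} (p : Prog α) : PMF (α × Meter) := StateT.run p ⟨0, 0, 0⟩

/-- A random draw, at no cost. -/
def draw {α : Type} (p : PMF α) : Prog α := StateT.lift p

/-- Charge `c` classical steps. -/
def tick (c : ℕ) : Prog Unit := modify fun s => { s with steps := s.steps + c }

/-- A uniformly random element of `{0, …, k}`, at the cost of its number of bits. -/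
def rand (k : ℕ) : Prog (Fin (k + 1)) := do
  tick k.size
  draw (PMF.uniformOfFintype (Fin (k + 1)))

/-- A fair coin. -/
def coin : Prog Bool := do
  let r ← rand 1
  pure (r.val == 1)

/-- Take a fresh copy of `ρ`, apply the circuit, measure. -/
def measureCopy {n : ℕ} (ρ : DensityMatrix n) (c : Circuit n) : Prog (Bits n) := do
  modify fun s => ⟨s.copies + 1, s.steps + 1, s.gates + (c.length + n)⟩
  draw (born ρ c)

/-- Prepare `|b⟩`, apply the circuit, measure. -/
def measureBasis {n : ℕ} (b : Bits n) (c : Circuit n) : Prog (Bits n) := do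
  modify fun s => ⟨s.copies, s.steps + 1, s.gates + (n + c.length + n)⟩
  draw (born (basisState b) c)

/-- Run `f 0, …, f (k - 1)` one after the other and collect the results. -/
def forFin {α : Type} : (k : ℕ) → (Fin k → Prog α) → Prog (Fin k → α)
  | 0, _ => pure Fin.elim0
  | k + 1, f => do
      tick 1
      let a ← f 0
      let l ← forFin k (fun i => f i.succ)
      pure (Fin.cons a l)

/-! ### Clifford unitaries -/

/-- One-qubit Pauli matrices; `(x, z)` stands for `I, X, Z, Y` when it is
`(0, 0), (1, 0), (0, 1), (1, 1)`. -/
def pauliOne : Bool × Bool → Matrix Bool Bool ℂ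
  | (false, false) => 1
  | (true, false) => Matrix.of fun a b => if a = b then 0 else 1
  | (false, true) => Matrix.diagonal fun a => if a then -1 else 1
  | (true, true) => Matrix.of fun a b =>
      if a = b then 0 else if a then Complex.I else -Complex.I

/-- Tensor products of Pauli matrices. -/
def pauli {n : ℕ} (p : Fin n → Bool × Bool) : Op n :=
  Matrix.of fun x y => ∏ i, pauliOne (p i) (x i) (y i)

/-- The Clifford group: the unitaries that map tensor products of Pauli matrices to tensor
products of Pauli matrices, up to sign, by conjugation. -/
def IsClifford {n : ℕ} (U : Op n) : Prop :=
  U ∈ unitary (Op n) ∧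
    ∀ p : Fin n → Bool × Bool, ∃ q : Fin n → Bool × Bool,
      U * pauli p * Uᴴ = pauli q ∨ U * pauli p * Uᴴ = -pauli q

/-- Equality of operators up to a global phase. -/
def EqUpToPhase {n : ℕ} (U V : Op n) : Prop := ∃ z : ℂ, ‖z‖ = 1 ∧ U = z • V

/-- The circuit produced by `p` is a uniformly random Clifford unitary: it is always Clifford, and
any two Clifford unitaries are equally likely (global phases are disregarded). -/
def IsUniformClifford {n : ℕ} (p : Prog (Circuit n)) : Prop :=
  (∀ o ∈ p.law.support, IsClifford (Circuit.toMatrix o.1)) ∧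
    ∀ V W : Op n, IsClifford V → IsClifford W →
      p.law.toOuterMeasure {o | EqUpToPhase (Circuit.toMatrix o.1) V} =
        p.law.toOuterMeasure {o | EqUpToPhase (Circuit.toMatrix o.1) W}

/-- The Hadamard gate. -/
def hadamard : Matrix.unitaryGroup Bool ℂ :=
  ⟨Matrix.of fun a b => if a && b then -((√2 : ℝ) : ℂ)⁻¹ else ((√2 : ℝ) : ℂ)⁻¹, by
    have h : ((√2 : ℝ) : ℂ)⁻¹ * ((√2 : ℝ) : ℂ)⁻¹ = 2⁻¹ := by
      rw [← mul_inv, ← Complex.ofReal_mul, Real.mul_self_sqrt (by norm_num)]; norm_num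
    rw [Matrix.mem_unitaryGroup_iff]
    ext a b
    cases a <;> cases b <;> (simp [Matrix.mul_apply, Matrix.star_apply, h]; try norm_num)⟩

/-- The phase gate. -/
def phase : Matrix.unitaryGroup Bool ℂ :=
  ⟨Matrix.diagonal fun a => if a then Complex.I else 1, by
    rw [Matrix.mem_unitaryGroup_iff]
    ext a b
    cases a <;> cases b <;> simp [Matrix.mul_apply, Matrix.star_apply, Matrix.diagonal]⟩

/-- The CNOT gate; the first qubit is the control. -/
def cnot : Matrix.unitaryGroup (Bool × Bool) ℂ :=
  ⟨Matrix.of fun a b => if a.1 = b.1 ∧ a.2 = xor b.1 b.2 then 1 else 0, by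
    rw [Matrix.mem_unitaryGroup_iff]
    ext ⟨a, a'⟩ ⟨b, b'⟩
    cases a <;> cases a' <;> cases b <;> cases b' <;>
      simp [Matrix.mul_apply, Matrix.star_apply, Fintype.sum_prod_type]⟩

def gH {n : ℕ} (i : Fin n) : Circuit n := [.one i hadamard]

def gS {n : ℕ} (i : Fin n) : Circuit n := [.one i phase]

/-- CNOT with control `i` and target `j`; nothing if `i = j`. -/
def gCNOT {n : ℕ} (i j : Fin n) : Circuit n := if h : j ≠ i then [.two i j h cnot] else []

/-- A Clifford circuit that takes `Z` on qubit `0` to the Pauli string `a ≠ I`, up to sign. -/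
def zTo {n : ℕ} (a : Fin (n + 1) → Bool × Bool) : Circuit (n + 1) :=
  let t : Fin (n + 1) :=
    ((List.finRange (n + 1)).find? (fun i => (a i).1 || (a i).2)).getD 0
  (gCNOT 0 t ++ gCNOT t 0 ++ gCNOT 0 t) ++
    (List.finRange (n + 1)).flatMap (fun i => if (a i).1 || (a i).2 then gCNOT i t else []) ++
    (List.finRange (n + 1)).flatMap (fun i =>
      if (a i).1 then (if (a i).2 then gH i ++ gS i else gH i) else [])

/-- A Clifford circuit that commutes with `Z` on qubit `0`, and takes `X` on qubit `0` to
`X` (or `Y`, if `z`) on qubit `0` times `q` on the other qubits, up to sign. -/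
def xTo {n : ℕ} (z : Bool) (q : Fin n → Bool × Bool) : Circuit (n + 1) :=
  (List.finRange n).flatMap (fun i =>
    match q i with
    | (false, false) => []
    | (true, false) => gCNOT 0 i.succ
    | (true, true) => gCNOT 0 i.succ ++ gS i.succ
    | (false, true) => gCNOT 0 i.succ ++ gH i.succ) ++
  (if z then gS 0 else [])

/-- The Pauli matrix `X ^ s Z ^ t` on qubit `0`. -/
def pauliZero {n : ℕ} (s t : Bool) : Circuit (n + 1) :=
  (if t then gS 0 ++ gS 0 else []) ++ (if s then gH 0 ++ gS 0 ++ gS 0 ++ gH 0 else [])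

/-- Sampling of a uniformly random Clifford circuit. The images of `Z` and `X` on qubit `0` are
drawn first, and a random Clifford circuit of the other qubits completes the circuit. -/
def cliffordSampler : (n : ℕ) → Prog (Circuit n)
  | 0 => pure []
  | n + 1 => do
      let r ← rand (4 ^ (n + 1) - 2)
      let a : Fin (n + 1) → Bool × Bool :=
        fun i => ((r.val + 1).testBit (2 * i.val), (r.val + 1).testBit (2 * i.val + 1))
      let q ← forFin n (fun _ => do
        let x ← coin
        let z ← coin
        pure (x, z))
      let z ← coin
      let s ← coin
      let t ← coin
      let c ← cliffordSampler n
      let out : Circuit (n + 1) := c.map Gate.shift ++ pauliZero s t ++ xTo z q ++ zTo a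
      tick (8 * (n + 1) + out.length)
      pure out

/-! ### Linear-time selection

Each function returns its result together with the number of steps. -/

def insertT (a : ℝ) : List ℝ → List ℝ × ℕ
  | [] => ([a], 1)
  | b :: l =>
      if a ≤ b then (a :: b :: l, 1)
      else ((b :: (insertT a l).1), (insertT a l).2 + 1)

/-- Insertion sort. -/
def sortT : List ℝ → List ℝ × ℕ
  | [] => ([], 1)
  | a :: l => ((insertT a (sortT l).1).1, (sortT l).2 + (insertT a (sortT l).1).2 + 1)

/-- The medians of the consecutive blocks of five. -/
def mediansOfFive : List ℝ → List ℝ × ℕ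
  | a :: b :: c :: d :: e :: l =>
      ((sortT [a, b, c, d, e]).1.getD 2 0 :: (mediansOfFive l).1,
        (sortT [a, b, c, d, e]).2 + (mediansOfFive l).2 + 1)
  | _ => ([], 1)

/-- The element of index `k` (from `0`) of the list in increasing order, by the method of medians
of medians. The first argument bounds the depth of the recursion; the length of the list is
enough. -/
def selectT : ℕ → List ℝ → ℕ → ℝ × ℕ
  | 0, _, _ => (0, 1)
  | f + 1, l, k =>
      if l.length < 60 then
        ((sortT l).1.getD k 0, l.length + (sortT l).2 + k + 1)
      else
        let meds := mediansOfFive l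
        let p := selectT f meds.1 (meds.1.length / 2)
        let lo := l.filter (fun x => decide (x < p.1))
        let hi := l.filter (fun x => decide (p.1 < x))
        let c := l.length + meds.2 + p.2 + 4 * l.length + 4
        if k < lo.length then
          ((selectT f lo k).1, c + (selectT f lo k).2)
        else if k < l.length - hi.length then
          (p.1, c)
        else
          ((selectT f hi (k - (l.length - hi.length))).1,
            c + (selectT f hi (k - (l.length - hi.length))).2)

/-- The median of `k` numbers, for `k` odd. -/
def median {k : ℕ} (v : Fin k → ℝ) : Prog ℝ := do
  let res := selectT k (List.ofFn v) (k / 2)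
  tick (k + res.2)
  pure res.1

/-! ### The procedure -/

/-- First phase, for one copy: a random Clifford unitary `U` is applied and the copy is measured.
The outcome and a circuit for `U†` are stored. -/
def snapshot {n : ℕ} (ρ : DensityMatrix n) : Prog (Bits n × Circuit n) := do
  let c ← cliffordSampler n
  let b ← measureCopy ρ c
  tick (n + c.length)
  pure (b, c.dagger)

/-- Second phase, for one snapshot `(b, U)` and one observable `O` of trace `t`: the average `X` of
`m = 2 (d + 1)` measurements of `O` in the state `U† |b⟩` is turned into `(d + 1) X - t`. -/
def estimate {n : ℕ} (V : ObservableCircuit n) (t : ℝ) (s : Bits n × Circuit n) : Prog ℝ := do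
  let m : ℕ := 2 * (2 ^ n + 1)
  let v ← forFin m (fun _ => do
    let x ← measureBasis s.1 (s.2 ++ V.circuit)
    tick 1
    pure (V.label x))
  tick (m + 3)
  pure ((2 ^ n + 1) * ((∑ l, v l) / m) - t)

/-- The trace of the observable, as the sum of its labels. -/
def traceOf {n : ℕ} (V : ObservableCircuit n) : Prog ℝ := do
  tick (2 * 2 ^ n)
  pure (∑ x, V.label x)

/-- The QCQC procedure with Clifford measurements, with `K * B` copies of `ρ`: the snapshots are
taken once and serve for all the observables; for each observable the median of the averages over
`K` groups of `B` snapshots is returned. -/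
def clifford {n M : ℕ} (ρ : DensityMatrix n) (obs : Fin M → ObservableCircuit n) (K B : ℕ) :
    Prog (Fin M → ℝ) := do
  let snaps ← forFin K (fun _ => forFin B (fun _ => snapshot ρ))
  forFin M (fun j => do
    let t ← traceOf (obs j)
    let means ← forFin K (fun k => do
      let y ← forFin B (fun i => estimate (obs j) t (snaps k i))
      tick (B + 1)
      pure ((∑ i, y i) / B))
    median means)

end QCQC

end

noncomputable section

open scoped Matrix Kronecker ComplexOrder

namespace QCQC

/-! Write `d = 2 ^ n`. The proof has four ingredients: uniformity of the sampler, moments of random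
Clifford measurements, amplification by medians, and resource accounting.

Uniformity. A Clifford unitary on `n + 1` qubits is fixed, up to phase and up to a Clifford unitary
on the last `n` qubits, by the signed images of `Z` and `X` on qubit `0`. `exists_frame` shows that
every Clifford unitary has such a decomposition. `frame_unique` shows that it is unique, so
induction on `n` gives every phase class the same weight (`samplerLaw_uniform`). The law is
therefore invariant under left multiplication by a Clifford unitary (`Ex_samplerLaw_mul_left`).

Moments. The diagonal of `U A U†` is the Fourier transform of the coefficients of the `Z`-strings.
By invariance and transitivity, the averaged second-order coefficients agree at all nontrivial
strings, and the averaged third-order coefficients agree at all pairs of commuting, distinct,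
nontrivial strings (`exists_clifford_maps_maps`). Sums over all strings are known from completeness
of the Pauli basis, which determines the common values. This yields `Ex_diag_mul` and
`Ex_diag_mul_mul` without the general theory of unitary designs. Hence one estimate is unbiased. For
the traceless part `T` of `O`, the randomness of the snapshot contributes at most `3 tr T² ≤ 3 tr
O²` to the variance. The finitely many repetitions contribute at most `tr O²`, because `m = 2 (d +
1)` cancels one of the two factors `d + 1`. The total `4 tr O²` of `singleLaw_moments` is at most `4
r λ²`.

Amplification. Snapshots are shared between observables, but for each fixed observable the groups
are independent (`cliffordLaw_map_eval`). Chebyshev's inequality inside a group and an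
exponential-moment bound for a bad majority give failure probability at most `2 ^ (-K)`
(`Ex_bad_le`). A union bound, which needs no independence between observables, gives
`clifford_accuracy`.

Resources. `Cost` is a compositional upper bound valid in every run. Sampling takes cubic time in
`n`, which `d` absorbs; each of the `M K B` estimates takes `O(d)` executions. Medians must be found
in linear time to avoid an extra logarithm of `K`, and this is the role of `selectT_spec`. -/

/-! ### Tensor products of one-qubit matrices and Pauli strings -/

/-- The tensor product of `n` one-qubit matrices. -/
def tens {n : ℕ} (A : Fin n → Matrix Bool Bool ℂ) : Op n :=
  Matrix.of fun x y => ∏ i, A i (x i) (y i)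

theorem tens_apply {n : ℕ} (A : Fin n → Matrix Bool Bool ℂ) (x y : Bits n) :
    tens A x y = ∏ i, A i (x i) (y i) := rfl

theorem pauli_eq_tens {n : ℕ} (p : Fin n → Bool × Bool) :
    pauli p = tens fun i => pauliOne (p i) := rfl

theorem sum_bits_prod {n : ℕ} {R : Type} [CommSemiring R] (f : Fin n → Bool → R) :
    ∑ x : Bits n, ∏ i, f i (x i) = ∏ i, ∑ b, f i b := by
  rw [Finset.prod_univ_sum, Fintype.piFinset_univ]

theorem sum_strings_prod {n : ℕ} {R : Type} [CommSemiring R] (f : Fin n → Bool × Bool → R) :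
    ∑ p : Fin n → Bool × Bool, ∏ i, f i (p i) = ∏ i, ∑ b, f i b := by
  rw [Finset.prod_univ_sum, Fintype.piFinset_univ]

theorem tens_mul {n : ℕ} (A B : Fin n → Matrix Bool Bool ℂ) :
    tens A * tens B = tens fun i => A i * B i := by
  ext x y
  simp only [Matrix.mul_apply, tens_apply, ← Finset.prod_mul_distrib]
  exact sum_bits_prod fun i b => A i (x i) b * B i b (y i)

theorem tens_conjTranspose {n : ℕ} (A : Fin n → Matrix Bool Bool ℂ) :
    (tens A)ᴴ = tens fun i => (A i)ᴴ := by
  ext x y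
  simp only [Matrix.conjTranspose_apply, tens_apply, star_prod]

theorem trace_tens {n : ℕ} (A : Fin n → Matrix Bool Bool ℂ) :
    (tens A).trace = ∏ i, (A i).trace := by
  simp only [Matrix.trace, Matrix.diag_apply, tens_apply]
  exact sum_bits_prod fun i b => A i b b

theorem tens_smul {n : ℕ} (s : Fin n → ℂ) (A : Fin n → Matrix Bool Bool ℂ) :
    (tens fun i => s i • A i) = (∏ i, s i) • tens A := by
  ext x y
  simp [tens_apply, Finset.prod_mul_distrib]

theorem prod_ite_eq_ite {ι : Type} [Fintype ι] {α : Type} [DecidableEq α] {R : Type}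
    [CommSemiring R] (c : R) (x y : ι → α) :
    (∏ i, if x i = y i then c else 0) = if x = y then c ^ Fintype.card ι else 0 := by
  split_ifs with h
  · subst h; simp
  · obtain ⟨i, hi⟩ := Function.ne_iff.1 h
    exact Finset.prod_eq_zero (Finset.mem_univ i) (by simp [hi])

theorem pauliOne_apply (a : Bool × Bool) (x y : Bool) : pauliOne a x y =
    if a.1 then (if x = y then 0 else if a.2 then (if x then Complex.I else -Complex.I) else 1)
    else (if x = y then (if a.2 && x then -1 else 1) else 0) := by
  rcases a with ⟨_ | _, _ | _⟩ <;> cases x <;> cases y <;> simp [pauliOne]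

theorem pauliOne_mul_self (a : Bool × Bool) : pauliOne a * pauliOne a = 1 := by
  ext x y
  rcases a with ⟨_ | _, _ | _⟩ <;> cases x <;> cases y <;>
    simp [pauliOne_apply, Matrix.mul_apply]

theorem trace_pauliOne_mul (a b : Bool × Bool) :
    (pauliOne a * pauliOne b).trace = if a = b then 2 else 0 := by
  rcases a with ⟨_ | _, _ | _⟩ <;> rcases b with ⟨_ | _, _ | _⟩ <;>
    (simp [pauliOne_apply, Matrix.mul_apply, Matrix.trace]; try norm_num)

/-- The sign with which two one-qubit Pauli matrices commute. -/
def sgnOne (a b : Bool × Bool) : ℂ := if xor (a.1 && b.2) (a.2 && b.1) then -1 else 1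

theorem pauliOne_mul_comm (a b : Bool × Bool) :
    pauliOne a * pauliOne b = sgnOne a b • (pauliOne b * pauliOne a) := by
  ext x y
  rcases a with ⟨_ | _, _ | _⟩ <;> rcases b with ⟨_ | _, _ | _⟩ <;> cases x <;> cases y <;>
    simp [pauliOne_apply, Matrix.mul_apply, sgnOne]

theorem sum_sgnOne (a : Bool × Bool) :
    ∑ b, sgnOne a b = if a = (false, false) then 4 else 0 := by
  rcases a with ⟨_ | _, _ | _⟩ <;> (simp [sgnOne, Fintype.sum_prod_type]; try norm_num)

/-- Completeness on one qubit: half of `∑ P ⊗ P` is the swap operator. All later expansions in Pauli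
strings are tensor powers of this identity. -/
theorem sum_pauliOne_mul_pauliOne (x y x' y' : Bool) :
    ∑ a, pauliOne a x y * pauliOne a x' y' =
      (if x = y' then 1 else 0) * (if y = x' then 2 else 0) := by
  cases x <;> cases y <;> cases x' <;> cases y' <;>
    (simp [pauliOne_apply, Fintype.sum_prod_type]; try norm_num)

/-- The trivial Pauli string. -/
def pId {n : ℕ} : Fin n → Bool × Bool := fun _ => (false, false)

theorem pauli_pId {n : ℕ} : pauli (pId : Fin n → Bool × Bool) = 1 := by
  ext x y
  simp only [pauli_eq_tens, tens_apply, pId, pauliOne_apply, Matrix.one_apply]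
  simpa using prod_ite_eq_ite (1 : ℂ) x y

theorem pauli_mul_self {n : ℕ} (p : Fin n → Bool × Bool) : pauli p * pauli p = 1 := by
  rw [← pauli_pId]
  simp only [pauli_eq_tens, tens_mul, pauliOne_mul_self]
  rfl

theorem trace_pauli_mul {n : ℕ} (p q : Fin n → Bool × Bool) :
    (pauli p * pauli q).trace = if p = q then 2 ^ n else 0 := by
  simp only [pauli_eq_tens, tens_mul, trace_tens, trace_pauliOne_mul]
  simpa using prod_ite_eq_ite (2 : ℂ) p q

/-- The sign with which two Pauli strings commute. -/
def sgn {n : ℕ} (p q : Fin n → Bool × Bool) : ℂ := ∏ i, sgnOne (p i) (q i)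

theorem pauli_mul_comm {n : ℕ} (p q : Fin n → Bool × Bool) :
    pauli p * pauli q = sgn p q • (pauli q * pauli p) := by
  simp only [pauli_eq_tens, tens_mul, sgn]
  rw [← tens_smul]
  congr 1
  funext i
  exact pauliOne_mul_comm _ _

theorem sgnOne_eq (a b : Bool × Bool) : sgnOne a b = 1 ∨ sgnOne a b = -1 := by
  unfold sgnOne; split_ifs <;> simp

theorem sgn_eq {n : ℕ} (p q : Fin n → Bool × Bool) : sgn p q = 1 ∨ sgn p q = -1 := by
  unfold sgn
  induction (Finset.univ : Finset (Fin n)) using Finset.induction_on with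
  | empty => simp
  | insert i s hi ih =>
    rw [Finset.prod_insert hi]
    rcases ih with h | h <;> rcases sgnOne_eq (p i) (q i) with h' | h' <;> simp [h, h']

theorem sgn_self {n : ℕ} (p : Fin n → Bool × Bool) : sgn p p = 1 :=
  Finset.prod_eq_one fun i _ => by
    rcases p i with ⟨_ | _, _ | _⟩ <;> simp [sgnOne]

theorem sgn_comm {n : ℕ} (p q : Fin n → Bool × Bool) : sgn p q = sgn q p :=
  Finset.prod_congr rfl fun i _ => by
    rcases p i with ⟨_ | _, _ | _⟩ <;> rcases q i with ⟨_ | _, _ | _⟩ <;> simp [sgnOne]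

theorem sgn_pId {n : ℕ} (p : Fin n → Bool × Bool) : sgn p pId = 1 :=
  Finset.prod_eq_one fun i _ => by simp [sgnOne, pId]

/-- A nontrivial string commutes with exactly half of the strings. The sum factorizes over qubits,
and one nontrivial factor makes it vanish. -/
theorem sum_sgn {n : ℕ} {p : Fin n → Bool × Bool} (hp : p ≠ pId) : ∑ q, sgn p q = 0 := by
  unfold sgn
  rw [sum_strings_prod fun i b => sgnOne (p i) b]
  obtain ⟨i, hi⟩ := Function.ne_iff.1 hp
  exact Finset.prod_eq_zero (Finset.mem_univ i) ((sum_sgnOne _).trans (if_neg hi))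

theorem sum_pauli_mul_pauli {n : ℕ} (x y x' y' : Bits n) :
    ∑ p, pauli p x y * pauli p x' y' =
      (if x = y' then 1 else 0) * (if y = x' then 2 ^ n else 0) := by
  simp only [pauli_eq_tens, tens_apply, ← Finset.prod_mul_distrib]
  rw [sum_strings_prod fun i b => pauliOne b (x i) (y i) * pauliOne b (x' i) (y' i)]
  simp only [sum_pauliOne_mul_pauliOne, Finset.prod_mul_distrib, prod_ite_eq_ite, one_pow, Fintype.card_fin]

/-- The Pauli strings are a basis of the operators. -/
theorem sum_trace_mul_pauli {n : ℕ} (A : Op n) :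
    ∑ p, (A * pauli p).trace • pauli p = (2 ^ n : ℂ) • A := by
  ext x y
  simp only [Matrix.sum_apply, Matrix.smul_apply, smul_eq_mul, Matrix.trace, Matrix.diag_apply,
    Matrix.mul_apply, Finset.sum_mul]
  rw [Finset.sum_comm]
  have h : ∀ u v : Bits n, ∑ p, A u v * pauli p v u * pauli p x y =
      A u v * ((if v = y then 1 else 0) * (if u = x then 2 ^ n else 0)) := fun u v => by
    simp only [mul_assoc, ← Finset.mul_sum, sum_pauli_mul_pauli]
  calc _ = ∑ u, ∑ v, ∑ p, A u v * pauli p v u * pauli p x y :=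
        Finset.sum_congr rfl fun u _ => Finset.sum_comm
    _ = _ := by simp only [h]; simp [mul_comm]

/-- Parseval's identity for the Pauli basis; it later determines the common value of the
second-order averages. -/
theorem sum_trace_mul_trace {n : ℕ} (A B : Op n) :
    ∑ p, (A * pauli p).trace * (B * pauli p).trace = 2 ^ n * (A * B).trace := by
  have h := congrArg (fun X => (B * X).trace) (sum_trace_mul_pauli A)
  simp only [Matrix.mul_sum, Matrix.trace_sum, Matrix.mul_smul, Matrix.trace_smul,
    smul_eq_mul] at h
  rw [h, Matrix.trace_mul_comm]

/-- A Pauli string is determined by its matrix up to sign. -/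
theorem pauli_eq_smul {n : ℕ} {p q : Fin n → Bool × Bool} {s : ℂ}
    (h : pauli p = s • pauli q) : p = q ∧ s = 1 := by
  have h2 := trace_pauli_mul p p
  nth_rewrite 1 [h] at h2
  rw [smul_mul_assoc, Matrix.trace_smul, trace_pauli_mul, if_pos rfl, smul_eq_mul] at h2
  have hn : (2 : ℂ) ^ n ≠ 0 := by positivity
  by_cases hpq : q = p
  · rw [if_pos hpq] at h2
    exact ⟨hpq.symm, mul_right_cancel₀ hn (by rw [h2, one_mul])⟩
  · rw [if_neg hpq, mul_zero] at h2
    exact absurd h2.symm hn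

theorem pauli_ne_zero {n : ℕ} (p : Fin n → Bool × Bool) : pauli p ≠ 0 := fun h => by
  have := pauli_mul_self p
  rw [h, zero_mul] at this
  exact zero_ne_one this

/-! ### Conjugation of Pauli strings by Clifford gates -/

theorem Circuit.toMatrix_append {n : ℕ} (c c' : Circuit n) :
    Circuit.toMatrix (c ++ c') = c'.toMatrix * c.toMatrix := by
  induction c with
  | nil => exact (mul_one _).symm
  | cons g c ih =>
    change Circuit.toMatrix (c ++ c') * g.toMatrix = _ * (Circuit.toMatrix c * g.toMatrix)
    rw [ih, mul_assoc]

theorem Circuit.toMatrix_singleton {n : ℕ} (g : Gate n) :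
    Circuit.toMatrix [g] = g.toMatrix := one_mul _

/-- `U` takes the Pauli string `p` to `q`, up to sign. -/
def Maps {n : ℕ} (U : Op n) (p q : Fin n → Bool × Bool) : Prop :=
  U * pauli p * Uᴴ = pauli q ∨ U * pauli p * Uᴴ = -pauli q

theorem Maps.of_smul {n : ℕ} {U : Op n} {p q : Fin n → Bool × Bool} {s : ℂ}
    (hs : s = 1 ∨ s = -1) (h : U * pauli p * Uᴴ = s • pauli q) : Maps U p q := by
  rcases hs with rfl | rfl
  · exact Or.inl (by rw [h, one_smul])
  · exact Or.inr (by rw [h, neg_smul, one_smul])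

theorem Maps.exists_smul {n : ℕ} {U : Op n} {p q : Fin n → Bool × Bool} (h : Maps U p q) :
    ∃ s : ℂ, (s = 1 ∨ s = -1) ∧ U * pauli p * Uᴴ = s • pauli q := by
  rcases h with h | h
  · exact ⟨1, Or.inl rfl, by rw [h, one_smul]⟩
  · exact ⟨-1, Or.inr rfl, by rw [h, neg_smul, one_smul]⟩

theorem conj_mul {n : ℕ} (U V A : Op n) : V * U * A * (V * U)ᴴ = V * (U * A * Uᴴ) * Vᴴ := by
  simp only [Matrix.conjTranspose_mul, mul_assoc]

theorem Maps.mul {n : ℕ} {U V : Op n} {p q r : Fin n → Bool × Bool} (hV : Maps V q r)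
    (hU : Maps U p q) : Maps (V * U) p r := by
  unfold Maps
  rw [conj_mul]
  rcases hU with h | h <;> rcases hV with h' | h' <;> simp [h, h']

theorem Maps.one {n : ℕ} (p : Fin n → Bool × Bool) : Maps (1 : Op n) p p := Or.inl (by simp)

theorem Maps.append {n : ℕ} {c c' : Circuit n} {p q r : Fin n → Bool × Bool}
    (h : Maps c.toMatrix p q) (h' : Maps c'.toMatrix q r) :
    Maps (Circuit.toMatrix (c ++ c')) p r := by
  rw [Circuit.toMatrix_append]
  exact h'.mul h

theorem Gate.toMatrix_one {n : ℕ} (i : Fin n) (u : Matrix.unitaryGroup Bool ℂ) :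
    (Gate.one i u).toMatrix =
      tens (Function.update (fun _ => (1 : Matrix Bool Bool ℂ)) i (u : Matrix Bool Bool ℂ)) := by
  ext x y
  rw [tens_apply, Fintype.prod_eq_mul_prod_subtype_ne _ i, Function.update_self]
  simp only [Gate.toMatrix, Matrix.submatrix_apply, Matrix.kroneckerMap_apply,
    Equiv.funSplitAt_apply]
  congr 1
  rw [Matrix.one_apply]
  have := prod_ite_eq_ite (1 : ℂ) (fun k : {k : Fin n // k ≠ i} => x k) (fun k => y k)
  rw [one_pow] at this
  rw [← this]
  refine Finset.prod_congr rfl fun k _ => ?_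
  rw [Function.update_of_ne k.2, Matrix.one_apply]

theorem Gate.one_conj {n : ℕ} (i : Fin n) (u : Matrix.unitaryGroup Bool ℂ)
    (p : Fin n → Bool × Bool) {a : Bool × Bool} {s : ℂ}
    (h : (u : Matrix Bool Bool ℂ) * pauliOne (p i) * (u : Matrix Bool Bool ℂ)ᴴ =
      s • pauliOne a) :
    (Gate.one i u).toMatrix * pauli p * ((Gate.one i u).toMatrix)ᴴ =
      s • pauli (Function.update p i a) := by
  rw [Gate.toMatrix_one, pauli_eq_tens, pauli_eq_tens, tens_conjTranspose, tens_mul, tens_mul]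
  -- The scalar is spread as a product with `s` at position `i`, so that `tens_smul` can move it
  -- into that tensor factor.
  have hs : s = ∏ k, (Function.update (fun _ => (1 : ℂ)) i s) k := by
    rw [Fintype.prod_eq_mul_prod_subtype_ne _ i, Function.update_self,
      Finset.prod_eq_one fun k _ => Function.update_of_ne k.2 _ _, mul_one]
  rw [hs, ← tens_smul]
  congr 1
  funext k
  by_cases hk : k = i
  · subst hk; simpa using h
  · simp [hk]

/-- The action of the Hadamard gate on qubit `i` on Pauli strings. -/
def actH {n : ℕ} (i : Fin n) (p : Fin n → Bool × Bool) : Fin n → Bool × Bool :=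
  Function.update p i ((p i).2, (p i).1)

/-- The action of the phase gate on qubit `i` on Pauli strings. -/
def actS {n : ℕ} (i : Fin n) (p : Fin n → Bool × Bool) : Fin n → Bool × Bool :=
  Function.update p i ((p i).1, xor (p i).1 (p i).2)

/-- The action of the CNOT gate with control `i` and target `j` on Pauli strings. -/
def actC {n : ℕ} (i j : Fin n) (p : Fin n → Bool × Bool) : Fin n → Bool × Bool :=
  Function.update (Function.update p i ((p i).1, xor (p i).2 (p j).2)) j
    (xor (p i).1 (p j).1, (p j).2)

theorem inv_sqrt_two_mul_self : ((√2 : ℝ) : ℂ)⁻¹ * ((√2 : ℝ) : ℂ)⁻¹ = 2⁻¹ := by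
  rw [← mul_inv, ← Complex.ofReal_mul, Real.mul_self_sqrt (by norm_num)]; norm_num

theorem hadamard_conj (a : Bool × Bool) :
    (hadamard : Matrix Bool Bool ℂ) * pauliOne a * (hadamard : Matrix Bool Bool ℂ)ᴴ =
      (if a.1 && a.2 then -1 else 1 : ℂ) • pauliOne (a.2, a.1) := by
  have h := inv_sqrt_two_mul_self
  ext x y
  rcases a with ⟨_ | _, _ | _⟩ <;> cases x <;> cases y <;>
    simp [hadamard, Matrix.mul_apply, pauliOne_apply] <;>
    first
    | linear_combination 2 * h
    | linear_combination -2 * h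
    | linear_combination 2 * Complex.I * h
    | linear_combination -2 * Complex.I * h

theorem phase_conj (a : Bool × Bool) :
    (phase : Matrix Bool Bool ℂ) * pauliOne a * (phase : Matrix Bool Bool ℂ)ᴴ =
      (if a.1 && a.2 then -1 else 1 : ℂ) • pauliOne (a.1, xor a.1 a.2) := by
  ext x y
  rcases a with ⟨_ | _, _ | _⟩ <;> cases x <;> cases y <;>
    simp [phase, Matrix.mul_apply, pauliOne_apply, Matrix.diagonal]

theorem gH_conj {n : ℕ} (i : Fin n) (p : Fin n → Bool × Bool) :
    Circuit.toMatrix (gH i) * pauli p * (Circuit.toMatrix (gH i))ᴴ =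
      (if (p i).1 && (p i).2 then -1 else 1 : ℂ) • pauli (actH i p) := by
  rw [gH, Circuit.toMatrix_singleton]
  exact Gate.one_conj i hadamard p (hadamard_conj _)

theorem gS_conj {n : ℕ} (i : Fin n) (p : Fin n → Bool × Bool) :
    Circuit.toMatrix (gS i) * pauli p * (Circuit.toMatrix (gS i))ᴴ =
      (if (p i).1 && (p i).2 then -1 else 1 : ℂ) • pauli (actS i p) := by
  rw [gS, Circuit.toMatrix_singleton]
  exact Gate.one_conj i phase p (phase_conj _)

theorem maps_gH {n : ℕ} (i : Fin n) (p : Fin n → Bool × Bool) :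
    Maps (Circuit.toMatrix (gH i)) p (actH i p) :=
  .of_smul (by split_ifs <;> simp) (gH_conj i p)

theorem maps_gS {n : ℕ} (i : Fin n) (p : Fin n → Bool × Bool) :
    Maps (Circuit.toMatrix (gS i)) p (actS i p) :=
  .of_smul (by split_ifs <;> simp) (gS_conj i p)

/-- The permutation of the computational basis made by CNOT. -/
def flipAt {n : ℕ} (i j : Fin n) (x : Bits n) : Bits n := Function.update x j (xor (x i) (x j))

theorem Gate.toMatrix_cnot {n : ℕ} (i j : Fin n) (h : j ≠ i) :
    (Gate.two i j h cnot).toMatrix = Matrix.of fun x y => if flipAt i j x = y then 1 else 0 := by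
  ext x y
  simp only [Gate.toMatrix, Matrix.submatrix_apply, Matrix.kroneckerMap_apply, Matrix.of_apply,
    splitTwo, Equiv.trans_apply, Equiv.prodCongr_apply, Equiv.coe_refl, Prod.map_apply, id_eq,
    Equiv.funSplitAt_apply, Equiv.prodAssoc_symm_apply, cnot, Matrix.one_apply]
  have key : (flipAt i j x = y) ↔ (x i = y i ∧ x j = xor (y i) (y j)) ∧
      ((fun k : {k : {k : Fin n // k ≠ i} // k ≠ ⟨j, h⟩} => x k.1.1) =
        fun k : {k : {k : Fin n // k ≠ i} // k ≠ ⟨j, h⟩} => y k.1.1) := by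
    constructor
    · rintro rfl
      refine ⟨⟨by simp [flipAt, h.symm], by simp [flipAt, h.symm]⟩, ?_⟩
      funext ⟨k, hk⟩
      have : (k : Fin n) ≠ j := fun e => hk (Subtype.ext e)
      simp [flipAt, this]
    · rintro ⟨⟨h1, h2⟩, h3⟩
      funext k
      by_cases hj : k = j
      · subst hj; simp [flipAt, h1, h2]
      · by_cases hi : k = i
        · subst hi; simp [flipAt, hj, h1]
        · have := congrFun h3 ⟨⟨k, hi⟩, fun e => hj (congrArg Subtype.val e)⟩
          simpa [flipAt, hj] using this
  rw [if_congr key rfl rfl, ite_zero_mul_ite_zero, mul_one]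

theorem cnot_pauliOne (a b : Bool × Bool) : ∃ s : ℂ, (s = 1 ∨ s = -1) ∧ ∀ x x' y y' : Bool,
    pauliOne a x y * pauliOne b (xor x x') (xor y y') =
      s * (pauliOne (a.1, xor a.2 b.2) x y * pauliOne (xor a.1 b.1, b.2) x' y') := by
  -- The sign is negative exactly for `X ⊗ Z` and `Y ⊗ Y`, which CNOT exchanges.
  refine ⟨if a.1 && b.2 && (a.2 == b.1) then -1 else 1, by split_ifs <;> simp, ?_⟩
  intro x x' y y'
  rcases a with ⟨_ | _, _ | _⟩ <;> rcases b with ⟨_ | _, _ | _⟩ <;> cases x <;> cases x' <;>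
    cases y <;> cases y' <;> simp [pauliOne_apply]

theorem Gate.cnot_conj_apply {n : ℕ} (i j : Fin n) (h : j ≠ i) (A : Op n) (x y : Bits n) :
    ((Gate.two i j h cnot).toMatrix * A * ((Gate.two i j h cnot).toMatrix)ᴴ) x y =
      A (flipAt i j x) (flipAt i j y) := by
  simp [Gate.toMatrix_cnot, Matrix.mul_apply, Matrix.conjTranspose_apply]

theorem maps_cnot {n : ℕ} (i j : Fin n) (h : j ≠ i) (p : Fin n → Bool × Bool) :
    Maps (Gate.two i j h cnot).toMatrix p (actC i j p) := by
  obtain ⟨s, hs, hp⟩ := cnot_pauliOne (p i) (p j)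
  refine .of_smul hs ?_
  ext x y
  rw [Gate.cnot_conj_apply, Matrix.smul_apply, smul_eq_mul]
  simp only [pauli_eq_tens, tens_apply]
  have hi : i ∈ (Finset.univ : Finset (Fin n)) := Finset.mem_univ i
  have hj : j ∈ (Finset.univ : Finset (Fin n)).erase i := Finset.mem_erase.2 ⟨h, Finset.mem_univ j⟩
  rw [← Finset.mul_prod_erase _ _ hi, ← Finset.mul_prod_erase _ _ hj,
    ← Finset.mul_prod_erase _ _ hi, ← Finset.mul_prod_erase _ _ hj, ← mul_assoc, ← mul_assoc,
    ← mul_assoc]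
  congr 1
  · have := hp (x i) (x j) (y i) (y j)
    simpa [flipAt, actC, h.symm, mul_assoc] using this
  · refine Finset.prod_congr rfl fun k hk => ?_
    simp only [Finset.mem_erase, Finset.mem_univ, and_true] at hk
    simp [flipAt, actC, hk.1, hk.2]

theorem maps_gCNOT {n : ℕ} {i j : Fin n} (h : j ≠ i) (p : Fin n → Bool × Bool) :
    Maps (Circuit.toMatrix (gCNOT i j)) p (actC i j p) := by
  rw [gCNOT, dif_pos h, Circuit.toMatrix_singleton]
  exact maps_cnot i j h p

theorem gCNOT_self {n : ℕ} (i : Fin n) : gCNOT i i = [] := by simp [gCNOT]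

/-! ### The Clifford group -/

theorem IsClifford.mul {n : ℕ} {U V : Op n} (hU : IsClifford U) (hV : IsClifford V) :
    IsClifford (U * V) := by
  refine ⟨mul_mem hU.1 hV.1, fun p => ?_⟩
  obtain ⟨q, hq⟩ := hV.2 p
  obtain ⟨r, hr⟩ := hU.2 q
  exact ⟨r, Maps.mul hr hq⟩

theorem IsClifford.one {n : ℕ} : IsClifford (1 : Op n) := ⟨one_mem _, fun p => ⟨p, Maps.one p⟩⟩

theorem conjTranspose_mul_self_of_mem {n : ℕ} {U : Op n} (hU : U ∈ unitary (Op n)) :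
    Uᴴ * U = 1 := (Unitary.mem_iff.1 hU).1

theorem mul_conjTranspose_self_of_mem {n : ℕ} {U : Op n} (hU : U ∈ unitary (Op n)) :
    U * Uᴴ = 1 := (Unitary.mem_iff.1 hU).2

theorem conjTranspose_mem {n : ℕ} {U : Op n} (hU : U ∈ unitary (Op n)) :
    Uᴴ ∈ unitary (Op n) := Unitary.star_mem hU

theorem conj_conj {n : ℕ} {U : Op n} (hU : U ∈ unitary (Op n)) (A : Op n) :
    Uᴴ * (U * A * Uᴴ) * U = A := by
  have h := conjTranspose_mul_self_of_mem hU
  calc _ = (Uᴴ * U) * A * (Uᴴ * U) := by simp only [mul_assoc]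
    _ = A := by rw [h, one_mul, mul_one]

theorem Maps.conjTranspose {n : ℕ} {U : Op n} (hU : U ∈ unitary (Op n))
    {p q : Fin n → Bool × Bool} (h : Maps U p q) : Maps Uᴴ q p := by
  obtain ⟨s, hs, h⟩ := h.exists_smul
  refine .of_smul hs ?_
  have h1 := conj_conj hU (pauli p)
  rw [h, Matrix.mul_smul, Matrix.smul_mul] at h1
  rw [Matrix.conjTranspose_conjTranspose, ← h1, smul_smul]
  rcases hs with rfl | rfl <;> simp

theorem Maps.unique {n : ℕ} {U : Op n} {p q r : Fin n → Bool × Bool} (h : Maps U p q)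
    (h' : Maps U p r) : q = r := by
  obtain ⟨s, hs, h⟩ := h.exists_smul
  obtain ⟨s', hs', h'⟩ := h'.exists_smul
  rw [h] at h'
  refine (pauli_eq_smul (s := s * s') ?_).1
  rw [mul_smul, ← h', smul_smul]
  rcases hs with rfl | rfl <;> simp

theorem Maps.injective {n : ℕ} {U : Op n} (hU : U ∈ unitary (Op n))
    {p q r : Fin n → Bool × Bool} (h : Maps U p r) (h' : Maps U q r) : p = q :=
  (h.conjTranspose hU).unique (h'.conjTranspose hU)

/-- Conjugation by `U` induces an injective map on the finite set of strings. It is therefore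
surjective, so every string has a preimage to which `Uᴴ` sends it. -/
theorem IsClifford.conjTranspose {n : ℕ} {U : Op n} (hU : IsClifford U) : IsClifford Uᴴ := by
  refine ⟨conjTranspose_mem hU.1, ?_⟩
  choose f hf using hU.2
  have hinj : Function.Injective f := fun p q hpq =>
    Maps.injective hU.1 (hf p) (by rw [hpq]; exact hf q)
  intro q
  obtain ⟨p, rfl⟩ := Finite.surjective_of_injective hinj q
  exact ⟨p, Maps.conjTranspose hU.1 (hf p)⟩

/-- Conjugation is multiplicative and the signs of the two images enter both orders of the product
alike, so commutation relations are preserved. This invariant restricts the possible images of `X`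
and `Z`. -/
theorem Maps.sgn_eq {n : ℕ} {U : Op n} (hU : U ∈ unitary (Op n))
    {p q p' q' : Fin n → Bool × Bool} (h : Maps U p p') (h' : Maps U q q') :
    sgn p q = sgn p' q' := by
  obtain ⟨s, hs, h⟩ := h.exists_smul
  obtain ⟨s', hs', h'⟩ := h'.exists_smul
  have hmul : ∀ A B : Op n, U * A * Uᴴ * (U * B * Uᴴ) = U * (A * B) * Uᴴ := fun A B => by
    calc _ = U * A * (Uᴴ * U) * B * Uᴴ := by simp only [mul_assoc]
      _ = _ := by rw [conjTranspose_mul_self_of_mem hU]; simp only [mul_assoc, mul_one]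
  have h1 : (s * s') • (pauli p' * pauli q') = (s * s') • sgn p q • (pauli q' * pauli p') := by
    have := hmul (pauli p) (pauli q)
    rw [h, h', pauli_mul_comm p q, Matrix.mul_smul U (sgn p q), Matrix.smul_mul (sgn p q), ← hmul,
      h, h'] at this
    simp only [smul_mul_assoc, mul_smul_comm, smul_smul] at this ⊢
    rw [mul_comm s s', this]
    congr 1
    ring
  have hss : s * s' ≠ 0 := by rcases hs with rfl | rfl <;> rcases hs' with rfl | rfl <;> simp
  have h2 := smul_right_injective (Op n) hss h1
  rw [pauli_mul_comm p' q'] at h2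
  have hne : pauli q' * pauli p' ≠ 0 := fun e => by
    apply pauli_ne_zero p'
    have := congrArg (fun X => pauli q' * X) e
    simpa [← mul_assoc, pauli_mul_self] using this
  exact (smul_left_injective ℂ hne h2).symm

theorem Maps.pId_eq {n : ℕ} {U : Op n} (hU : U ∈ unitary (Op n)) : Maps U pId pId :=
  Or.inl (by rw [pauli_pId, mul_one, mul_conjTranspose_self_of_mem hU])

/-- The gates used by the sampler. -/
inductive IsCliffordGate {n : ℕ} : Gate n → Prop
  | hadamard (i : Fin n) : IsCliffordGate (.one i hadamard)
  | phase (i : Fin n) : IsCliffordGate (.one i phase)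
  | cnot (i j : Fin n) (h : j ≠ i) : IsCliffordGate (.two i j h cnot)

theorem IsCliffordGate.isClifford {n : ℕ} {g : Gate n} (h : IsCliffordGate g) :
    IsClifford g.toMatrix := by
  refine ⟨g.toMatrix_mem, fun p => ?_⟩
  cases h with
  | hadamard i =>
    have := maps_gH i p
    rw [gH, Circuit.toMatrix_singleton] at this
    exact ⟨_, this⟩
  | phase i =>
    have := maps_gS i p
    rw [gS, Circuit.toMatrix_singleton] at this
    exact ⟨_, this⟩
  | cnot i j h => exact ⟨_, maps_cnot i j h p⟩

/-- Circuits of Hadamard, phase and CNOT gates. -/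
def IsCliffordCircuit {n : ℕ} (c : Circuit n) : Prop := ∀ g ∈ c, IsCliffordGate g

theorem IsCliffordCircuit.isClifford {n : ℕ} {c : Circuit n} (h : IsCliffordCircuit c) :
    IsClifford c.toMatrix := by
  induction c with
  | nil => exact .one
  | cons g c ih =>
    exact (ih fun g' hg' => h g' (List.mem_cons_of_mem _ hg')).mul
      (h g List.mem_cons_self).isClifford

theorem IsCliffordCircuit.nil {n : ℕ} : IsCliffordCircuit ([] : Circuit n) := by
  simp [IsCliffordCircuit]

theorem IsCliffordCircuit.append {n : ℕ} {c c' : Circuit n} (h : IsCliffordCircuit c)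
    (h' : IsCliffordCircuit c') : IsCliffordCircuit (c ++ c') := fun g hg =>
  (List.mem_append.1 hg).elim (h g) (h' g)

theorem IsCliffordCircuit.flatMap {n : ℕ} {α : Type} {l : List α} {f : α → Circuit n}
    (h : ∀ a, IsCliffordCircuit (f a)) : IsCliffordCircuit (l.flatMap f) := fun g hg => by
  obtain ⟨a, _, ha⟩ := List.mem_flatMap.1 hg
  exact h a g ha

theorem isCliffordCircuit_gH {n : ℕ} (i : Fin n) : IsCliffordCircuit (gH i) := fun g hg => by
  rw [List.mem_singleton.1 hg]; exact .hadamard i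

theorem isCliffordCircuit_gS {n : ℕ} (i : Fin n) : IsCliffordCircuit (gS i) := fun g hg => by
  rw [List.mem_singleton.1 hg]; exact .phase i

theorem isCliffordCircuit_gCNOT {n : ℕ} (i j : Fin n) : IsCliffordCircuit (gCNOT i j) := by
  unfold gCNOT
  split_ifs with h
  · intro g hg; rw [List.mem_singleton.1 hg]; exact .cnot i j h
  · exact .nil

theorem isCliffordCircuit_zTo {n : ℕ} (a : Fin (n + 1) → Bool × Bool) :
    IsCliffordCircuit (zTo a) := by
  unfold zTo
  refine ((((isCliffordCircuit_gCNOT _ _).append (isCliffordCircuit_gCNOT _ _)).append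
    (isCliffordCircuit_gCNOT _ _)).append (.flatMap fun i => ?_)).append (.flatMap fun i => ?_)
  · split_ifs
    exacts [isCliffordCircuit_gCNOT _ _, .nil]
  · split_ifs
    exacts [(isCliffordCircuit_gH _).append (isCliffordCircuit_gS _), isCliffordCircuit_gH _, .nil]

theorem isCliffordCircuit_xTo {n : ℕ} (z : Bool) (q : Fin n → Bool × Bool) :
    IsCliffordCircuit (xTo z q) := by
  unfold xTo
  refine .append (.flatMap fun i => ?_) ?_
  · rcases q i with ⟨_ | _, _ | _⟩
    exacts [.nil, (isCliffordCircuit_gCNOT _ _).append (isCliffordCircuit_gH _),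
      isCliffordCircuit_gCNOT _ _, (isCliffordCircuit_gCNOT _ _).append (isCliffordCircuit_gS _)]
  · split_ifs
    exacts [isCliffordCircuit_gS _, .nil]

theorem isCliffordCircuit_pauliZero {n : ℕ} (s t : Bool) :
    IsCliffordCircuit (pauliZero s t : Circuit (n + 1)) := by
  unfold pauliZero
  refine .append ?_ ?_
  · split_ifs
    exacts [(isCliffordCircuit_gS _).append (isCliffordCircuit_gS _), .nil]
  · split_ifs
    exacts [(((isCliffordCircuit_gH _).append (isCliffordCircuit_gS _)).append
      (isCliffordCircuit_gS _)).append (isCliffordCircuit_gH _), .nil]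

theorem IsCliffordCircuit.map_shift {n : ℕ} {c : Circuit n} (h : IsCliffordCircuit c) :
    IsCliffordCircuit (c.map Gate.shift) := fun g hg => by
  obtain ⟨g', hg', rfl⟩ := List.mem_map.1 hg
  cases h g' hg' with
  | hadamard i => exact .hadamard _
  | phase i => exact .phase _
  | cnot i j h => exact .cnot _ _ _

/-! ### The building blocks of the sampler -/

/-- `Z` on qubit `i`. -/
def pZ {n : ℕ} (i : Fin n) : Fin n → Bool × Bool := fun k => (false, decide (k = i))

/-- `X` on qubit `i`. -/
def pX {n : ℕ} (i : Fin n) : Fin n → Bool × Bool := fun k => (decide (k = i), false)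

theorem pZ_ne_pId {n : ℕ} (i : Fin n) : pZ i ≠ pId := fun h => by
  simpa [pZ, pId] using congrFun h i

/-- A loop invariant for circuits assembled qubit by qubit: `σ l` is the string reached after the
prefix `l`. Absence of duplicates guarantees that the next index has not been processed before. -/
theorem maps_flatMap {n : ℕ} {α : Type} {f : α → Circuit n} (σ : List α → Fin n → Bool × Bool)
    (h : ∀ l a, a ∉ l → Maps (f a).toMatrix (σ l) (σ (l ++ [a]))) {l : List α}
    (hl : l.Nodup) : Maps (Circuit.toMatrix (l.flatMap f)) (σ []) (σ l) := by
  induction l using List.reverseRecOn with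
  | nil => exact Maps.one _
  | append_singleton l a ih =>
    rw [List.nodup_append] at hl
    rw [List.flatMap_append, List.flatMap_singleton]
    exact (ih hl.1).append (h l a fun ha => hl.2.2 a ha a (by simp) rfl)

/-- Three alternating CNOTs swap two qubits. When `t = 0` all three are empty circuits. -/
theorem maps_swap {n : ℕ} (t : Fin (n + 1)) :
    Maps (Circuit.toMatrix (gCNOT 0 t ++ gCNOT t 0 ++ gCNOT 0 t)) (pZ 0) (pZ t) := by
  by_cases ht : t = 0
  · subst ht; simp only [gCNOT_self]; exact Maps.one _
  · have h1 : actC 0 t (pZ 0) = pZ 0 := by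
      funext k
      by_cases hk : k = t
      · subst hk; simp [actC, pZ, ht]
      · by_cases hk0 : k = 0
        · subst hk0; simp [actC, pZ, ht, hk]
        · simp [actC, pZ, hk, hk0]
    have h2 : actC 0 t (actC t 0 (pZ 0)) = pZ t := by
      funext k
      by_cases hk : k = t
      · subst hk; simp [actC, pZ, ht]
      · by_cases hk0 : k = 0
        · subst hk0; simp [actC, pZ, ht, hk]
        · simp [actC, pZ, hk, hk0]
    have h3 := (maps_gCNOT ht (pZ 0)).append (maps_gCNOT (Ne.symm ht) (actC 0 t (pZ 0)))
    have h4 := h3.append (maps_gCNOT ht _)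
    rwa [h1, h2] at h4

/-- A CNOT propagates `Z` from its target to its control, so the common target `t` spreads its `Z`
over the whole support. The turn of `t` itself is the empty circuit. -/
theorem maps_fanIn {n : ℕ} (t : Fin n) (ν : Fin n → Bool) (ht : ν t = true) :
    Maps (Circuit.toMatrix ((List.finRange n).flatMap
      fun i => if ν i then gCNOT i t else [])) (pZ t) (fun k => (false, ν k)) := by
  have h := maps_flatMap (f := fun i => if ν i then gCNOT i t else [])
    (fun l k => (false, decide (k = t) || (decide (k ∈ l) && ν k))) ?_ (List.nodup_finRange n)
  · convert h using 1
    · funext k; simp [pZ]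
    · funext k
      by_cases hk : k = t
      · subst hk; simp [ht]
      · simp [hk]
  · intro l i hi
    cases hν : ν i with
    | false =>
      have : (fun k => (false, decide (k = t) || (decide (k ∈ l ++ [i]) && ν k))) =
          fun k => (false, decide (k = t) || (decide (k ∈ l) && ν k)) := by
        funext k
        by_cases hk : k = i
        · subst hk; simp [hν]
        · simp [hk]
      rw [this]
      exact Maps.one _
    | true =>
      by_cases hit : i = t
      · subst hit
        have : (fun k => (false, decide (k = i) || (decide (k ∈ l ++ [i]) && ν k))) =
            fun k => (false, decide (k = i) || (decide (k ∈ l) && ν k)) := by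
          funext k
          by_cases hk : k = i
          · subst hk; simp
          · simp [hk]
        rw [this]
        simp only [gCNOT_self, if_true]
        exact Maps.one _
      · have := maps_gCNOT (Ne.symm hit) (fun k => (false, decide (k = t) || (decide (k ∈ l) && ν k)))
        simp only [if_true]
        convert this using 1
        funext k
        by_cases hk : k = t
        · subst hk; simp [actC]
        · by_cases hk' : k = i
          · subst hk'; simp [actC, hi, hν, hk]
          · simp [actC, hk, hk']

/-- On each qubit of the support, Hadamard takes `Z` to `X`, and a subsequent phase gate takes `X`
to `Y`. -/
theorem maps_localBasis {n : ℕ} (a : Fin n → Bool × Bool) :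
    Maps (Circuit.toMatrix ((List.finRange n).flatMap fun i =>
      if (a i).1 then (if (a i).2 then gH i ++ gS i else gH i) else []))
      (fun k => (false, (a k).1 || (a k).2)) a := by
  have h := maps_flatMap (f := fun i =>
      if (a i).1 then (if (a i).2 then gH i ++ gS i else gH i) else [])
    (fun l k => if k ∈ l then a k else (false, (a k).1 || (a k).2)) ?_ (List.nodup_finRange n)
  · simpa using h
  · intro l i hi
    set σ : Fin n → Bool × Bool := fun k => if k ∈ l then a k else (false, (a k).1 || (a k).2)
      with hσ
    have hσi : σ i = (false, (a i).1 || (a i).2) := by simp [hσ, hi]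
    have hu : (fun k => if k ∈ l ++ [i] then a k else (false, (a k).1 || (a k).2)) =
        Function.update σ i (a i) := by
      funext k
      by_cases hk : k = i
      · subst hk; simp
      · simp [hk, hσ]
    rw [hu]
    rcases hai : a i with ⟨_ | _, _ | _⟩ <;> rw [hai] at hσi <;> simp only [Bool.false_eq_true,
      if_true, if_false]
    · rw [Function.update_eq_self_iff.2 (by rw [hσi]; rfl)]; exact Maps.one _
    · rw [Function.update_eq_self_iff.2 (by rw [hσi]; rfl)]; exact Maps.one _
    · have := maps_gH i σ
      rwa [actH, hσi] at this
    · have := (maps_gH i σ).append (maps_gS i _)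
      rwa [actH, hσi, actS, Function.update_self, Function.update_idem] at this

theorem maps_zTo {n : ℕ} {a : Fin (n + 1) → Bool × Bool} (ha : a ≠ pId) :
    Maps (Circuit.toMatrix (zTo a)) (pZ 0) a := by
  -- Nontriviality of `a` makes the search succeed, so the default value in `zTo` is never used.
  obtain ⟨t, ht⟩ : ∃ t, (List.finRange (n + 1)).find? (fun i => (a i).1 || (a i).2) = some t := by
    rw [← Option.isSome_iff_exists, List.find?_isSome]
    obtain ⟨i, hi⟩ := Function.ne_iff.1 ha
    refine ⟨i, List.mem_finRange i, ?_⟩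
    rcases hai : a i with ⟨_ | _, _ | _⟩ <;> simp_all [pId]
  have hat := List.find?_some ht
  unfold zTo
  simp only [ht, Option.getD_some]
  exact ((maps_swap t).append (maps_fanIn t _ hat)).append (maps_localBasis a)

/-- Qubit `0` is only ever a control or subject to a phase gate, both diagonal on that qubit. -/
theorem maps_xTo_pZ {n : ℕ} (z : Bool) (q : Fin n → Bool × Bool) :
    Maps (Circuit.toMatrix (xTo z q)) (pZ 0) (pZ 0) := by
  have hC : ∀ i : Fin n, Maps (Circuit.toMatrix (gCNOT 0 i.succ)) (pZ 0) (pZ 0) := fun i => by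
    have h := maps_gCNOT (Fin.succ_ne_zero i) (pZ 0)
    have h' : actC 0 i.succ (pZ 0) = pZ 0 := by
      funext k
      by_cases hk : k = i.succ
      · subst hk; simp [actC, pZ]
      · by_cases hk' : k = 0
        · subst hk'; simp [actC, pZ, hk]
        · simp [actC, hk, hk']
    rwa [h'] at h
  have hS : ∀ i : Fin (n + 1), Maps (Circuit.toMatrix (gS i)) (pZ 0) (pZ 0) := fun i => by
    have h := maps_gS i (pZ 0)
    rwa [actS, Function.update_eq_self_iff.2 (by simp [pZ])] at h
  have hH : ∀ i : Fin n, Maps (Circuit.toMatrix (gH i.succ)) (pZ 0) (pZ 0) := fun i => by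
    have h := maps_gH i.succ (pZ 0)
    rwa [actH, Function.update_eq_self_iff.2 (by simp [pZ])] at h
  unfold xTo
  refine Maps.append (q := pZ 0) (maps_flatMap (fun _ => pZ 0) (fun l i _ => ?_)
    (List.nodup_finRange n)) ?_
  · rcases q i with ⟨_ | _, _ | _⟩
    exacts [Maps.one _, (hC i).append (hH i), hC i, (hC i).append (hS _)]
  · split_ifs
    exacts [hS 0, Maps.one _]

/-- A CNOT copies `X` from its control to its target; a local phase gate or Hadamard then turns the
copy into `Y` or `Z`. -/
theorem maps_xTo_pX {n : ℕ} (z : Bool) (q : Fin n → Bool × Bool) :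
    Maps (Circuit.toMatrix (xTo z q)) (pX 0)
      (Fin.cons (true, z) q : Fin (n + 1) → Bool × Bool) := by
  unfold xTo
  have h := maps_flatMap (f := fun i : Fin n =>
    match q i with
    | (false, false) => []
    | (true, false) => gCNOT 0 i.succ
    | (true, true) => gCNOT 0 i.succ ++ gS i.succ
    | (false, true) => gCNOT 0 i.succ ++ gH i.succ)
    (fun l => (Fin.cons (true, false) (fun i => if i ∈ l then q i else (false, false)) :
      Fin (n + 1) → Bool × Bool)) ?_ (List.nodup_finRange n)
  · have h0 : (Fin.cons (true, false) (fun i => if i ∈ ([] : List (Fin n)) then q i else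
        (false, false)) : Fin (n + 1) → Bool × Bool) = pX 0 := by
      funext k
      refine Fin.cases ?_ (fun k => ?_) k <;> simp [pX]
    rw [h0] at h
    refine h.append ?_
    simp only [List.mem_finRange, if_true]
    cases z with
    | false => exact Maps.one _
    | true =>
      have := maps_gS 0 (Fin.cons (true, false) q : Fin (n + 1) → Bool × Bool)
      simpa [actS] using this
  · intro l i hi
    set σ : Fin (n + 1) → Bool × Bool :=
      Fin.cons (true, false) (fun i => if i ∈ l then q i else (false, false)) with hσ
    have hσi : σ i.succ = (false, false) := by simp [hσ, hi]
    have hσ0 : σ 0 = (true, false) := rfl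
    have hu : (Fin.cons (true, false) (fun k => if k ∈ l ++ [i] then q k else (false, false)) :
        Fin (n + 1) → Bool × Bool) = Function.update σ i.succ (q i) := by
      funext k
      refine Fin.cases ?_ (fun k => ?_) k
      · rw [Function.update_of_ne (Fin.succ_ne_zero i).symm]; rfl
      · by_cases hk : k = i
        · subst hk; simp
        · simp [hk, hσ]
    rw [hu]
    have hC : Maps (Circuit.toMatrix (gCNOT 0 i.succ)) σ
        (Function.update σ i.succ (true, false)) := by
      have := maps_gCNOT (Fin.succ_ne_zero i) σ
      rwa [actC, hσi, hσ0, Function.update_eq_self_iff (a := (0 : Fin (n + 1))).2 (by rw [hσ0]; rfl)]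
        at this
    rcases hqi : q i with ⟨_ | _, _ | _⟩ <;> simp only
    · rw [Function.update_eq_self_iff.2 (by rw [hσi])]; exact Maps.one _
    · have := hC.append (maps_gH i.succ _)
      rwa [actH, Function.update_self, Function.update_idem] at this
    · exact hC
    · have := hC.append (maps_gS i.succ _)
      rwa [actS, Function.update_self, Function.update_idem] at this

theorem conj_append {n : ℕ} {c c' : Circuit n} {p q r : Fin n → Bool × Bool} {s s' : ℂ}
    (h : c.toMatrix * pauli p * c.toMatrixᴴ = s • pauli q)
    (h' : c'.toMatrix * pauli q * c'.toMatrixᴴ = s' • pauli r) :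
    Circuit.toMatrix (c ++ c') * pauli p * (Circuit.toMatrix (c ++ c'))ᴴ =
      (s * s') • pauli r := by
  rw [Circuit.toMatrix_append, conj_mul, h, Matrix.mul_smul, Matrix.smul_mul, h', smul_smul]

/-- The sign `(-1) ^ b`. -/
def bsign (b : Bool) : ℂ := if b then -1 else 1

theorem bsign_injective : Function.Injective bsign := by
  intro a b
  cases a <;> cases b <;> norm_num [bsign]

theorem nil_conj {n : ℕ} (p : Fin n → Bool × Bool) :
    Circuit.toMatrix ([] : Circuit n) * pauli p * (Circuit.toMatrix ([] : Circuit n))ᴴ =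
      (1 : ℂ) • pauli p := by
  simp [Circuit.toMatrix]

/-- Two phase gates make `Z`, and Hadamards around them make `X`. Only the `X` part flips the sign
of `Z`; exact signs matter here because they identify `s` and `t`. -/
theorem pauliZero_conj_pZ {n : ℕ} (s t : Bool) :
    Circuit.toMatrix (pauliZero s t : Circuit (n + 1)) * pauli (pZ 0) *
      (Circuit.toMatrix (pauliZero s t : Circuit (n + 1)))ᴴ = bsign s • pauli (pZ 0) := by
  have hS : actS 0 (pZ 0 : Fin (n + 1) → Bool × Bool) = pZ 0 := by
    rw [actS, Function.update_eq_self_iff.2 (by simp [pZ])]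
  have hXX : actS 0 (actS 0 (actH 0 (pZ 0 : Fin (n + 1) → Bool × Bool))) = actH 0 (pZ 0) := by
    simp [actS, actH, pZ]
  have hHH : actH 0 (actH 0 (pZ 0 : Fin (n + 1) → Bool × Bool)) = pZ 0 := by
    simp [actH]
  have h1 : Circuit.toMatrix (if t then gS 0 ++ gS 0 else [] : Circuit (n + 1)) * pauli (pZ 0) *
      (Circuit.toMatrix (if t then gS 0 ++ gS 0 else [] : Circuit (n + 1)))ᴴ =
      (1 : ℂ) • pauli (pZ 0) := by
    cases t with
    | false => exact nil_conj _
    | true =>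
      have := conj_append (gS_conj 0 (pZ 0 : Fin (n + 1) → Bool × Bool)) (gS_conj 0 _)
      rw [hS, hS] at this
      simpa [pZ] using this
  have h2 : Circuit.toMatrix (if s then gH 0 ++ gS 0 ++ gS 0 ++ gH 0 else [] : Circuit (n + 1)) *
      pauli (pZ 0) *
      (Circuit.toMatrix (if s then gH 0 ++ gS 0 ++ gS 0 ++ gH 0 else [] : Circuit (n + 1)))ᴴ =
      bsign s • pauli (pZ 0) := by
    cases s with
    | false => exact nil_conj _
    | true =>
      have := conj_append (conj_append (conj_append (gH_conj 0 (pZ 0 : Fin (n + 1) → Bool × Bool))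
        (gS_conj 0 _)) (gS_conj 0 _)) (gH_conj 0 _)
      rw [hXX, hHH] at this
      simpa [pZ, actH, actS, bsign] using this
  have := conj_append h1 h2
  rwa [one_mul] at this

theorem pauliZero_conj_pX {n : ℕ} (s t : Bool) :
    Circuit.toMatrix (pauliZero s t : Circuit (n + 1)) * pauli (pX 0) *
      (Circuit.toMatrix (pauliZero s t : Circuit (n + 1)))ᴴ = bsign t • pauli (pX 0) := by
  have hSS : actS 0 (actS 0 (pX 0 : Fin (n + 1) → Bool × Bool)) = pX 0 := by
    simp [actS, pX]
  have hSH : actS 0 (actH 0 (pX 0 : Fin (n + 1) → Bool × Bool)) = actH 0 (pX 0) := by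
    simp [actS, actH, pX]
  have hHH : actH 0 (actH 0 (pX 0 : Fin (n + 1) → Bool × Bool)) = pX 0 := by
    simp [actH]
  have h1 : Circuit.toMatrix (if t then gS 0 ++ gS 0 else [] : Circuit (n + 1)) * pauli (pX 0) *
      (Circuit.toMatrix (if t then gS 0 ++ gS 0 else [] : Circuit (n + 1)))ᴴ =
      bsign t • pauli (pX 0) := by
    cases t with
    | false => exact nil_conj _
    | true =>
      have := conj_append (gS_conj 0 (pX 0 : Fin (n + 1) → Bool × Bool)) (gS_conj 0 _)
      rw [hSS] at this
      simpa [pX, actS, bsign] using this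
  have h2 : Circuit.toMatrix (if s then gH 0 ++ gS 0 ++ gS 0 ++ gH 0 else [] : Circuit (n + 1)) *
      pauli (pX 0) *
      (Circuit.toMatrix (if s then gH 0 ++ gS 0 ++ gS 0 ++ gH 0 else [] : Circuit (n + 1)))ᴴ =
      (1 : ℂ) • pauli (pX 0) := by
    cases s with
    | false => exact nil_conj _
    | true =>
      have := conj_append (conj_append (conj_append (gH_conj 0 (pX 0 : Fin (n + 1) → Bool × Bool))
        (gS_conj 0 _)) (gS_conj 0 _)) (gH_conj 0 _)
      rw [hSH, hSH, hHH] at this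
      simpa [pX, actH] using this
  have := conj_append h1 h2
  rwa [mul_one] at this

/-! ### Operators on all qubits but the first -/

/-- The operator `W` on the last `n` of `n + 1` qubits. -/
def lift {n : ℕ} (W : Op n) : Op (n + 1) :=
  Matrix.of fun x y => if x 0 = y 0 then W (Fin.tail x) (Fin.tail y) else 0

theorem lift_cons {n : ℕ} (W : Op n) (b b' : Bool) (x y : Bits n) :
    lift W (Fin.cons b x : Bits (n + 1)) (Fin.cons b' y : Bits (n + 1)) =
      if b = b' then W x y else 0 := rfl

theorem sum_bits_succ {n : ℕ} {R : Type} [AddCommMonoid R] (f : Bits (n + 1) → R) :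
    ∑ x, f x = ∑ b, ∑ t : Bits n, f (Fin.cons b t : Bits (n + 1)) := by
  rw [← (Fin.consEquiv fun _ : Fin (n + 1) => Bool).sum_comp, Fintype.sum_prod_type]
  rfl

theorem op_ext_cons {n : ℕ} {A B : Op (n + 1)}
    (h : ∀ (b b' : Bool) (x y : Bits n), A (Fin.cons b x : Bits (n + 1)) (Fin.cons b' y) =
      B (Fin.cons b x : Bits (n + 1)) (Fin.cons b' y)) : A = B := by
  ext x y
  rw [← Fin.cons_self_tail x, ← Fin.cons_self_tail y]
  exact h _ _ _ _

theorem lift_mul {n : ℕ} (A B : Op n) : lift (A * B) = lift A * lift B := by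
  refine op_ext_cons fun b b' x y => ?_
  simp only [Matrix.mul_apply, sum_bits_succ, lift_cons]
  cases b <;> cases b' <;> simp

theorem lift_one {n : ℕ} : lift (1 : Op n) = 1 := by
  refine op_ext_cons fun b b' x y => ?_
  rw [lift_cons, Matrix.one_apply, Matrix.one_apply]
  by_cases hb : b = b' <;> simp [Fin.cons_inj, hb]

theorem lift_conjTranspose {n : ℕ} (A : Op n) : (lift A)ᴴ = lift Aᴴ := by
  refine op_ext_cons fun b b' x y => ?_
  simp only [Matrix.conjTranspose_apply, lift_cons]
  cases b <;> cases b' <;> simp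

theorem lift_smul {n : ℕ} (z : ℂ) (A : Op n) : lift (z • A) = z • lift A := by
  refine op_ext_cons fun b b' x y => ?_
  simp [lift_cons]

theorem lift_neg {n : ℕ} (A : Op n) : lift (-A) = -lift A := by
  refine op_ext_cons fun b b' x y => ?_
  simp only [Matrix.neg_apply, lift_cons]
  split_ifs <;> simp

theorem lift_injective {n : ℕ} : Function.Injective (lift : Op n → Op (n + 1)) := fun A B h => by
  ext x y
  have := congrFun (congrFun h (Fin.cons true x)) (Fin.cons true y)
  simpa only [lift_cons, if_true] using this

theorem lift_mem {n : ℕ} {A : Op n} : lift A ∈ unitary (Op (n + 1)) ↔ A ∈ unitary (Op n) := by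
  simp only [Unitary.mem_iff, Matrix.star_eq_conjTranspose, lift_conjTranspose, ← lift_mul]
  rw [← lift_one]
  simp only [lift_injective.eq_iff]

theorem lift_tens {n : ℕ} (A : Fin n → Matrix Bool Bool ℂ) :
    lift (tens A) = tens (Fin.cons 1 A : Fin (n + 1) → Matrix Bool Bool ℂ) := by
  refine op_ext_cons fun b b' x y => ?_
  simp [lift_cons, tens_apply, Fin.prod_univ_succ, Matrix.one_apply]

theorem lift_pauli {n : ℕ} (p : Fin n → Bool × Bool) :
    lift (pauli p) = pauli (Fin.cons (false, false) p : Fin (n + 1) → Bool × Bool) := by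
  rw [pauli_eq_tens, lift_tens, pauli_eq_tens]
  congr 1
  funext k
  refine Fin.cases ?_ (fun k => ?_) k <;> simp [pauliOne]

theorem pauli_cons_apply {n : ℕ} (a : Bool × Bool) (b b' : Bool) (x y : Bits n) :
    pauli (Fin.cons a pId : Fin (n + 1) → Bool × Bool) (Fin.cons b x : Bits (n + 1))
      (Fin.cons b' y) = pauliOne a b b' * if x = y then 1 else 0 := by
  have h : pauli (pId : Fin n → Bool × Bool) x y = if x = y then 1 else 0 := by
    rw [pauli_pId, Matrix.one_apply]
  rw [← h]
  simp [pauli_eq_tens, tens_apply, Fin.prod_univ_succ]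

theorem pZ_zero {n : ℕ} : (pZ 0 : Fin (n + 1) → Bool × Bool) = Fin.cons (false, true) pId := by
  funext k
  refine Fin.cases ?_ (fun k => ?_) k <;> simp [pZ, pId]

theorem pX_zero {n : ℕ} : (pX 0 : Fin (n + 1) → Bool × Bool) = Fin.cons (true, false) pId := by
  funext k
  refine Fin.cases ?_ (fun k => ?_) k <;> simp [pX, pId]

theorem lift_comm_cons {n : ℕ} (W : Op n) (a : Bool × Bool) :
    lift W * pauli (Fin.cons a pId : Fin (n + 1) → Bool × Bool) =
      pauli (Fin.cons a pId : Fin (n + 1) → Bool × Bool) * lift W := by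
  refine op_ext_cons fun b b' x y => ?_
  simp only [Matrix.mul_apply, sum_bits_succ, lift_cons, pauli_cons_apply]
  cases b <;> cases b' <;> simp [mul_comm]

/-- Split `A` into blocks by the value of qubit `0`. Commuting with `Z` kills the off-diagonal
blocks, and commuting with `X` makes the two diagonal blocks equal. -/
theorem exists_lift_of_commute {n : ℕ} {A : Op (n + 1)}
    (hZ : A * pauli (pZ 0) = pauli (pZ 0) * A) (hX : A * pauli (pX 0) = pauli (pX 0) * A) :
    ∃ W : Op n, A = lift W := by
  refine ⟨Matrix.of fun x y => A (Fin.cons true x : Bits (n + 1)) (Fin.cons true y), ?_⟩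
  refine op_ext_cons fun b b' x y => ?_
  have h1 : ∀ b b' : Bool, A (Fin.cons b x : Bits (n + 1)) (Fin.cons b' y) * pauliOne (false, true) b' b' =
      pauliOne (false, true) b b * A (Fin.cons b x : Bits (n + 1)) (Fin.cons b' y) := fun b b' => by
    have := congrFun (congrFun hZ (Fin.cons b x)) (Fin.cons b' y)
    simp only [pZ_zero, Matrix.mul_apply, sum_bits_succ, pauli_cons_apply] at this
    cases b <;> cases b' <;> simp [pauliOne_apply] at this ⊢ <;> exact this
  have h2 : A (Fin.cons true x : Bits (n + 1)) (Fin.cons true y) =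
      A (Fin.cons false x : Bits (n + 1)) (Fin.cons false y) := by
    have := congrFun (congrFun hX (Fin.cons true x)) (Fin.cons false y)
    simp only [pX_zero, Matrix.mul_apply, sum_bits_succ, pauli_cons_apply] at this
    simpa [pauliOne_apply] using this
  rw [lift_cons, Matrix.of_apply]
  have h3 := h1 true false
  have h4 := h1 false true
  cases b <;> cases b' <;> simp [pauliOne_apply] at h3 h4 ⊢
  · exact h2.symm
  · linear_combination (-1 / 2 : ℂ) * h4
  · linear_combination (1 / 2 : ℂ) * h3

theorem Gate.toMatrix_two_apply {n : ℕ} (i j : Fin n) (h : j ≠ i)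
    (u : Matrix.unitaryGroup (Bool × Bool) ℂ) (x y : Bits n) :
    (Gate.two i j h u).toMatrix x y = (u : Matrix (Bool × Bool) (Bool × Bool) ℂ)
      (x i, x j) (y i, y j) * if ∀ k, k ≠ i → k ≠ j → x k = y k then 1 else 0 := by
  simp only [Gate.toMatrix, Matrix.submatrix_apply, Matrix.kroneckerMap_apply,
    splitTwo, Equiv.trans_apply, Equiv.prodCongr_apply, Equiv.coe_refl, Prod.map_apply, id_eq,
    Equiv.funSplitAt_apply, Equiv.prodAssoc_symm_apply, Matrix.one_apply]
  congr 1
  refine if_congr ⟨fun hk k hi hj => ?_, fun hk => ?_⟩ rfl rfl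
  · exact congrFun hk ⟨⟨k, hi⟩, fun e => hj (congrArg Subtype.val e)⟩
  · funext ⟨k, hj⟩
    exact hk k k.2 fun e => hj (Subtype.ext e)

theorem Gate.toMatrix_shift {n : ℕ} (g : Gate n) : g.shift.toMatrix = lift g.toMatrix := by
  cases g with
  | one i u =>
    rw [Gate.shift, Gate.toMatrix_one, Gate.toMatrix_one, lift_tens]
    congr 1
    funext k
    refine Fin.cases ?_ (fun k => ?_) k
    · rw [Function.update_of_ne (Fin.succ_ne_zero i).symm]; rfl
    · by_cases hk : k = i
      · subst hk; simp
      · simp [hk]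
  | two i j h u =>
    refine op_ext_cons fun b b' x y => ?_
    rw [Gate.shift, lift_cons, Gate.toMatrix_two_apply, Gate.toMatrix_two_apply]
    have : (∀ k, k ≠ i.succ → k ≠ j.succ → (Fin.cons b x : Bits (n + 1)) k =
        (Fin.cons b' y : Bits (n + 1)) k) ↔ b = b' ∧ ∀ k, k ≠ i → k ≠ j → x k = y k := by
      rw [Fin.forall_fin_succ]
      simp [(Fin.succ_ne_zero _).symm]
    rw [if_congr this rfl rfl]
    by_cases hb : b = b' <;> simp [hb]

theorem Circuit.toMatrix_map_shift {n : ℕ} (c : Circuit n) :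
    Circuit.toMatrix (c.map Gate.shift) = lift c.toMatrix := by
  induction c with
  | nil => exact lift_one.symm
  | cons g c ih =>
    rw [List.map_cons, Circuit.toMatrix, Circuit.toMatrix, ih, Gate.toMatrix_shift, lift_mul]

theorem IsClifford.of_lift {n : ℕ} {W : Op n} (h : IsClifford (lift W)) : IsClifford W := by
  refine ⟨lift_mem.1 h.1, fun p => ?_⟩
  obtain ⟨q, hq⟩ := h.2 (Fin.cons (false, false) p)
  -- the image commutes with all operators on the first qubit
  have hsgn : ∀ a : Bool × Bool, sgn q (Fin.cons a pId) = 1 := fun a => by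
    have h1 : Maps (lift W) (Fin.cons a pId) (Fin.cons a pId) := Or.inl (by
      rw [lift_comm_cons, mul_assoc, mul_conjTranspose_self_of_mem h.1, mul_one])
    rw [← Maps.sgn_eq h.1 hq h1, sgn, Fin.prod_univ_succ]
    simp [sgnOne, pId]
  -- Only the identity commutes with both `X` and `Z` on one qubit, so the image is supported on the
  -- other qubits.
  have hq0 : q 0 = (false, false) := by
    have h1 := hsgn (true, false)
    have h2 := hsgn (false, true)
    simp only [sgn, Fin.prod_univ_succ, Fin.cons_zero, Fin.cons_succ, pId] at h1 h2
    rcases hq0 : q 0 with ⟨_ | _, _ | _⟩ <;> simp [sgnOne, hq0] at h1 h2 ⊢ <;>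
      first | (norm_num at h1; done) | norm_num at h2
  have hq' : pauli q = lift (pauli (Fin.tail q)) := by
    rw [lift_pauli, ← hq0, Fin.cons_self_tail]
  refine ⟨Fin.tail q, ?_⟩
  rw [← lift_pauli, hq', lift_conjTranspose, ← lift_mul, ← lift_mul, ← lift_neg] at hq
  exact hq.imp (fun e => lift_injective e) (fun e => lift_injective e)

theorem EqUpToPhase.conj_eq {n : ℕ} {U V : Op n} (h : EqUpToPhase U V) (A : Op n) :
    U * A * Uᴴ = V * A * Vᴴ := by
  obtain ⟨z, hz, rfl⟩ := h
  have : star z * z = 1 := by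
    rw [Complex.star_def, mul_comm, Complex.mul_conj, Complex.normSq_eq_norm_sq, hz]; simp
  rw [Matrix.conjTranspose_smul, Matrix.mul_smul, Matrix.smul_mul, Matrix.smul_mul, smul_smul,
    this, one_smul]

theorem EqUpToPhase.refl {n : ℕ} (U : Op n) : EqUpToPhase U U := ⟨1, by simp, by simp⟩

theorem EqUpToPhase.symm {n : ℕ} {U V : Op n} (h : EqUpToPhase U V) : EqUpToPhase V U := by
  obtain ⟨z, hz, rfl⟩ := h
  have hz0 : z ≠ 0 := fun e => by simp [e] at hz
  exact ⟨z⁻¹, by simp [hz], by rw [smul_smul, inv_mul_cancel₀ hz0, one_smul]⟩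

theorem EqUpToPhase.trans {n : ℕ} {U V W : Op n} (h : EqUpToPhase U V) (h' : EqUpToPhase V W) :
    EqUpToPhase U W := by
  obtain ⟨z, hz, rfl⟩ := h
  obtain ⟨w, hw, rfl⟩ := h'
  exact ⟨z * w, by simp [hz, hw], by rw [smul_smul]⟩

theorem EqUpToPhase.mul_left {n : ℕ} {U V : Op n} (h : EqUpToPhase U V) (A : Op n) :
    EqUpToPhase (A * U) (A * V) := by
  obtain ⟨z, hz, rfl⟩ := h
  exact ⟨z, hz, by rw [Matrix.mul_smul]⟩

theorem eqUpToPhase_lift {n : ℕ} {U V : Op n} : EqUpToPhase (lift U) (lift V) ↔ EqUpToPhase U V := by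
  unfold EqUpToPhase
  simp only [← lift_smul, lift_injective.eq_iff]

/-! ### Decomposition of Clifford unitaries -/

/-- The part of the sampled circuit that fixes the images of `Z` and `X` on qubit `0`. -/
def frame {n : ℕ} (a : Fin (n + 1) → Bool × Bool) (q : Fin n → Bool × Bool) (z s t : Bool) :
    Circuit (n + 1) := pauliZero s t ++ xTo z q ++ zTo a

theorem frame_toMatrix {n : ℕ} (a : Fin (n + 1) → Bool × Bool) (q : Fin n → Bool × Bool)
    (z s t : Bool) : (frame a q z s t).toMatrix =
      (zTo a).toMatrix * ((xTo z q).toMatrix * (pauliZero s t : Circuit (n + 1)).toMatrix) := by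
  rw [frame, Circuit.toMatrix_append, Circuit.toMatrix_append]

theorem lift_conj_cons {n : ℕ} {W : Op n} (hW : W ∈ unitary (Op n)) (a : Bool × Bool) :
    lift W * pauli (Fin.cons a pId : Fin (n + 1) → Bool × Bool) * (lift W)ᴴ =
      pauli (Fin.cons a pId) := by
  rw [lift_comm_cons, mul_assoc, mul_conjTranspose_self_of_mem (lift_mem.2 hW), mul_one]

theorem sgn_cons_pId {n : ℕ} (a : Bool × Bool) (q : Fin (n + 1) → Bool × Bool) :
    sgn q (Fin.cons a pId) = sgnOne (q 0) a := by
  rw [sgn, Fin.prod_univ_succ, Fin.cons_zero]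
  simp [sgnOne, pId]

/-- Peel off the image of `Z` on qubit `0`, then that of `X`, then the two signs. What remains
commutes with `X` and `Z` on qubit `0` and hence acts on the other qubits alone. -/
theorem exists_frame {n : ℕ} {V : Op (n + 1)} (hV : IsClifford V) :
    ∃ (a : Fin (n + 1) → Bool × Bool) (q : Fin n → Bool × Bool) (z s t : Bool) (W : Op n),
      a ≠ pId ∧ IsClifford W ∧ V = (frame a q z s t).toMatrix * lift W := by
  obtain ⟨a, ha⟩ : ∃ a, Maps V (pZ 0) a := hV.2 _
  have ha0 : a ≠ pId := fun e => by
    subst e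
    exact pZ_ne_pId _ (ha.injective hV.1 (Maps.pId_eq hV.1))
  have hA := (isCliffordCircuit_zTo a).isClifford
  have hV1 := hA.conjTranspose.mul hV
  obtain ⟨V1, hV1def⟩ : ∃ V1, V1 = (zTo a).toMatrixᴴ * V := ⟨_, rfl⟩
  rw [← hV1def] at hV1
  have h1Z : Maps V1 (pZ 0) (pZ 0) := hV1def ▸ ((maps_zTo ha0).conjTranspose hA.1).mul ha
  obtain ⟨p, hp⟩ : ∃ p, Maps V1 (pX 0) p := hV1.2 _
  -- The image of `X` anticommutes with `Z` on qubit `0`, so its factor there is `X` or `Y`, as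
  -- `xTo` requires.
  have hp0 : (p 0).1 = true := by
    have h := hp.sgn_eq hV1.1 h1Z
    rw [pZ_zero, sgn_cons_pId, sgn_cons_pId] at h
    rcases hp0 : p 0 with ⟨_ | _, _ | _⟩ <;> rw [hp0] at h <;> simp [sgnOne, pX] at h ⊢ <;>
      norm_num at h
  have hpc : p = Fin.cons (true, (p 0).2) (Fin.tail p) := by
    rw [← hp0]; exact (Fin.cons_self_tail p).symm
  have hX := (isCliffordCircuit_xTo (p 0).2 (Fin.tail p)).isClifford
  have hV2 := hX.conjTranspose.mul hV1
  obtain ⟨V2, hV2def⟩ : ∃ V2, V2 = (xTo (p 0).2 (Fin.tail p)).toMatrixᴴ * V1 := ⟨_, rfl⟩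
  rw [← hV2def] at hV2
  have h2Z : Maps V2 (pZ 0) (pZ 0) :=
    hV2def ▸ ((maps_xTo_pZ _ _).conjTranspose hX.1).mul h1Z
  have h2X : Maps V2 (pX 0) (pX 0) := by
    have h := (maps_xTo_pX (p 0).2 (Fin.tail p)).conjTranspose hX.1
    rw [← hpc] at h
    exact hV2def ▸ h.mul hp
  have hsg : ∀ {p : Fin (n + 1) → Bool × Bool}, Maps V2 p p → ∃ b, V2 * pauli p * V2ᴴ =
      bsign b • pauli p := by
    rintro p (h | h)
    · exact ⟨false, by simpa [bsign] using h⟩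
    · exact ⟨true, by simpa [bsign] using h⟩
  obtain ⟨s, hs⟩ := hsg h2Z
  obtain ⟨t, ht⟩ := hsg h2X
  have hP := (isCliffordCircuit_pauliZero (n := n) s t).isClifford
  have hV3 := hP.conjTranspose.mul hV2
  have hPZ := pauliZero_conj_pZ (n := n) s t
  have hPX := pauliZero_conj_pX (n := n) s t
  obtain ⟨P, hPdef⟩ : ∃ P, P = (pauliZero s t : Circuit (n + 1)).toMatrix := ⟨_, rfl⟩
  rw [← hPdef] at hP hV3 hPZ hPX
  -- `V2` and `P` give this string the same sign, so `Pᴴ * V2` fixes it exactly.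
  have hcomm : ∀ {p : Fin (n + 1) → Bool × Bool} {b : Bool},
      V2 * pauli p * V2ᴴ = bsign b • pauli p → P * pauli p * Pᴴ = bsign b • pauli p →
      Pᴴ * V2 * pauli p = pauli p * (Pᴴ * V2) := by
    intro p b h2 hp
    have e : Pᴴ * V2 * pauli p * (Pᴴ * V2)ᴴ = pauli p := by
      rw [conj_mul, h2, ← hp, Matrix.conjTranspose_conjTranspose, conj_conj hP.1]
    calc Pᴴ * V2 * pauli p = Pᴴ * V2 * pauli p * ((Pᴴ * V2)ᴴ * (Pᴴ * V2)) := by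
          rw [conjTranspose_mul_self_of_mem hV3.1, mul_one]
      _ = (Pᴴ * V2 * pauli p * (Pᴴ * V2)ᴴ) * (Pᴴ * V2) := by simp only [mul_assoc]
      _ = _ := by rw [e]
  obtain ⟨W, hW⟩ := exists_lift_of_commute (hcomm hs hPZ) (hcomm ht hPX)
  refine ⟨a, Fin.tail p, (p 0).2, s, t, W, ha0, .of_lift (hW ▸ hV3), ?_⟩
  rw [frame_toMatrix, ← hW, hV2def, hV1def, ← hPdef]
  calc V = ((zTo a).toMatrix * ((xTo (p 0).2 (Fin.tail p)).toMatrix * (P * Pᴴ) *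
        (xTo (p 0).2 (Fin.tail p)).toMatrixᴴ) * (zTo a).toMatrixᴴ) * V := by
        rw [mul_conjTranspose_self_of_mem hP.1, mul_one, mul_conjTranspose_self_of_mem hX.1,
          mul_one, mul_conjTranspose_self_of_mem hA.1, one_mul]
    _ = _ := by simp only [mul_assoc]

theorem maps_pauliZero_pZ {n : ℕ} (s t : Bool) :
    Maps (pauliZero s t : Circuit (n + 1)).toMatrix (pZ 0) (pZ 0) :=
  .of_smul (by cases s <;> simp [bsign]) (pauliZero_conj_pZ s t)

theorem maps_pauliZero_pX {n : ℕ} (s t : Bool) :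
    Maps (pauliZero s t : Circuit (n + 1)).toMatrix (pX 0) (pX 0) :=
  .of_smul (by cases t <;> simp [bsign]) (pauliZero_conj_pX s t)

theorem maps_lift_pZ {n : ℕ} {W : Op n} (hW : W ∈ unitary (Op n)) :
    Maps (lift W) (pZ 0) (pZ 0) := by
  rw [pZ_zero]; exact Or.inl (lift_conj_cons hW _)

theorem maps_lift_pX {n : ℕ} {W : Op n} (hW : W ∈ unitary (Op n)) :
    Maps (lift W) (pX 0) (pX 0) := by
  rw [pX_zero]; exact Or.inl (lift_conj_cons hW _)

theorem EqUpToPhase.maps {n : ℕ} {U V : Op n} (h : EqUpToPhase U V) {p q : Fin n → Bool × Bool}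
    (hU : Maps U p q) : Maps V p q := by
  unfold Maps at hU ⊢
  rwa [h.conj_eq] at hU

theorem EqUpToPhase.cancel_left {n : ℕ} {A X Y : Op n} (hA : A ∈ unitary (Op n))
    (h : EqUpToPhase (A * X) (A * Y)) : EqUpToPhase X Y := by
  have := h.mul_left Aᴴ
  rwa [← mul_assoc, ← mul_assoc, conjTranspose_mul_self_of_mem hA, one_mul, one_mul] at this

theorem eq_of_bsign_smul_pauli {n : ℕ} {b b' : Bool} {p : Fin n → Bool × Bool}
    (h : bsign b • pauli p = bsign b' • pauli p) : b = b' :=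
  bsign_injective (smul_left_injective ℂ (pauli_ne_zero p) h)

/-- The lifted factor fixes `Z` and `X` on qubit `0`, so their signs after conjugation recover `s`
and `t`. A global phase is invisible to conjugation. -/
theorem pauliZero_lift_unique {n : ℕ} {s t s' t' : Bool} {W W' : Op n}
    (hW : W ∈ unitary (Op n)) (hW' : W' ∈ unitary (Op n))
    (h : EqUpToPhase ((pauliZero s' t' : Circuit (n + 1)).toMatrix * lift W')
      ((pauliZero s t : Circuit (n + 1)).toMatrix * lift W)) :
    s' = s ∧ t' = t ∧ EqUpToPhase W' W := by
  have hs : s' = s := eq_of_bsign_smul_pauli (p := (pZ 0 : Fin (n + 1) → Bool × Bool)) <| by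
    have e := h.conj_eq (pauli (pZ 0))
    rwa [conj_mul, conj_mul, pZ_zero, lift_conj_cons hW, lift_conj_cons hW', ← pZ_zero,
      pauliZero_conj_pZ, pauliZero_conj_pZ] at e
  have ht : t' = t := eq_of_bsign_smul_pauli (p := (pX 0 : Fin (n + 1) → Bool × Bool)) <| by
    have e := h.conj_eq (pauli (pX 0))
    rwa [conj_mul, conj_mul, pX_zero, lift_conj_cons hW, lift_conj_cons hW', ← pX_zero,
      pauliZero_conj_pX, pauliZero_conj_pX] at e
  subst hs ht
  exact ⟨rfl, rfl, eqUpToPhase_lift.1 (h.cancel_left (Circuit.toMatrix_mem _))⟩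

/-- The image of `Z` on qubit `0` reveals `a`; after cancelling its circuit, the image of `X`
reveals `z` and `q`, and the signs reveal the rest. -/
theorem frame_unique {n : ℕ} {a a' : Fin (n + 1) → Bool × Bool} {q q' : Fin n → Bool × Bool}
    {z s t z' s' t' : Bool} {W W' : Op n} (ha : a ≠ pId) (ha' : a' ≠ pId)
    (hW : W ∈ unitary (Op n)) (hW' : W' ∈ unitary (Op n))
    (h : EqUpToPhase ((frame a' q' z' s' t').toMatrix * lift W')
      ((frame a q z s t).toMatrix * lift W)) :
    a' = a ∧ q' = q ∧ z' = z ∧ s' = s ∧ t' = t ∧ EqUpToPhase W' W := by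
  simp only [frame_toMatrix, mul_assoc] at h
  have haa : a' = a := (h.maps ((maps_zTo ha').mul ((maps_xTo_pZ z' q').mul
      ((maps_pauliZero_pZ s' t').mul (maps_lift_pZ hW'))))).unique
    ((maps_zTo ha).mul ((maps_xTo_pZ z q).mul ((maps_pauliZero_pZ s t).mul (maps_lift_pZ hW))))
  subst haa
  replace h := h.cancel_left (Circuit.toMatrix_mem _)
  have hqz := (h.maps ((maps_xTo_pX z' q').mul
      ((maps_pauliZero_pX s' t').mul (maps_lift_pX hW')))).unique
    ((maps_xTo_pX z q).mul ((maps_pauliZero_pX s t).mul (maps_lift_pX hW)))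
  obtain ⟨hz, hq⟩ := Fin.cons_inj.1 hqz
  obtain rfl : z' = z := (Prod.ext_iff.1 hz).2
  subst hq
  obtain ⟨h1, h2, h3⟩ := pauliZero_lift_unique hW hW' (h.cancel_left (Circuit.toMatrix_mem _))
  exact ⟨rfl, rfl, rfl, h1, h2, h3⟩

/-! ### Expectations -/

/-- The expectation of `f` under a law of finite support. -/
def Ex {α E : Type} [AddCommGroup E] [Module ℝ E] (μ : PMF α) (f : α → E) : E :=
  ∑ᶠ x, (μ x).toReal • f x

section Ex

variable {α β E : Type} [AddCommGroup E] [Module ℝ E]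

theorem toReal_eq_zero_of_notMem {μ : PMF α} {x : α} (h : x ∉ μ.support) : (μ x).toReal = 0 := by
  rw [(μ.apply_eq_zero_iff x).2 h]; rfl

theorem Ex_eq_sum {μ : PMF α} {s : Finset α} (hs : μ.support ⊆ s) (f : α → E) :
    Ex μ f = ∑ x ∈ s, (μ x).toReal • f x := by
  refine finsum_eq_sum_of_support_subset _ fun x hx => hs ?_
  by_contra h
  exact hx (by simp [toReal_eq_zero_of_notMem h])

theorem Ex_eq_univ_sum [Fintype α] (μ : PMF α) (f : α → E) :
    Ex μ f = ∑ x, (μ x).toReal • f x := Ex_eq_sum (by simp) f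

theorem Ex_pure (a : α) (f : α → E) : Ex (PMF.pure a) f = f a := by
  rw [Ex_eq_sum (s := {a}) (by simp)]
  simp [PMF.pure_apply]

theorem finite_support_bind {μ : PMF α} {g : α → PMF β} (hμ : μ.support.Finite)
    (hg : ∀ a ∈ μ.support, (g a).support.Finite) : (μ.bind g).support.Finite := by
  rw [PMF.support_bind]
  exact hμ.biUnion hg

theorem finite_support_pure (a : α) : (PMF.pure a).support.Finite := by
  rw [PMF.support_pure]; exact Set.finite_singleton a

theorem Ex_bind {μ : PMF α} {g : α → PMF β} (hμ : μ.support.Finite)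
    (hg : ∀ a ∈ μ.support, (g a).support.Finite) (f : β → E) :
    Ex (μ.bind g) f = Ex μ fun a => Ex (g a) f := by
  have hb := finite_support_bind hμ hg
  have h1 : ∀ x, ((μ.bind g) x).toReal = ∑ a ∈ hμ.toFinset, (μ a).toReal * (g a x).toReal := by
    intro x
    rw [PMF.bind_apply, tsum_eq_sum (s := hμ.toFinset), ENNReal.toReal_sum]
    · simp
    · exact fun a _ => ENNReal.mul_ne_top (μ.apply_ne_top a) ((g a).apply_ne_top x)
    · intro a ha
      rw [Set.Finite.mem_toFinset] at ha
      rw [(μ.apply_eq_zero_iff a).2 ha, zero_mul]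
  rw [Ex_eq_sum (s := hb.toFinset) (by simp), Ex_eq_sum (s := hμ.toFinset) (by simp)]
  simp only [h1, Finset.sum_smul, mul_smul]
  rw [Finset.sum_comm]
  refine Finset.sum_congr rfl fun a ha => ?_
  rw [Set.Finite.mem_toFinset] at ha
  rw [Ex_eq_sum (s := hb.toFinset), Finset.smul_sum]
  rw [Set.Finite.coe_toFinset, PMF.support_bind]
  exact Set.subset_biUnion_of_mem (u := fun a => (g a).support) ha

theorem Ex_map {μ : PMF α} (hμ : μ.support.Finite) (g : α → β) (f : β → E) :
    Ex (μ.map g) f = Ex μ fun a => f (g a) := by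
  refine (Ex_bind (g := PMF.pure ∘ g) hμ (fun a _ => finite_support_pure (g a)) f).trans ?_
  simp only [Function.comp, Ex_pure]

theorem sum_toReal {μ : PMF α} {s : Finset α} (hs : μ.support ⊆ s) :
    ∑ x ∈ s, (μ x).toReal = 1 := by
  rw [← ENNReal.toReal_sum fun x _ => μ.apply_ne_top x]
  have := μ.tsum_coe
  rw [tsum_eq_sum (s := s) fun a ha => (μ.apply_eq_zero_iff a).2 fun h => ha (hs h)] at this
  rw [this]; rfl

theorem Ex_const {μ : PMF α} (hμ : μ.support.Finite) (c : E) : Ex μ (fun _ => c) = c := by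
  rw [Ex_eq_sum (s := hμ.toFinset) (by simp), ← Finset.sum_smul, sum_toReal (by simp), one_smul]

theorem Ex_add {μ : PMF α} (hμ : μ.support.Finite) (f g : α → E) :
    Ex μ (fun x => f x + g x) = Ex μ f + Ex μ g := by
  simp only [Ex_eq_sum (s := hμ.toFinset) (μ := μ) (by simp), smul_add, Finset.sum_add_distrib]

theorem Ex_sum {ι : Type} {μ : PMF α} (hμ : μ.support.Finite) (s : Finset ι) (f : ι → α → E) :
    Ex μ (fun x => ∑ i ∈ s, f i x) = ∑ i ∈ s, Ex μ (f i) := by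
  simp only [Ex_eq_sum (s := hμ.toFinset) (μ := μ) (by simp), Finset.smul_sum]
  exact Finset.sum_comm

theorem Ex_linear {F : Type} [AddCommGroup F] [Module ℝ F] {μ : PMF α} (hμ : μ.support.Finite)
    (L : E →ₗ[ℝ] F) (f : α → E) : Ex μ (fun x => L (f x)) = L (Ex μ f) := by
  simp only [Ex_eq_sum (s := hμ.toFinset) (μ := μ) (by simp), map_sum, map_smul]

theorem Ex_const_mul {μ : PMF α} (hμ : μ.support.Finite) (c : ℝ) (f : α → ℝ) :
    Ex μ (fun x => c * f x) = c * Ex μ f :=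
  Ex_linear hμ (LinearMap.mulLeft ℝ c) f

theorem Ex_const_mul_complex {μ : PMF α} (hμ : μ.support.Finite) (c : ℂ) (f : α → ℂ) :
    Ex μ (fun x => c * f x) = c * Ex μ f :=
  Ex_linear hμ (LinearMap.mulLeft ℝ c) f

theorem Ex_re {μ : PMF α} (hμ : μ.support.Finite) (f : α → ℂ) :
    Ex μ (fun x => (f x).re) = (Ex μ f).re :=
  Ex_linear hμ Complex.reLm f

theorem Ex_sub {μ : PMF α} (hμ : μ.support.Finite) (f g : α → E) :
    Ex μ (fun x => f x - g x) = Ex μ f - Ex μ g := by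
  simp only [Ex_eq_sum (s := hμ.toFinset) (μ := μ) (by simp), smul_sub, Finset.sum_sub_distrib]

theorem Ex_mono {μ : PMF α} (hμ : μ.support.Finite) {f g : α → ℝ}
    (h : ∀ x ∈ μ.support, f x ≤ g x) : Ex μ f ≤ Ex μ g := by
  simp only [Ex_eq_sum (s := hμ.toFinset) (μ := μ) (by simp), smul_eq_mul]
  exact Finset.sum_le_sum fun x hx =>
    mul_le_mul_of_nonneg_left (h x (by simpa using hx)) ENNReal.toReal_nonneg

theorem toOuterMeasure_eq_Ex {μ : PMF α} (hμ : μ.support.Finite) (s : Set α) :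
    μ.toOuterMeasure s = ENNReal.ofReal (Ex μ (s.indicator 1)) := by
  classical
  rw [PMF.toOuterMeasure_apply, tsum_eq_sum (s := hμ.toFinset),
    Ex_eq_sum (s := hμ.toFinset) (by simp), ENNReal.ofReal_sum_of_nonneg]
  · refine Finset.sum_congr rfl fun x _ => ?_
    by_cases hx : x ∈ s
    · simp [hx, ENNReal.ofReal_toReal (μ.apply_ne_top x)]
    · simp [hx]
  · intro x _
    exact smul_nonneg ENNReal.toReal_nonneg (Set.indicator_nonneg (by simp) x)
  · intro x hx
    rw [Set.Finite.mem_toFinset] at hx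
    by_cases hs : x ∈ s
    · simp [hs, (μ.apply_eq_zero_iff x).2 hx]
    · simp [hs]

end Ex

/-! ### Laws of programs -/

/-- The value returned by `p` has law `μ`, of finite support, whatever the meter shows. -/
def Denotes {α : Type} (p : Prog α) (μ : PMF α) : Prop :=
  μ.support.Finite ∧ ∀ s, (StateT.run p s).map Prod.fst = μ

theorem Denotes.pure {α : Type} (a : α) : Denotes (Pure.pure a : Prog α) (PMF.pure a) :=
  ⟨finite_support_pure a, fun _ => PMF.pure_map _ _⟩

theorem Denotes.bind {α β : Type} {p : Prog α} {f : α → Prog β} {μ : PMF α} {ν : α → PMF β}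
    (hp : Denotes p μ) (hf : ∀ a, Denotes (f a) (ν a)) : Denotes (p >>= f) (μ.bind ν) := by
  refine ⟨finite_support_bind hp.1 fun a _ => (hf a).1, fun s => ?_⟩
  change ((StateT.run p s).bind fun o => StateT.run (f o.1) o.2).map Prod.fst = _
  rw [PMF.map_bind]
  simp only [(hf _).2]
  rw [← hp.2 s, PMF.bind_map]
  rfl

theorem Denotes.tick {α : Type} {p : Prog α} {μ : PMF α} (c : ℕ) (h : Denotes p μ) :
    Denotes (do QCQC.tick c; p) μ := by
  refine ⟨h.1, fun s => ?_⟩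
  change ((PMF.pure ((), _)).bind fun o : Unit × Meter => StateT.run p o.2).map Prod.fst = _
  rw [PMF.pure_bind]
  exact h.2 _

theorem Denotes.draw {α : Type} {μ : PMF α} (h : μ.support.Finite) : Denotes (QCQC.draw μ) μ := by
  refine ⟨h, fun s => ?_⟩
  change (μ.bind fun x => PMF.pure (x, s)).map Prod.fst = _
  rw [PMF.map_bind]
  simp only [PMF.pure_map]
  exact PMF.bind_pure μ

theorem Denotes.modify {α : Type} {p : Prog α} {μ : PMF α} (u : Meter → Meter)
    (h : Denotes p μ) : Denotes (do modify u; p) μ := by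
  refine ⟨h.1, fun s => ?_⟩
  change ((PMF.pure ((), _)).bind fun o : Unit × Meter => StateT.run p o.2).map Prod.fst = _
  rw [PMF.pure_bind]
  exact h.2 _

theorem finite_support_of_finite {α : Type} [Finite α] (μ : PMF α) : μ.support.Finite :=
  Set.toFinite _

theorem Denotes.law_apply {α : Type} {p : Prog α} {μ : PMF α} (h : Denotes p μ) (s : Set α) :
    p.law.toOuterMeasure {o | o.1 ∈ s} = μ.toOuterMeasure s := by
  rw [← h.2 ⟨0, 0, 0⟩, PMF.toOuterMeasure_map_apply]
  rfl

theorem Denotes.mem_support {α : Type} {p : Prog α} {μ : PMF α} (h : Denotes p μ)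
    {o : α × Meter} (ho : o ∈ p.law.support) : o.1 ∈ μ.support := by
  rw [← h.2 ⟨0, 0, 0⟩, PMF.support_map]
  exact ⟨o, ho, rfl⟩

/-- The law of `k` independent draws. -/
def prodLaw {α : Type} : (k : ℕ) → (Fin k → PMF α) → PMF (Fin k → α)
  | 0, _ => PMF.pure Fin.elim0
  | k + 1, f => (f 0).bind fun a => (prodLaw k fun i => f i.succ).bind fun l =>
      PMF.pure (Fin.cons a l)

theorem Denotes.forFin {α : Type} {k : ℕ} {f : Fin k → Prog α} {μ : Fin k → PMF α}
    (h : ∀ i, Denotes (f i) (μ i)) : Denotes (QCQC.forFin k f) (prodLaw k μ) := by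
  induction k with
  | zero => exact .pure _
  | succ k ih =>
    exact .tick 1 ((h 0).bind fun a => (ih fun i => h i.succ).bind fun l => .pure _)

theorem prodLaw_apply {α : Type} {k : ℕ} (μ : Fin k → PMF α) (v : Fin k → α) :
    prodLaw k μ v = ∏ i, μ i (v i) := by
  classical
  induction k with
  | zero =>
    rw [prodLaw, PMF.pure_apply, if_pos (Subsingleton.elim _ _)]
    simp
  | succ k ih =>
    rw [prodLaw, PMF.bind_apply, Fin.prod_univ_succ, tsum_eq_single (v 0)]
    · congr 1
      rw [PMF.bind_apply, tsum_eq_single (Fin.tail v)]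
      · rw [ih, PMF.pure_apply, if_pos (Fin.cons_self_tail v).symm, mul_one]
        rfl
      · intro l hl
        rw [PMF.pure_apply, if_neg, mul_zero]
        intro e
        exact hl (by rw [e, Fin.tail_cons])
    · intro a ha
      have : ((prodLaw k fun i => μ i.succ).bind fun l => PMF.pure (Fin.cons a l)) v = 0 := by
        rw [PMF.bind_apply, ENNReal.tsum_eq_zero]
        intro l
        rw [PMF.pure_apply, if_neg, mul_zero]
        rintro rfl
        exact ha (by simp)
      rw [this, mul_zero]

theorem finite_support_prodLaw {α : Type} {k : ℕ} {μ : Fin k → PMF α}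
    (h : ∀ i, (μ i).support.Finite) : (prodLaw k μ).support.Finite := by
  induction k with
  | zero => exact finite_support_pure _
  | succ k ih =>
    exact finite_support_bind (h 0) fun a _ => finite_support_bind (ih fun i => h i.succ)
      fun l _ => finite_support_pure _

theorem Ex_prodLaw_succ {α E : Type} [AddCommGroup E] [Module ℝ E] {k : ℕ}
    {μ : Fin (k + 1) → PMF α} (h : ∀ i, (μ i).support.Finite) (f : (Fin (k + 1) → α) → E) :
    Ex (prodLaw (k + 1) μ) f =
      Ex (μ 0) fun a => Ex (prodLaw k fun i => μ i.succ) fun l => f (Fin.cons a l) := by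
  have hk := finite_support_prodLaw fun i => h (Fin.succ i)
  rw [prodLaw, Ex_bind (h 0) fun a _ => finite_support_bind hk fun l _ => finite_support_pure _]
  congr 1
  funext a
  rw [Ex_bind hk fun l _ => finite_support_pure _]
  simp only [Ex_pure]

/-- The expectation of a product of functions of independent variables. -/
theorem Ex_prodLaw_prod {α : Type} {k : ℕ} {μ : Fin k → PMF α} (h : ∀ i, (μ i).support.Finite)
    (f : Fin k → α → ℝ) : Ex (prodLaw k μ) (fun v => ∏ i, f i (v i)) = ∏ i, Ex (μ i) (f i) := by
  induction k with
  | zero => simp [prodLaw, Ex_pure]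
  | succ k ih =>
    rw [Ex_prodLaw_succ h, Fin.prod_univ_succ, ← ih fun i => h i.succ]
    simp only [Fin.prod_univ_succ, Fin.cons_zero, Fin.cons_succ]
    simp only [Ex_const_mul (finite_support_prodLaw fun i => h (Fin.succ i))]
    simp only [mul_comm (f 0 _), Ex_const_mul (h 0)]
    rw [mul_comm]

/-- Drawing all parameters first and then the values is the same as drawing the pairs. -/
theorem prodLaw_bind {α β : Type} {k : ℕ} (μ : Fin k → PMF α) (g : Fin k → α → PMF β) :
    ((prodLaw k μ).bind fun v => prodLaw k fun i => g i (v i)) =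
      prodLaw k fun i => (μ i).bind (g i) := by
  induction k with
  | zero => exact PMF.pure_bind _ _
  | succ k ih =>
    simp only [prodLaw, PMF.bind_bind, PMF.pure_bind, Fin.cons_zero, Fin.cons_succ]
    congr 1
    funext a
    -- The first value is drawn after all parameters on one side and immediately after its own
    -- parameter on the other; independent draws may be exchanged.
    rw [PMF.bind_comm]
    congr 1
    funext b
    rw [← ih, PMF.bind_bind]

theorem prodLaw_map_eval {α : Type} {k : ℕ} (μ : Fin k → PMF α) (j : Fin k) :
    (prodLaw k μ).map (fun v => v j) = μ j := by
  induction k with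
  | zero => exact j.elim0
  | succ k ih =>
    simp only [prodLaw, PMF.map_bind, PMF.pure_map]
    refine Fin.cases ?_ (fun j => ?_) j
    · simp only [Fin.cons_zero, PMF.bind_const, PMF.bind_pure]
    · simp only [Fin.cons_succ]
      rw [PMF.bind_const]
      exact ih (fun i => μ i.succ) j

/-! ### The law of the sampler -/

/-- The law of `coin`. -/
def coinLaw : PMF Bool :=
  (PMF.uniformOfFintype (Fin 2)).bind fun r => PMF.pure (r.val == 1)

theorem denotes_rand (k : ℕ) : Denotes (rand k) (PMF.uniformOfFintype (Fin (k + 1))) :=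
  .tick _ (.draw (finite_support_of_finite _))

theorem denotes_coin : Denotes coin coinLaw := (denotes_rand 1).bind fun _ => .pure _

theorem coinLaw_apply (b : Bool) : coinLaw b = 2⁻¹ := by
  rw [coinLaw, PMF.bind_apply, tsum_fintype, Fin.sum_univ_two]
  cases b <;> simp [PMF.pure_apply, PMF.uniformOfFintype_apply]

/-- The law of a uniformly random one-qubit Pauli matrix. -/
def pairLaw : PMF (Bool × Bool) :=
  coinLaw.bind fun x => coinLaw.bind fun z => PMF.pure (x, z)

theorem pairLaw_apply (a : Bool × Bool) : pairLaw a = 2⁻¹ * 2⁻¹ := by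
  obtain ⟨x, z⟩ := a
  simp only [pairLaw, PMF.bind_apply, tsum_fintype, Fintype.sum_bool, PMF.pure_apply,
    coinLaw_apply]
  cases x <;> cases z <;> simp

/-- The Pauli string encoded by the binary digits of `r + 1`. -/
def string {n : ℕ} (r : Fin (4 ^ (n + 1) - 2 + 1)) : Fin (n + 1) → Bool × Bool :=
  fun i => ((r.val + 1).testBit (2 * i.val), (r.val + 1).testBit (2 * i.val + 1))

/-- The shift `r + 1` runs over all nonzero numbers of `2 (n + 1)` bits, that is, over the codes of
the nontrivial strings. -/
theorem four_pow_sub {n : ℕ} : 4 ^ (n + 1) - 2 + 1 + 1 = 2 ^ (2 * (n + 1)) := by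
  have : 4 ≤ 4 ^ (n + 1) := Nat.le_self_pow (by omega) 4
  rw [pow_mul]
  norm_num
  omega

theorem testBit_succ_eq {n : ℕ} (r : Fin (4 ^ (n + 1) - 2 + 1)) (i : ℕ) :
    (r.val + 1).testBit i = if h : i < 2 * (n + 1) then
      (if i % 2 = 0 then (string r ⟨i / 2, by omega⟩).1 else (string r ⟨i / 2, by omega⟩).2)
      else false := by
  have hr := r.2
  have h4 := @four_pow_sub n
  split_ifs with h h2
  · simp only [string]
    congr 1
    omega
  · simp only [string]
    congr 1
    omega
  · exact Nat.testBit_lt_two_pow (lt_of_lt_of_le (by omega)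
      (Nat.pow_le_pow_right (by norm_num) (not_lt.1 h)))

theorem string_injective {n : ℕ} :
    Function.Injective (string : Fin (4 ^ (n + 1) - 2 + 1) → Fin (n + 1) → Bool × Bool) := by
  intro r r' h
  have : r.val + 1 = r'.val + 1 := Nat.eq_of_testBit_eq fun i => by
    rw [testBit_succ_eq, testBit_succ_eq, h]
  exact Fin.ext (by omega)

theorem string_ne_pId {n : ℕ} (r : Fin (4 ^ (n + 1) - 2 + 1)) : string r ≠ pId := by
  intro h
  have : r.val + 1 = 0 := Nat.eq_of_testBit_eq fun i => by
    rw [testBit_succ_eq, h]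
    simp [pId]
  omega

/-- Surjectivity by counting: the encoding is injective between sets of equal size. -/
theorem exists_string {n : ℕ} {a : Fin (n + 1) → Bool × Bool} (ha : a ≠ pId) :
    ∃ r, string r = a := by
  have hinj : Function.Injective
      (fun r => (⟨string r, string_ne_pId r⟩ : {a : Fin (n + 1) → Bool × Bool // a ≠ pId})) :=
    fun r r' h => string_injective (congrArg Subtype.val h)
  have hcard : Fintype.card (Fin (4 ^ (n + 1) - 2 + 1)) =
      Fintype.card {a : Fin (n + 1) → Bool × Bool // a ≠ pId} := by
    have h4 : 4 ≤ 4 ^ (n + 1) := Nat.le_self_pow (by omega) 4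
    rw [Fintype.card_fin, Fintype.card_subtype_compl, Fintype.card_subtype_eq]
    simp
    omega
  obtain ⟨r, hr⟩ := ((Fintype.bijective_iff_injective_and_card _).2 ⟨hinj, hcard⟩).2 ⟨a, ha⟩
  exact ⟨r, congrArg Subtype.val hr⟩

/-- The law of the circuit drawn by `cliffordSampler`. -/
def samplerLaw : (n : ℕ) → PMF (Circuit n)
  | 0 => PMF.pure []
  | n + 1 =>
      (PMF.uniformOfFintype (Fin (4 ^ (n + 1) - 2 + 1))).bind fun r =>
      (prodLaw n fun _ => pairLaw).bind fun q =>
      coinLaw.bind fun z => coinLaw.bind fun s => coinLaw.bind fun t =>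
      (samplerLaw n).bind fun c =>
        PMF.pure (c.map Gate.shift ++ pauliZero s t ++ xTo z q ++ zTo (string r))

theorem denotes_cliffordSampler (n : ℕ) : Denotes (cliffordSampler n) (samplerLaw n) := by
  induction n with
  | zero => exact .pure _
  | succ n ih =>
    refine (denotes_rand _).bind fun r => ?_
    refine (Denotes.forFin fun _ =>
      denotes_coin.bind fun x => denotes_coin.bind fun z => .pure _).bind fun q => ?_
    refine denotes_coin.bind fun z => denotes_coin.bind fun s => denotes_coin.bind fun t => ?_
    exact ih.bind fun c => .tick _ (.pure _)

theorem isCliffordCircuit_of_mem_support {n : ℕ} {c : Circuit n}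
    (hc : c ∈ (samplerLaw n).support) : IsCliffordCircuit c := by
  induction n with
  | zero =>
    rw [samplerLaw, PMF.mem_support_pure_iff] at hc
    rw [hc]; exact .nil
  | succ n ih =>
    simp only [samplerLaw, PMF.mem_support_bind_iff, PMF.mem_support_pure_iff] at hc
    obtain ⟨r, _, q, _, z, _, s, _, t, _, c', hc', rfl⟩ := hc
    exact (((ih hc').map_shift.append (isCliffordCircuit_pauliZero s t)).append
      (isCliffordCircuit_xTo z q)).append (isCliffordCircuit_zTo _)

theorem toOuterMeasure_bind_eq_zero {α β : Type} {p : PMF α} {f : α → PMF β} {s : Set β}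
    (h : ∀ a, (f a).toOuterMeasure s = 0) : (p.bind f).toOuterMeasure s = 0 := by
  simp [PMF.toOuterMeasure_bind_apply, h]

theorem toOuterMeasure_bind_eq_single {α β : Type} {p : PMF α} {f : α → PMF β} {s : Set β}
    (a : α) (h : ∀ a', a' ≠ a → (f a').toOuterMeasure s = 0) :
    (p.bind f).toOuterMeasure s = p a * (f a).toOuterMeasure s := by
  rw [PMF.toOuterMeasure_bind_apply]
  exact tsum_eq_single a fun a' ha' => by rw [h a' ha', mul_zero]

theorem toOuterMeasure_pure_eq_zero {α : Type} {a : α} {s : Set α} (h : a ∉ s) :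
    (PMF.pure a).toOuterMeasure s = 0 := by
  rw [PMF.toOuterMeasure_pure_apply, if_neg h]

theorem out_toMatrix {n : ℕ} (a : Fin (n + 1) → Bool × Bool) (q : Fin n → Bool × Bool)
    (z s t : Bool) (c : Circuit n) :
    Circuit.toMatrix (c.map Gate.shift ++ pauliZero s t ++ xTo z q ++ zTo a) =
      (frame a q z s t).toMatrix * lift c.toMatrix := by
  simp only [Circuit.toMatrix_append, frame_toMatrix, Circuit.toMatrix_map_shift, mul_assoc]

theorem norm_apply_of_mem_unitary_zero {U : Op 0} (hU : U ∈ unitary (Op 0)) (o : Bits 0) :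
    ‖U o o‖ = 1 := by
  have h := congrFun (congrFun (mul_conjTranspose_self_of_mem hU) o) o
  rw [Matrix.mul_apply, Fintype.sum_subsingleton _ o, Matrix.conjTranspose_apply,
    Matrix.one_apply_eq, Complex.star_def, Complex.mul_conj, Complex.normSq_eq_norm_sq] at h
  norm_cast at h
  exact (pow_eq_one_iff_of_nonneg (norm_nonneg _) two_ne_zero).1 h

/-- Without qubits a unitary is a single complex number of modulus one. This is the base case of
uniformity. -/
theorem unitary_eqUpToPhase_zero {U V : Op 0} (hU : U ∈ unitary (Op 0))
    (hV : V ∈ unitary (Op 0)) : EqUpToPhase U V := by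
  obtain ⟨o⟩ : Nonempty (Bits 0) := inferInstance
  have h1 := norm_apply_of_mem_unitary_zero hU o
  have h2 := norm_apply_of_mem_unitary_zero hV o
  have hne : V o o ≠ 0 := fun e => by
    rw [e, norm_zero] at h2
    exact zero_ne_one h2
  refine ⟨U o o / V o o, by rw [norm_div, h1, h2, div_one], ?_⟩
  ext x y
  rw [Subsingleton.elim x o, Subsingleton.elim y o, Matrix.smul_apply, smul_eq_mul,
    div_mul_cancel₀ _ hne]

/-- All Clifford unitaries are equally likely. -/
theorem samplerLaw_uniform (n : ℕ) : ∃ κ : ENNReal, ∀ V : Op n, IsClifford V →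
    (samplerLaw n).toOuterMeasure {c | EqUpToPhase c.toMatrix V} = κ := by
  induction n with
  | zero =>
    refine ⟨1, fun V hV => ?_⟩
    rw [samplerLaw, PMF.toOuterMeasure_pure_apply, if_pos]
    exact unitary_eqUpToPhase_zero (one_mem _) hV.1
  | succ n ih =>
    obtain ⟨κ, hκ⟩ := ih
    -- The class of `V` is hit by exactly one choice of `r`, `q`, `z`, `s`, `t`. The weight is the
    -- product of the probabilities of these choices and the weight `κ` of the class of `W`.
    refine ⟨((Fintype.card (Fin (4 ^ (n + 1) - 2 + 1)) : ENNReal)⁻¹) *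
      ((∏ _i : Fin n, (2⁻¹ * 2⁻¹)) * (2⁻¹ * (2⁻¹ * (2⁻¹ * κ)))), fun V hV => ?_⟩
    obtain ⟨a, q₀, z₀, s₀, t₀, W, ha, hW, rfl⟩ := exists_frame hV
    obtain ⟨r₀, rfl⟩ := exists_string ha
    have key : ∀ {r q z s t} {c : Circuit n}, EqUpToPhase
        (Circuit.toMatrix (c.map Gate.shift ++ pauliZero s t ++ xTo z q ++ zTo (string r)))
        ((frame (string r₀) q₀ z₀ s₀ t₀).toMatrix * lift W) →
        r = r₀ ∧ q = q₀ ∧ z = z₀ ∧ s = s₀ ∧ t = t₀ ∧ EqUpToPhase c.toMatrix W := by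
      intro r q z s t c h
      rw [out_toMatrix] at h
      obtain ⟨h1, h2⟩ := frame_unique ha (string_ne_pId r) hW.1 c.toMatrix_mem h
      exact ⟨string_injective h1, h2⟩
    rw [samplerLaw, toOuterMeasure_bind_eq_single r₀, toOuterMeasure_bind_eq_single q₀,
      toOuterMeasure_bind_eq_single z₀, toOuterMeasure_bind_eq_single s₀,
      toOuterMeasure_bind_eq_single t₀]
    · have hlast : ((samplerLaw n).bind fun c => PMF.pure (c.map Gate.shift ++ pauliZero s₀ t₀ ++
          xTo z₀ q₀ ++ zTo (string r₀))).toOuterMeasure {c | EqUpToPhase (Circuit.toMatrix c)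
            ((frame (string r₀) q₀ z₀ s₀ t₀).toMatrix * lift W)} = κ := by
        rw [← hκ W hW]
        change ((samplerLaw n).map _).toOuterMeasure _ = _
        rw [PMF.toOuterMeasure_map_apply]
        congr 1
        ext c
        simp only [Set.mem_preimage, Set.mem_ofPred_eq]
        refine ⟨fun h => (key h).2.2.2.2.2, fun h => ?_⟩
        rw [out_toMatrix]
        exact (eqUpToPhase_lift.2 h).mul_left _
      rw [hlast, prodLaw_apply, PMF.uniformOfFintype_apply]
      simp only [pairLaw_apply, coinLaw_apply]
    · exact fun t ht => toOuterMeasure_bind_eq_zero fun c =>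
        toOuterMeasure_pure_eq_zero fun h => ht (key h).2.2.2.2.1
    · exact fun s hs => toOuterMeasure_bind_eq_zero fun t => toOuterMeasure_bind_eq_zero fun c =>
        toOuterMeasure_pure_eq_zero fun h => hs (key h).2.2.2.1
    · exact fun z hz => toOuterMeasure_bind_eq_zero fun s => toOuterMeasure_bind_eq_zero fun t =>
        toOuterMeasure_bind_eq_zero fun c =>
        toOuterMeasure_pure_eq_zero fun h => hz (key h).2.2.1
    · exact fun q hq => toOuterMeasure_bind_eq_zero fun z => toOuterMeasure_bind_eq_zero fun s =>
        toOuterMeasure_bind_eq_zero fun t => toOuterMeasure_bind_eq_zero fun c =>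
        toOuterMeasure_pure_eq_zero fun h => hq (key h).2.1
    · exact fun r hr => toOuterMeasure_bind_eq_zero fun q => toOuterMeasure_bind_eq_zero fun z =>
        toOuterMeasure_bind_eq_zero fun s => toOuterMeasure_bind_eq_zero fun t =>
        toOuterMeasure_bind_eq_zero fun c =>
        toOuterMeasure_pure_eq_zero fun h => hr (key h).1

theorem isUniformClifford_cliffordSampler (n : ℕ) : IsUniformClifford (cliffordSampler n) := by
  have hd := denotes_cliffordSampler n
  refine ⟨fun o ho => (isCliffordCircuit_of_mem_support (hd.mem_support ho)).isClifford,
    fun V W hV hW => ?_⟩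
  obtain ⟨κ, hκ⟩ := samplerLaw_uniform n
  have h1 := hd.law_apply {c | EqUpToPhase (Circuit.toMatrix c) V}
  have h2 := hd.law_apply {c | EqUpToPhase (Circuit.toMatrix c) W}
  rw [hκ V hV] at h1
  rw [hκ W hW] at h2
  exact h1.trans h2.symm

/-! ### Invariance of the law of the sampler -/

theorem EqUpToPhase.isClifford {n : ℕ} {U V : Op n} (h : EqUpToPhase U V) (hU : IsClifford U) :
    IsClifford V := by
  refine ⟨?_, fun p => ?_⟩
  · have h1 := h.conj_eq 1
    rw [mul_one, mul_one, mul_conjTranspose_self_of_mem hU.1] at h1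
    exact Unitary.mem_iff.2 ⟨mul_eq_one_comm.1 h1.symm, h1.symm⟩
  · obtain ⟨q, hq⟩ := hU.2 p
    exact ⟨q, h.maps hq⟩

/-- Operators up to a global phase. -/
def phaseSetoid (n : ℕ) : Setoid (Op n) :=
  ⟨EqUpToPhase, EqUpToPhase.refl, EqUpToPhase.symm, EqUpToPhase.trans⟩

/-- Left multiplication by a unitary, up to a global phase. -/
def mulPhase {n : ℕ} (W : Op n) : Quotient (phaseSetoid n) → Quotient (phaseSetoid n) :=
  Quotient.map' (fun U => W * U) fun _ _ h => EqUpToPhase.mul_left h W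

theorem mulPhase_mulPhase {n : ℕ} {W W' : Op n} (h : W * W' = 1)
    (x : Quotient (phaseSetoid n)) : mulPhase W (mulPhase W' x) = x := by
  refine Quotient.inductionOn' x fun U => ?_
  change Quotient.mk'' (W * (W' * U)) = _
  rw [← mul_assoc, h, one_mul]

/-- Left multiplication by a unitary, as a permutation of the operators up to a global phase. -/
def mulPhaseEquiv {n : ℕ} {W : Op n} (hW : W ∈ unitary (Op n)) :
    Quotient (phaseSetoid n) ≃ Quotient (phaseSetoid n) where
  toFun := mulPhase W
  invFun := mulPhase Wᴴ
  left_inv := mulPhase_mulPhase (conjTranspose_mul_self_of_mem hW)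
  right_inv := mulPhase_mulPhase (mul_conjTranspose_self_of_mem hW)

theorem finite_support_samplerLaw (n : ℕ) : (samplerLaw n).support.Finite :=
  (denotes_cliffordSampler n).1

/-- Many circuits implement the same unitary, so the law is pushed forward to phase classes, where
left multiplication by `W` is a bijection preserving the weights. -/
theorem Ex_samplerLaw_mul_left {n : ℕ} {W : Op n} (hW : IsClifford W) {Φ : Op n → ℂ}
    (hΦ : ∀ U V, EqUpToPhase U V → Φ U = Φ V) :
    Ex (samplerLaw n) (fun c => Φ (W * c.toMatrix)) =
      Ex (samplerLaw n) (fun c => Φ c.toMatrix) := by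
  let cls : Circuit n → Quotient (phaseSetoid n) := fun c => Quotient.mk'' c.toMatrix
  let Ψ : Quotient (phaseSetoid n) → ℂ := fun x => Quotient.liftOn' x Φ hΦ
  have h1 : Ex (samplerLaw n) (fun c => Φ c.toMatrix) = Ex ((samplerLaw n).map cls) Ψ :=
    (Ex_map (finite_support_samplerLaw n) cls Ψ).symm
  have h2 : Ex (samplerLaw n) (fun c => Φ (W * c.toMatrix)) =
      Ex ((samplerLaw n).map cls) fun x => Ψ (mulPhaseEquiv hW.1 x) :=
    (Ex_map (finite_support_samplerLaw n) cls fun x => Ψ (mulPhaseEquiv hW.1 x)).symm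
  obtain ⟨κ, hκ⟩ := samplerLaw_uniform n
  have hval : ∀ V : Op n, (samplerLaw n).map cls (Quotient.mk'' V) =
      (samplerLaw n).toOuterMeasure {c | EqUpToPhase c.toMatrix V} := fun V => by
    rw [← PMF.toOuterMeasure_apply_singleton, PMF.toOuterMeasure_map_apply]
    congr 1
    ext c
    exact Quotient.eq''
  have hzero : ∀ V : Op n, ¬ IsClifford V →
      (samplerLaw n).toOuterMeasure {c | EqUpToPhase c.toMatrix V} = 0 := fun V hV => by
    rw [PMF.toOuterMeasure_apply_eq_zero_iff, Set.disjoint_left]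
    exact fun c hc h => hV (EqUpToPhase.isClifford h
      (isCliffordCircuit_of_mem_support hc).isClifford)
  -- Clifford classes all weigh `κ` and other classes weigh `0`; multiplication by the Clifford
  -- unitary `W` respects this distinction in both directions.
  have hinv : ∀ x, (samplerLaw n).map cls (mulPhaseEquiv hW.1 x) = (samplerLaw n).map cls x := by
    intro x
    refine Quotient.inductionOn' x fun V => ?_
    change (samplerLaw n).map cls (Quotient.mk'' (W * V)) = _
    rw [hval, hval]
    by_cases hV : IsClifford V
    · rw [hκ V hV, hκ _ (hW.mul hV)]
    · rw [hzero V hV, hzero]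
      intro h
      have := hW.conjTranspose.mul h
      rw [← mul_assoc, conjTranspose_mul_self_of_mem hW.1, one_mul] at this
      exact hV this
  rw [h1, h2]
  have h3 := finsum_comp_equiv (mulPhaseEquiv hW.1)
    (f := fun x => ((samplerLaw n).map cls x).toReal • Ψ x)
  simp only [hinv] at h3
  exact h3

/-! ### Transitivity of the Clifford group -/

theorem exists_clifford_pZ {n : ℕ} {p : Fin (n + 1) → Bool × Bool} (hp : p ≠ pId) :
    ∃ W : Op (n + 1), IsClifford W ∧ Maps W p (pZ 0) :=
  ⟨_, (isCliffordCircuit_zTo p).isClifford.conjTranspose,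
    (maps_zTo hp).conjTranspose (Circuit.toMatrix_mem _)⟩

theorem exists_clifford_maps {n : ℕ} {p q : Fin n → Bool × Bool} (hp : p ≠ pId) (hq : q ≠ pId) :
    ∃ W : Op n, IsClifford W ∧ Maps W p q := by
  cases n with
  | zero => exact absurd (Subsingleton.elim _ _) hp
  | succ n =>
    obtain ⟨W, hW, h⟩ := exists_clifford_pZ hp
    obtain ⟨W', hW', h'⟩ := exists_clifford_pZ hq
    exact ⟨_, hW'.conjTranspose.mul hW, (h'.conjTranspose hW'.1).mul h⟩

theorem pauli_cons {n : ℕ} (a : Bool × Bool) (p : Fin n → Bool × Bool) :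
    pauli (Fin.cons a p : Fin (n + 1) → Bool × Bool) =
      pauli (Fin.cons a pId : Fin (n + 1) → Bool × Bool) * lift (pauli p) := by
  rw [lift_pauli, pauli_eq_tens, pauli_eq_tens, pauli_eq_tens, tens_mul]
  congr 1
  funext k
  refine Fin.cases ?_ (fun k => ?_) k <;> simp [pauliOne, pId]

theorem Maps.lift_cons {n : ℕ} {U : Op n} {p q : Fin n → Bool × Bool} (h : Maps U p q)
    (a : Bool × Bool) : Maps (lift U) (Fin.cons a p) (Fin.cons a q) := by
  obtain ⟨s, hs, h⟩ := h.exists_smul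
  refine .of_smul hs ?_
  rw [pauli_cons, pauli_cons a q, ← mul_assoc, lift_comm_cons, lift_conjTranspose, mul_assoc,
    mul_assoc, ← mul_assoc (lift U), ← lift_mul, ← lift_mul, h, lift_smul, Matrix.mul_smul]

theorem IsCliffordCircuit.lift {n : ℕ} {c : Circuit n} (h : IsCliffordCircuit c) :
    IsClifford (QCQC.lift c.toMatrix) := by
  rw [← Circuit.toMatrix_map_shift]
  exact h.map_shift.isClifford

/-- After `p` is moved to `Z` on qubit `0`, commutation leaves the image of `q` with only `I` or `Z`
there. Its remaining part is nontrivial and can be moved to `Z` on qubit `1` without touching qubit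
`0`. -/
theorem exists_clifford_pZ_pZ {n : ℕ} {p q : Fin (n + 2) → Bool × Bool} (hp : p ≠ pId)
    (hq : q ≠ pId) (hpq : p ≠ q) (hs : sgn p q = 1) :
    ∃ W : Op (n + 2), IsClifford W ∧ Maps W p (pZ 0) ∧ Maps W q (pZ 1) := by
  obtain ⟨W₁, hW₁, h₁⟩ := exists_clifford_pZ hp
  obtain ⟨r, hr⟩ : ∃ r, Maps W₁ q r := hW₁.2 q
  have hr0 : (r 0).1 = false := by
    rw [h₁.sgn_eq hW₁.1 hr, sgn_comm, pZ_zero, sgn_cons_pId] at hs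
    rcases h0 : r 0 with ⟨_ | _, _ | _⟩ <;> rw [h0] at hs <;> simp [sgnOne] at hs ⊢ <;>
      norm_num at hs
  have hrc : r = Fin.cons (false, (r 0).2) (Fin.tail r) := by
    rw [← hr0]; exact (Fin.cons_self_tail r).symm
  -- A trivial tail would make the image of `q` either the identity or the image of `p`.
  have htail : Fin.tail r ≠ pId := fun e => by
    rw [e] at hrc
    cases hb : (r 0).2 with
    | false =>
      refine hq (hr.injective hW₁.1 ?_)
      have : r = pId := by
        rw [hrc, hb]
        funext k
        refine Fin.cases ?_ (fun k => ?_) k <;> simp [pId]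
      rw [this]
      exact Maps.pId_eq hW₁.1
    | true =>
      refine hpq (h₁.injective hW₁.1 ?_)
      rwa [pZ_zero, ← hb, ← hrc]
  have hc := (isCliffordCircuit_zTo (Fin.tail r)).lift.conjTranspose
  have hm := ((maps_zTo htail).lift_cons (false, (r 0).2)).conjTranspose
    (lift_mem.2 (Circuit.toMatrix_mem _))
  rw [← hrc] at hm
  have h2p : Maps (lift (zTo (Fin.tail r)).toMatrix)ᴴ (pZ 0) (pZ 0) :=
    (maps_lift_pZ (Circuit.toMatrix_mem _)).conjTranspose (lift_mem.2 (Circuit.toMatrix_mem _))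
  cases hb : (r 0).2 with
  | false =>
    refine ⟨_, hc.mul hW₁, h2p.mul h₁, ?_⟩
    have : (pZ 1 : Fin (n + 2) → Bool × Bool) = Fin.cons (false, (r 0).2) (pZ 0) := by
      rw [hb]
      funext k
      refine Fin.cases ?_ (fun k => ?_) k
      · simp [pZ]
      · by_cases h0 : k = 0
        · subst h0; simp [pZ]
        · have : k.succ ≠ 1 := fun e =>
            h0 (Fin.succ_injective _ (e.trans Fin.succ_zero_eq_one.symm))
          simp [pZ, this, h0]
    rw [this]
    exact hm.mul hr
  | true =>
    -- The second string has become `Z ⊗ Z` on qubits `0` and `1`; one more CNOT removes the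
    -- superfluous `Z` and fixes `Z` on its control.
    refine ⟨_, (isCliffordCircuit_gCNOT 0 1).isClifford.mul (hc.mul hW₁), ?_, ?_⟩
    · refine Maps.mul ?_ (h2p.mul h₁)
      have := maps_gCNOT (n := n + 2) (i := 0) (j := 1) (by simp) (pZ 0)
      have e : actC 0 1 (pZ 0) = (pZ 0 : Fin (n + 2) → Bool × Bool) := by
        funext k
        by_cases h1 : k = 1
        · subst h1; simp [actC, pZ]
        · by_cases h0 : k = 0
          · subst h0; simp [actC, pZ]
          · simp [actC, h1, h0]
      rwa [e] at this
    · refine Maps.mul ?_ (hm.mul hr)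
      have := maps_gCNOT (n := n + 2) (i := 0) (j := 1) (by simp)
        (Fin.cons (false, (r 0).2) (pZ 0))
      have e : actC 0 1 (Fin.cons (false, (r 0).2) (pZ 0)) =
          (pZ 1 : Fin (n + 2) → Bool × Bool) := by
        have h1' : (Fin.cons (false, true) (pZ 0) : Fin (n + 2) → Bool × Bool) 1 =
          (false, true) := by
          rw [← Fin.succ_zero_eq_one, Fin.cons_succ]; simp [pZ]
        rw [hb]
        funext k
        refine Fin.cases ?_ (fun k => ?_) k
        · simp [actC, pZ, h1']
        · by_cases h0 : k = 0
          · subst h0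
            simp [actC, pZ, h1']
          · have : k.succ ≠ 1 := fun e =>
              h0 (Fin.succ_injective _ (e.trans Fin.succ_zero_eq_one.symm))
            simp [actC, pZ, this, h0]
      rwa [e] at this

/-- The Clifford group acts transitively on the pairs of commuting, distinct and nontrivial Pauli
strings. -/
theorem exists_clifford_maps_maps {n : ℕ} {p q p' q' : Fin n → Bool × Bool} (hp : p ≠ pId)
    (hq : q ≠ pId) (hpq : p ≠ q) (hs : sgn p q = 1) (hp' : p' ≠ pId) (hq' : q' ≠ pId)
    (hpq' : p' ≠ q') (hs' : sgn p' q' = 1) :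
    ∃ W : Op n, IsClifford W ∧ Maps W p p' ∧ Maps W q q' := by
  match n with
  | 0 => exact absurd (Subsingleton.elim _ _) hp
  | 1 =>
    -- On one qubit, distinct nontrivial Pauli matrices anticommute, so no such pair exists.
    exfalso
    have hp0 : p 0 ≠ (false, false) := fun e => hp (by funext k; rw [Subsingleton.elim k 0, e]; rfl)
    have hq0 : q 0 ≠ (false, false) := fun e => hq (by funext k; rw [Subsingleton.elim k 0, e]; rfl)
    have hpq0 : p 0 ≠ q 0 := fun e => hpq (by funext k; rw [Subsingleton.elim k 0, e])
    rw [sgn, Fin.prod_univ_one] at hs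
    rcases h1 : p 0 with ⟨_ | _, _ | _⟩ <;> rcases h2 : q 0 with ⟨_ | _, _ | _⟩ <;>
      simp [h1, h2, sgnOne] at hp0 hq0 hpq0 hs <;> norm_num at hs
  | n + 2 =>
    obtain ⟨W, hW, h1, h2⟩ := exists_clifford_pZ_pZ hp hq hpq hs
    obtain ⟨W', hW', h1', h2'⟩ := exists_clifford_pZ_pZ hp' hq' hpq' hs'
    exact ⟨_, hW'.conjTranspose.mul hW, (h1'.conjTranspose hW'.1).mul h1,
      (h2'.conjTranspose hW'.1).mul h2⟩

/-! ### Moments of random Clifford measurements -/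

/-- The Pauli string of `Z`s at the marked qubits. -/
def zs {n : ℕ} (z : Bits n) : Fin n → Bool × Bool := fun i => (false, z i)

/-- The eigenvalue of `zs z` at a basis vector. -/
def chi {n : ℕ} (z x : Bits n) : ℂ := ∏ i, if z i && x i then -1 else 1

theorem pauli_zs {n : ℕ} (z : Bits n) : pauli (zs z) = Matrix.diagonal (chi z) := by
  ext x y
  rw [pauli_eq_tens, tens_apply, Matrix.diagonal_apply]
  split_ifs with h
  · subst h
    exact Finset.prod_congr rfl fun i _ => by simp [pauliOne_apply, zs]
  · obtain ⟨i, hi⟩ := Function.ne_iff.1 h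
    exact Finset.prod_eq_zero (Finset.mem_univ i) (by simp [pauliOne_apply, zs, hi])

theorem sum_chi_mul_chi {n : ℕ} (x y : Bits n) :
    ∑ z, chi z x * chi z y = if x = y then 2 ^ n else 0 := by
  simp only [chi, ← Finset.prod_mul_distrib]
  rw [sum_bits_prod fun i b => (if b && x i then (-1 : ℂ) else 1) * if b && y i then -1 else 1]
  have : ∀ i, (∑ b, (if b && x i then (-1 : ℂ) else 1) * if b && y i then -1 else 1) =
      if x i = y i then 2 else 0 := fun i => by
    cases x i <;> cases y i <;> (simp; try norm_num)
  simp only [this]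
  simpa using prod_ite_eq_ite (2 : ℂ) x y

theorem trace_mul_zs {n : ℕ} (A : Op n) (z : Bits n) :
    (A * pauli (zs z)).trace = ∑ x, A x x * chi z x := by
  simp [pauli_zs, Matrix.trace, Matrix.mul_diagonal]

theorem trace_mul_zs_mul_zs {n : ℕ} (A : Op n) (z z' : Bits n) :
    (A * (pauli (zs z) * pauli (zs z'))).trace = ∑ x, A x x * (chi z x * chi z' x) := by
  simp [pauli_zs, Matrix.trace, Matrix.mul_diagonal, Matrix.diagonal_mul_diagonal]

theorem sum_trace_mul_chi {n : ℕ} (A : Op n) (b : Bits n) :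
    ∑ z, (A * pauli (zs z)).trace * chi z b = 2 ^ n * A b b := by
  simp only [trace_mul_zs, Finset.sum_mul]
  rw [Finset.sum_comm]
  simp only [mul_assoc, ← Finset.mul_sum, sum_chi_mul_chi]
  simp [mul_comm]

/-- Only `Z`-strings see the diagonal, and their eigenvalues are the characters of the group of bit
strings. This is Plancherel's identity for the two diagonals. -/
theorem sum_diag_mul {n : ℕ} (A R : Op n) :
    2 ^ n * ∑ b, R b b * A b b =
      ∑ z, (A * pauli (zs z)).trace * (R * pauli (zs z)).trace := by
  have h : ∀ b, 2 ^ n * (R b b * A b b) =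
      ∑ z, (A * pauli (zs z)).trace * (R b b * chi z b) := fun b => by
    rw [mul_left_comm, ← sum_trace_mul_chi, Finset.mul_sum]
    exact Finset.sum_congr rfl fun z _ => by ring
  rw [Finset.mul_sum]
  simp only [h]
  rw [Finset.sum_comm]
  simp only [← Finset.mul_sum, trace_mul_zs R]

theorem sum_diag_mul_mul {n : ℕ} (A R : Op n) :
    (2 ^ n) ^ 2 * ∑ b, R b b * (A b b * A b b) =
      ∑ z, ∑ z', (A * pauli (zs z)).trace * (A * pauli (zs z')).trace *
        (R * (pauli (zs z) * pauli (zs z'))).trace := by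
  have h : ∀ b, (2 ^ n) ^ 2 * (R b b * (A b b * A b b)) = ∑ z, ∑ z',
      (A * pauli (zs z)).trace * (A * pauli (zs z')).trace * (R b b * (chi z b * chi z' b)) :=
    fun b => by
    have : (2 ^ n) ^ 2 * (R b b * (A b b * A b b)) =
        R b b * ((2 ^ n * A b b) * (2 ^ n * A b b)) := by ring
    rw [this, ← sum_trace_mul_chi, Finset.sum_mul_sum, Finset.mul_sum]
    refine Finset.sum_congr rfl fun z _ => ?_
    rw [Finset.mul_sum]
    exact Finset.sum_congr rfl fun z' _ => by ring
  rw [Finset.mul_sum]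
  simp only [h]
  rw [Finset.sum_comm]
  refine Finset.sum_congr rfl fun z _ => ?_
  rw [Finset.sum_comm]
  refine Finset.sum_congr rfl fun z' _ => ?_
  rw [← Finset.mul_sum, trace_mul_zs_mul_zs]

theorem sum_of_const_off {α : Type} [Fintype α] [DecidableEq α] (o : α) {f : α → ℂ} {e : ℂ}
    (h : ∀ a, a ≠ o → f a = e) : ∑ a, f a = (Fintype.card α - 1) * e + f o := by
  have : Nonempty α := ⟨o⟩
  rw [← Finset.sum_erase_add _ _ (Finset.mem_univ o),
    Finset.sum_congr rfl fun a ha => h a (Finset.ne_of_mem_erase ha), Finset.sum_const,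
    Finset.card_erase_of_mem (Finset.mem_univ o), Finset.card_univ, nsmul_eq_mul,
    Nat.cast_sub Fintype.card_pos, Nat.cast_one]

/-- Inclusion and exclusion: the degenerate pairs form a row, a column and the diagonal. These meet
pairwise only at `(o, o)`, which is counted three times. -/
theorem sum_pairs {α : Type} [Fintype α] [DecidableEq α] (o : α) (f : α → α → ℂ) :
    ∑ p, ∑ q, f p q = (∑ p, ∑ q, if p ≠ o ∧ q ≠ o ∧ p ≠ q then f p q else 0) +
      ∑ q, f o q + ∑ p, f p o + ∑ p, f p p - 2 * f o o := by
  have h : ∀ p q, f p q = (if p ≠ o ∧ q ≠ o ∧ p ≠ q then f p q else 0) +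
      (if p = o then f p q else 0) + (if q = o then f p q else 0) + (if p = q then f p q else 0) -
      (if p = o then if q = o then 2 * f p q else 0 else 0) := by
    intro p q
    by_cases hp : p = o
    · by_cases hq : q = o
      · subst hp; subst hq; simp; ring
      · subst hp; simp [hq, Ne.symm hq]
    · by_cases hq : q = o
      · subst hq; simp [hp]
      · by_cases hpq : p = q
        · subst hpq; simp [hp]
        · simp [hp, hq, hpq]
  conv_lhs => enter [2, p, 2, q]; rw [h p q]
  simp only [Finset.sum_sub_distrib, Finset.sum_add_distrib]
  congr 1
  · congr 1
    · congr 1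
      · congr 1
        rw [Finset.sum_comm]
        simp
      · simp
    · simp
  · simp [Finset.sum_ite_eq']

theorem zs_ne_pId {n : ℕ} {z : Bits n} (hz : z ≠ fun _ => false) : zs z ≠ pId := fun h =>
  hz (funext fun i => congrArg Prod.snd (congrFun h i))

theorem zs_false {n : ℕ} : zs (fun _ => false : Bits n) = pId := rfl

theorem zs_injective {n : ℕ} : Function.Injective (zs : Bits n → _) := fun _ _ h =>
  funext fun i => congrArg Prod.snd (congrFun h i)

theorem sgn_zs {n : ℕ} (z z' : Bits n) : sgn (zs z) (zs z') = 1 :=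
  Finset.prod_eq_one fun i _ => by simp [sgnOne, zs]

theorem Maps.exists_eq_smul_conj {n : ℕ} {W : Op n} {p q : Fin n → Bool × Bool} (h : Maps W p q) :
    ∃ s : ℂ, s * s = 1 ∧ pauli q = s • (W * pauli p * Wᴴ) := by
  obtain ⟨s, hs, h⟩ := h.exists_smul
  have hss : s * s = 1 := by rcases hs with rfl | rfl <;> norm_num
  exact ⟨s, hss, by rw [h, smul_smul, hss, one_smul]⟩

theorem conj_mul_conj {n : ℕ} {W : Op n} (hW : W ∈ unitary (Op n)) (A B : Op n) :
    W * A * Wᴴ * (W * B * Wᴴ) = W * (A * B) * Wᴴ := by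
  calc _ = W * A * (Wᴴ * W) * B * Wᴴ := by simp only [mul_assoc]
    _ = _ := by rw [conjTranspose_mul_self_of_mem hW]; simp only [mul_assoc, mul_one]

theorem trace_conj {n : ℕ} {W : Op n} (hW : W ∈ unitary (Op n)) (A : Op n) :
    (W * A * Wᴴ).trace = A.trace := by
  rw [Matrix.trace_mul_comm, ← mul_assoc, conjTranspose_mul_self_of_mem hW, one_mul]

/-- The product of the coefficients of two operators at a Pauli string. -/
def coeffTwo {n : ℕ} (A B : Op n) (p : Fin n → Bool × Bool) : ℂ :=
  (A * pauli p).trace * (B * pauli p).trace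

/-- The third order coefficient at a pair of Pauli strings. -/
def coeffThree {n : ℕ} (A R : Op n) (p q : Fin n → Bool × Bool) : ℂ :=
  (A * pauli p).trace * (A * pauli q).trace * (R * (pauli p * pauli q)).trace

theorem coeffTwo_conj {n : ℕ} {W : Op n} (hW : W ∈ unitary (Op n)) {p q : Fin n → Bool × Bool}
    (h : Maps W p q) (A B : Op n) :
    coeffTwo (W * A * Wᴴ) (W * B * Wᴴ) q = coeffTwo A B p := by
  obtain ⟨s, hs, e⟩ := h.exists_eq_smul_conj
  simp only [coeffTwo, e, Matrix.mul_smul, conj_mul_conj hW, Matrix.trace_smul, trace_conj hW,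
    smul_eq_mul]
  linear_combination ((A * pauli p).trace * (B * pauli p).trace) * hs

/-- Each string occurs twice in the coefficient, so the unknown signs of the images square to one.
-/
theorem coeffThree_conj {n : ℕ} {W : Op n} (hW : W ∈ unitary (Op n))
    {p q p' q' : Fin n → Bool × Bool} (h : Maps W p p') (h' : Maps W q q') (A R : Op n) :
    coeffThree (W * A * Wᴴ) (W * R * Wᴴ) p' q' = coeffThree A R p q := by
  obtain ⟨s, hs, e⟩ := h.exists_eq_smul_conj
  obtain ⟨s', hs', e'⟩ := h'.exists_eq_smul_conj
  simp only [coeffThree, e, e', Matrix.mul_smul, Matrix.smul_mul, conj_mul_conj hW,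
    Matrix.trace_smul, trace_conj hW, smul_eq_mul]
  linear_combination ((A * pauli p).trace * (A * pauli q).trace *
    (R * (pauli p * pauli q)).trace) * (s' * s' * hs + hs')

theorem sum_coeffTwo {n : ℕ} (A B : Op n) : ∑ p, coeffTwo A B p = 2 ^ n * (A * B).trace :=
  sum_trace_mul_trace A B

/-- The weight selects commuting pairs. Exchanging the strings multiplies the coefficient by `sgn p
q`, so the weighted sum is the average of the full sum and its transpose, which coincide. -/
theorem sum_coeffThree {n : ℕ} (A R : Op n) :
    ∑ p, ∑ q, (1 + sgn p q) / 2 * coeffThree A R p q = (2 ^ n) ^ 2 * (R * (A * A)).trace := by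
  have h1 : ∑ p, ∑ q, coeffThree A R p q = (2 ^ n) ^ 2 * (R * (A * A)).trace := by
    have h := sum_trace_mul_pauli A
    have e : R * ((∑ p, (A * pauli p).trace • pauli p) * ∑ q, (A * pauli q).trace • pauli q) =
        R * (((2 ^ n : ℂ) • A) * ((2 ^ n : ℂ) • A)) := by rw [h]
    have e2 := congrArg Matrix.trace e
    simp only [Finset.sum_mul_sum, Matrix.mul_sum, Matrix.trace_sum, smul_mul_assoc,
      mul_smul_comm, Matrix.trace_smul, smul_eq_mul] at e2
    rw [pow_two, mul_assoc, ← e2]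
    refine Finset.sum_congr rfl fun p _ => Finset.sum_congr rfl fun q _ => ?_
    unfold coeffThree
    ring
  have h2 : ∀ p q, sgn p q * coeffThree A R p q = coeffThree A R q p := fun p q => by
    unfold coeffThree
    rw [pauli_mul_comm p q, Matrix.mul_smul, Matrix.trace_smul, smul_eq_mul]
    have : sgn p q * sgn p q = 1 := by rcases sgn_eq p q with h | h <;> rw [h] <;> norm_num
    linear_combination ((A * pauli p).trace * (A * pauli q).trace *
      (R * (pauli q * pauli p)).trace) * this
  have h3 : ∀ p q, (1 + sgn p q) / 2 * coeffThree A R p q =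
      (1 / 2) * coeffThree A R p q + (1 / 2) * coeffThree A R q p := fun p q => by
    rw [← h2 p q]; ring
  simp only [h3, Finset.sum_add_distrib, ← Finset.mul_sum]
  rw [Finset.sum_comm (f := fun p q => coeffThree A R q p), h1]
  ring

theorem card_strings {n : ℕ} : (Fintype.card (Fin n → Bool × Bool) : ℂ) = (2 ^ n) ^ 2 := by
  rw [← pow_mul, mul_comm n 2, pow_mul]
  norm_num

theorem card_bits {n : ℕ} : (Fintype.card (Bits n) : ℂ) = 2 ^ n := by simp

theorem sum_weight {n : ℕ} : (∑ p : Fin n → Bool × Bool, ∑ q,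
    if p ≠ pId ∧ q ≠ pId ∧ p ≠ q then (1 + sgn p q) / 2 else 0) =
      ((2 ^ n) ^ 2 - 1) * ((2 ^ n) ^ 2 - 4) / 2 := by
  have h := sum_pairs (pId : Fin n → Bool × Bool) fun p q => (1 + sgn p q) / 2
  have hall : ∑ p : Fin n → Bool × Bool, ∑ q, (1 + sgn p q) / 2 =
      (2 ^ n) ^ 2 * (2 ^ n) ^ 2 / 2 + (2 ^ n) ^ 2 / 2 := by
    simp only [← Finset.sum_div, Finset.sum_add_distrib, Finset.sum_const, Finset.card_univ,
      nsmul_eq_mul, card_strings, mul_one]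
    rw [sum_of_const_off pId (e := 0) fun p hp => sum_sgn hp]
    simp only [sgn_comm pId, sgn_pId, Finset.sum_const, Finset.card_univ, nsmul_eq_mul,
      card_strings, mul_one, mul_zero, zero_add]
    ring
  simp only [hall, sgn_comm pId, sgn_pId, sgn_self, Finset.sum_const, Finset.card_univ,
    nsmul_eq_mul, card_strings] at h
  linear_combination -h

/-- A Clifford unitary carrying `p` to a reference string can be absorbed into the random one. If no
nontrivial string exists, any constant serves. -/
theorem Ex_coeffTwo_const {n : ℕ} (A B : Op n) : ∃ e : ℂ, ∀ p, p ≠ pId →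
    Ex (samplerLaw n) (fun c => coeffTwo (c.toMatrix * A * c.toMatrixᴴ)
      (c.toMatrix * B * c.toMatrixᴴ) p) = e := by
  by_cases hex : ∃ p₀ : Fin n → Bool × Bool, p₀ ≠ pId
  · obtain ⟨p₀, hp₀⟩ := hex
    refine ⟨Ex (samplerLaw n) (fun c => coeffTwo (c.toMatrix * A * c.toMatrixᴴ)
        (c.toMatrix * B * c.toMatrixᴴ) p₀), fun p hp => ?_⟩
    obtain ⟨W, hW, h⟩ := exists_clifford_maps hp hp₀
    rw [← Ex_samplerLaw_mul_left (Φ := fun U => coeffTwo (U * A * Uᴴ) (U * B * Uᴴ) p₀) hW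
      fun U V hUV => by simp only [hUV.conj_eq]]
    simp only [conj_mul, coeffTwo_conj hW.1 h]
  · exact ⟨0, fun p hp => absurd ⟨p, hp⟩ hex⟩

/-- The same absorption, with transitivity on pairs. For `n ≤ 1` there are no admissible pairs and
`e` is arbitrary; the factors multiplying it later then vanish. -/
theorem Ex_coeffThree_const {n : ℕ} (A R : Op n) : ∃ e : ℂ, ∀ p q, p ≠ pId → q ≠ pId → p ≠ q →
    sgn p q = 1 → Ex (samplerLaw n) (fun c => coeffThree (c.toMatrix * A * c.toMatrixᴴ)
      (c.toMatrix * R * c.toMatrixᴴ) p q) = e := by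
  by_cases hex : ∃ p₀ q₀ : Fin n → Bool × Bool, p₀ ≠ pId ∧ q₀ ≠ pId ∧ p₀ ≠ q₀ ∧ sgn p₀ q₀ = 1
  · obtain ⟨p₀, q₀, hp₀, hq₀, hpq₀, hs₀⟩ := hex
    refine ⟨Ex (samplerLaw n) (fun c => coeffThree (c.toMatrix * A * c.toMatrixᴴ)
        (c.toMatrix * R * c.toMatrixᴴ) p₀ q₀), fun p q hp hq hpq hs => ?_⟩
    obtain ⟨W, hW, h, h'⟩ := exists_clifford_maps_maps hp hq hpq hs hp₀ hq₀ hpq₀ hs₀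
    rw [← Ex_samplerLaw_mul_left (Φ := fun U => coeffThree (U * A * Uᴴ) (U * R * Uᴴ) p₀ q₀) hW
      fun U V hUV => by simp only [hUV.conj_eq]]
    simp only [conj_mul, coeffThree_conj hW.1 h h']
  · exact ⟨0, fun p q hp hq hpq hs => absurd ⟨p, q, hp, hq, hpq, hs⟩ hex⟩

/-- The sum over all `Z`-strings of the second order coefficients. -/
theorem Ex_sum_coeffTwo_zs {n : ℕ} (A B : Op n) :
    (2 ^ n + 1) * ∑ z, Ex (samplerLaw n) (fun c => coeffTwo (c.toMatrix * A * c.toMatrixᴴ)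
      (c.toMatrix * B * c.toMatrixᴴ) (zs z)) =
      2 ^ n * ((A * B).trace + A.trace * B.trace) := by
  obtain ⟨e, he⟩ := Ex_coeffTwo_const A B
  set F := fun p => Ex (samplerLaw n) (fun c => coeffTwo (c.toMatrix * A * c.toMatrixᴴ)
      (c.toMatrix * B * c.toMatrixᴴ) p) with hF
  replace he : ∀ p, p ≠ pId → F p = e := he
  change (2 ^ n + 1) * ∑ z, F (zs z) = _
  have hfin := finite_support_samplerLaw n
  have h0 : F pId = A.trace * B.trace := by
    simp only [hF, coeffTwo, pauli_pId, mul_one]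
    simp only [trace_conj (Circuit.toMatrix_mem _), Ex_const hfin]
  have h1 : ∑ p, F p = 2 ^ n * (A * B).trace := by
    simp only [hF]
    rw [← Ex_sum hfin]
    simp only [sum_coeffTwo, conj_mul_conj (Circuit.toMatrix_mem _),
      trace_conj (Circuit.toMatrix_mem _), Ex_const hfin]
  rw [sum_of_const_off pId he, h0, card_strings] at h1
  have h2 : ∑ z : Bits n, F (zs z) = (2 ^ n - 1) * e + A.trace * B.trace := by
    rw [sum_of_const_off (fun _ => false) fun z hz => he (zs z) (zs_ne_pId hz), card_bits, zs_false,
      h0]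
  rw [h2]
  -- The total over all strings gives `(d² - 1) e`; the `Z`-strings need `(d - 1) e`, and the
  -- prefactor `d + 1` supplies the missing factor.
  linear_combination h1

/-- The second moment of a random Clifford measurement. -/
theorem Ex_diag_mul {n : ℕ} (A R : Op n) :
    (2 ^ n + 1) * Ex (samplerLaw n) (fun c => ∑ b, (c.toMatrix * R * c.toMatrixᴴ) b b *
      (c.toMatrix * A * c.toMatrixᴴ) b b) = (A * R).trace + A.trace * R.trace := by
  have hfin := finite_support_samplerLaw n
  have hd : (2 : ℂ) ^ n ≠ 0 := by positivity
  have h := Ex_sum_coeffTwo_zs A R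
  rw [← Ex_sum hfin] at h
  simp only [coeffTwo, ← sum_diag_mul] at h
  rw [Ex_const_mul_complex hfin] at h
  exact mul_left_cancel₀ hd (by linear_combination h)

/-- The third moment of a random Clifford measurement of a traceless observable. -/
theorem Ex_diag_mul_mul {n : ℕ} {A R : Op n} (hA : A.trace = 0) (hR : R.trace = 1) :
    (2 ^ n + 1) * (2 ^ n + 2) * Ex (samplerLaw n) (fun c => ∑ b,
      (c.toMatrix * R * c.toMatrixᴴ) b b * ((c.toMatrix * A * c.toMatrixᴴ) b b *
      (c.toMatrix * A * c.toMatrixᴴ) b b)) = (A * A).trace + 2 * (R * (A * A)).trace := by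
  have hfin := finite_support_samplerLaw n
  have hd : (2 : ℂ) ^ n ≠ 0 := by positivity
  obtain ⟨e, he⟩ := Ex_coeffThree_const A R
  set G := fun p q => Ex (samplerLaw n) (fun c => coeffThree (c.toMatrix * A * c.toMatrixᴴ)
      (c.toMatrix * R * c.toMatrixᴴ) p q) with hG
  replace he : ∀ p q, p ≠ pId → q ≠ pId → p ≠ q → sgn p q = 1 → G p q = e := he
  have hGl : ∀ q, G pId q = 0 := fun q => by
    simp only [hG, coeffThree, pauli_pId, mul_one]
    simp only [trace_conj (Circuit.toMatrix_mem _), hA, zero_mul, Ex_const hfin]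
  -- Tracelessness of `A` removes every pair containing the identity, leaving only the diagonal as a
  -- degenerate contribution.
  have hGr : ∀ p, G p pId = 0 := fun p => by
    simp only [hG, coeffThree, pauli_pId, mul_one]
    simp only [trace_conj (Circuit.toMatrix_mem _), hA, mul_zero, zero_mul, Ex_const hfin]
  have hGd : ∀ p, G p p = Ex (samplerLaw n) (fun c => coeffTwo (c.toMatrix * A * c.toMatrixᴴ)
      (c.toMatrix * A * c.toMatrixᴴ) p) := fun p => by
    simp only [hG, coeffThree, coeffTwo, pauli_mul_self]
    simp only [mul_one, trace_conj (Circuit.toMatrix_mem _), hR]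
  have hdiag : ∑ p, G p p = 2 ^ n * (A * A).trace := by
    simp only [hGd]
    rw [← Ex_sum hfin]
    simp only [sum_coeffTwo, conj_mul_conj (Circuit.toMatrix_mem _),
      trace_conj (Circuit.toMatrix_mem _), Ex_const hfin]
  have hall : ∑ p, ∑ q, (1 + sgn p q) / 2 * G p q = (2 ^ n) ^ 2 * (R * (A * A)).trace := by
    simp only [hG, ← Ex_const_mul_complex hfin, ← Ex_sum hfin]
    simp only [sum_coeffThree, conj_mul_conj (Circuit.toMatrix_mem _),
      trace_conj (Circuit.toMatrix_mem _), Ex_const hfin]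
  have hoff : (∑ p, ∑ q, if p ≠ pId ∧ q ≠ pId ∧ p ≠ q then (1 + sgn p q) / 2 * G p q else 0) =
      ((2 ^ n) ^ 2 - 1) * ((2 ^ n) ^ 2 - 4) / 2 * e := by
    rw [← sum_weight, Finset.sum_mul]
    refine Finset.sum_congr rfl fun p _ => ?_
    rw [Finset.sum_mul]
    refine Finset.sum_congr rfl fun q _ => ?_
    split_ifs with h
    · rcases sgn_eq p q with hs | hs
      · rw [he p q h.1 h.2.1 h.2.2 hs]
      · rw [hs]; ring
    · rw [zero_mul]
  have hS := sum_pairs pId fun p q => (1 + sgn p q) / 2 * G p q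
  simp only [hall, hoff, hGl, hGr, sgn_self, mul_zero, Finset.sum_const_zero, add_zero,
    sub_zero] at hS
  norm_num at hS
  rw [hdiag] at hS
  -- the same for the strings of `Z`s
  have hcount : (∑ z : Bits n, ∑ z' : Bits n, if z ≠ (fun _ => false) ∧ z' ≠ (fun _ => false) ∧
      z ≠ z' then (1 : ℂ) else 0) = (2 ^ n - 1) * (2 ^ n - 2) := by
    have h := sum_pairs (fun _ => false : Bits n) fun _ _ => (1 : ℂ)
    simp only [Finset.sum_const, Finset.card_univ, nsmul_eq_mul, card_bits, mul_one] at h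
    linear_combination -h
  have hZ := sum_pairs (fun _ => false : Bits n) fun z z' => G (zs z) (zs z')
  have hZoff : (∑ z : Bits n, ∑ z' : Bits n, if z ≠ (fun _ => false) ∧ z' ≠ (fun _ => false) ∧
      z ≠ z' then G (zs z) (zs z') else 0) = (2 ^ n - 1) * (2 ^ n - 2) * e := by
    rw [← hcount, Finset.sum_mul]
    refine Finset.sum_congr rfl fun z _ => ?_
    rw [Finset.sum_mul]
    refine Finset.sum_congr rfl fun z' _ => ?_
    split_ifs with h
    · rw [he _ _ (zs_ne_pId h.1) (zs_ne_pId h.2.1) (fun e => h.2.2 (zs_injective e)) (sgn_zs _ _),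
        one_mul]
    · rw [zero_mul]
  have hT := Ex_sum_coeffTwo_zs A A
  rw [hA, mul_zero, add_zero] at hT
  simp only [hZoff, zs_false, hGl, hGr, hGd, mul_zero, Finset.sum_const_zero, add_zero,
    sub_zero] at hZ
  have hfinal : ∑ z, ∑ z', G (zs z) (zs z') = (2 ^ n) ^ 2 * Ex (samplerLaw n) (fun c => ∑ b,
      (c.toMatrix * R * c.toMatrixᴴ) b b * ((c.toMatrix * A * c.toMatrixᴴ) b b *
      (c.toMatrix * A * c.toMatrixᴴ) b b)) := by
    rw [← Ex_const_mul_complex hfin]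
    simp only [sum_diag_mul_mul]
    simp only [hG, Ex_sum hfin, coeffThree]
  rw [hfinal] at hZ
  refine mul_left_cancel₀ (pow_ne_zero 2 hd) ?_
  -- The multiplicities are `(d² - 1)(d² - 4) / 2` for all strings and `(d - 1)(d - 2)` for
  -- `Z`-strings; these multipliers eliminate `e`, and `hT` evaluates the diagonal.
  linear_combination (2 ^ n + 1) * (2 ^ n + 2) * hZ + (2 ^ n + 2) * hT - 2 * hS

/-! ### Traces of squares -/

theorem IsHermitian.apply_self_eq {n : ℕ} {A : Op n} (hA : A.IsHermitian) (b : Bits n) :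
    A b b = (((A b b).re : ℝ) : ℂ) := (hA.coe_re_apply_self b).symm

theorem posSemidef_mul_self {n : ℕ} {A : Op n} (hA : A.IsHermitian) : (A * A).PosSemidef := by
  have := Matrix.posSemidef_conjTranspose_mul_self A
  rwa [hA.eq] at this

theorem re_apply_self_nonneg {n : ℕ} {A : Op n} (hA : A.PosSemidef) (b : Bits n) :
    0 ≤ (A b b).re := (Complex.le_def.1 (hA.diag_nonneg (i := b))).1

theorem re_trace_nonneg {n : ℕ} {A : Op n} (hA : A.PosSemidef) : 0 ≤ A.trace.re := by
  rw [Matrix.trace, Complex.re_sum]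
  exact Finset.sum_nonneg fun b _ => re_apply_self_nonneg hA b

/-- In an eigenbasis of the state the left side is an average of the nonnegative diagonal entries of
`A`, with weights at most one. -/
theorem DensityMatrix.trace_mul_le {n : ℕ} (ρ : DensityMatrix n) {A : Op n} (hA : A.PosSemidef) :
    (ρ.mat * A).trace.re ≤ A.trace.re := by
  have hρ := ρ.posSemidef.isHermitian
  set W : Op n := (hρ.eigenvectorUnitary : Op n) with hWdef
  have hW : W ∈ unitary (Op n) := hρ.eigenvectorUnitary.2
  set D : Op n := Matrix.diagonal (RCLike.ofReal ∘ hρ.eigenvalues) with hD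
  have hspec : ρ.mat = W * D * Wᴴ := by
    have := hρ.spectral_theorem
    rwa [Unitary.conjStarAlgAut_apply] at this
  have hsum : ∑ i, hρ.eigenvalues i = 1 := by
    have := hρ.trace_eq_sum_eigenvalues
    rw [ρ.trace_eq_one] at this
    have h2 := congrArg Complex.re this
    simp only [Complex.one_re, Complex.re_sum] at h2
    exact h2.symm
  have hnn := ρ.posSemidef.eigenvalues_nonneg
  have hB : (Wᴴ * A * W).PosSemidef := hA.conjTranspose_mul_mul_same W
  have h1 : (ρ.mat * A).trace = (D * (Wᴴ * A * W)).trace := by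
    rw [hspec, mul_assoc, mul_assoc, Matrix.trace_mul_comm]
    simp only [mul_assoc]
  have h2 : A.trace = (Wᴴ * A * W).trace := by
    have := trace_conj (conjTranspose_mem hW) A
    rw [Matrix.conjTranspose_conjTranspose] at this
    exact this.symm
  rw [h1, h2, Matrix.trace, Matrix.trace, Complex.re_sum, Complex.re_sum]
  refine Finset.sum_le_sum fun i _ => ?_
  rw [Matrix.diag_apply, Matrix.diag_apply, hD, Matrix.diagonal_mul, Function.comp]
  have h3 : ((RCLike.ofReal (hρ.eigenvalues i) : ℂ) * (Wᴴ * A * W) i i).re =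
      hρ.eigenvalues i * ((Wᴴ * A * W) i i).re := Complex.re_ofReal_mul _ _
  rw [h3]
  have h4 : hρ.eigenvalues i ≤ 1 := by
    rw [← hsum]
    exact Finset.single_le_sum (fun j _ => hnn j) (Finset.mem_univ i)
  exact mul_le_of_le_one_left (re_apply_self_nonneg hB i) h4

/-- The trace of the square is the sum of the squared eigenvalues, and the rank counts the nonzero
ones. -/
theorem trace_mul_self_le_of_rank {n r : ℕ} {lam : ℝ} {A : Op n} (hA : A.IsHermitian)
    (hr : A.rank ≤ r) (hlam : ∀ i, |hA.eigenvalues i| ≤ lam) :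
    (A * A).trace.re ≤ r * lam ^ 2 := by
  set W : Op n := (hA.eigenvectorUnitary : Op n) with hWdef
  have hW : W ∈ unitary (Op n) := hA.eigenvectorUnitary.2
  have hspec : A = W * Matrix.diagonal (RCLike.ofReal ∘ hA.eigenvalues) * Wᴴ := by
    have := hA.spectral_theorem
    rwa [Unitary.conjStarAlgAut_apply] at this
  have h1 : (A * A).trace.re = ∑ i, hA.eigenvalues i ^ 2 := by
    have : A * A = W * Matrix.diagonal (fun i => ((hA.eigenvalues i ^ 2 : ℝ) : ℂ)) * Wᴴ := by
      conv_lhs => rw [hspec, conj_mul_conj hW, Matrix.diagonal_mul_diagonal]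
      congr 3
      funext i
      simp [pow_two]
    rw [this, trace_conj hW, Matrix.trace_diagonal, Complex.re_sum]
    simp only [Complex.ofReal_re]
  have h2 : ∑ i, hA.eigenvalues i ^ 2 ≤ ∑ i, if hA.eigenvalues i ≠ 0 then lam ^ 2 else 0 := by
    refine Finset.sum_le_sum fun i _ => ?_
    split_ifs with h
    · rw [← sq_abs]
      exact pow_le_pow_left₀ (abs_nonneg _) (hlam i) 2
    · rw [not_not.1 h]; simp
  rw [h1]
  refine h2.trans ?_
  rw [← Finset.sum_filter, Finset.sum_const, nsmul_eq_mul]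
  refine mul_le_mul_of_nonneg_right ?_ (sq_nonneg _)
  rw [hA.rank_eq_card_non_zero_eigs, Fintype.card_subtype] at hr
  exact_mod_cast hr

/-! ### Moments, in terms of real numbers -/

/-- The diagonal entries of `U A U†`. -/
def diagOf {n : ℕ} (A : Op n) (c : Circuit n) (b : Bits n) : ℝ :=
  ((c.toMatrix * A * c.toMatrixᴴ) b b).re

theorem coe_diagOf {n : ℕ} {A : Op n} (hA : A.IsHermitian) (c : Circuit n) (b : Bits n) :
    (c.toMatrix * A * c.toMatrixᴴ) b b = (diagOf A c b : ℂ) :=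
  IsHermitian.apply_self_eq (Matrix.isHermitian_mul_mul_conjTranspose _ hA) b

theorem Ex_diagOf_mul {n : ℕ} (ρ : DensityMatrix n) {A : Op n} (hA : A.IsHermitian) :
    (2 ^ n + 1) * Ex (samplerLaw n) (fun c => ∑ b, diagOf ρ.mat c b * diagOf A c b) =
      (A * ρ.mat).trace.re + A.trace.re := by
  have h := Ex_diag_mul A ρ.mat
  simp only [coe_diagOf hA, coe_diagOf ρ.posSemidef.isHermitian, ρ.trace_eq_one, mul_one] at h
  have h2 := congrArg Complex.re h
  rw [Complex.add_re] at h2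
  rw [← h2]
  have : ((2 ^ n + 1 : ℂ)) = ((2 ^ n + 1 : ℝ) : ℂ) := by push_cast; rfl
  rw [this, Complex.re_ofReal_mul, ← Ex_re (finite_support_samplerLaw n)]
  congr 2
  funext c
  norm_cast

theorem Ex_diagOf_mul_sq {n : ℕ} (ρ : DensityMatrix n) {A : Op n} (hA : A.IsHermitian)
    (htr : A.trace = 0) :
    (2 ^ n + 1) * (2 ^ n + 2) *
      Ex (samplerLaw n) (fun c => ∑ b, diagOf ρ.mat c b * diagOf A c b ^ 2) =
      (A * A).trace.re + 2 * (ρ.mat * (A * A)).trace.re := by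
  have h := Ex_diag_mul_mul htr ρ.trace_eq_one
  simp only [coe_diagOf hA, coe_diagOf ρ.posSemidef.isHermitian] at h
  have h2 := congrArg Complex.re h
  have h3 : ((2 : ℂ) * (ρ.mat * (A * A)).trace).re = 2 * (ρ.mat * (A * A)).trace.re :=
    Complex.re_ofReal_mul 2 _
  rw [Complex.add_re, h3] at h2
  rw [← h2]
  have : ((2 ^ n + 1) * (2 ^ n + 2) : ℂ) = (((2 ^ n + 1) * (2 ^ n + 2) : ℝ) : ℂ) := by
    push_cast; rfl
  rw [this, Complex.re_ofReal_mul, ← Ex_re (finite_support_samplerLaw n)]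
  congr 2
  funext c
  simp only [pow_two]
  norm_cast

/-! ### The laws of snapshots and estimates -/

/-- The law of `snapshot`. -/
def snapshotLaw {n : ℕ} (ρ : DensityMatrix n) : PMF (Bits n × Circuit n) :=
  (samplerLaw n).bind fun c => (born ρ c).bind fun b => PMF.pure (b, c.dagger)

theorem denotes_snapshot {n : ℕ} (ρ : DensityMatrix n) :
    Denotes (snapshot ρ) (snapshotLaw ρ) :=
  (denotes_cliffordSampler n).bind fun _ =>
    (Denotes.modify _ (.draw (finite_support_of_finite _))).bind fun _ => .tick _ (.pure _)

theorem finite_support_snapshotLaw {n : ℕ} (ρ : DensityMatrix n) :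
    (snapshotLaw ρ).support.Finite := (denotes_snapshot ρ).1

theorem born_toReal {n : ℕ} (ρ : DensityMatrix n) (c : Circuit n) (b : Bits n) :
    (born ρ c b).toReal = diagOf ρ.mat c b := by
  rw [born, PMF.ofFintype_apply]
  exact ENNReal.toReal_ofReal
    (re_apply_self_nonneg (ρ.posSemidef.mul_mul_conjTranspose_same _) b)

theorem Ex_snapshotLaw {n : ℕ} (ρ : DensityMatrix n) (f : Bits n × Circuit n → ℝ) :
    Ex (snapshotLaw ρ) f =
      Ex (samplerLaw n) fun c => ∑ b, diagOf ρ.mat c b * f (b, c.dagger) := by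
  rw [snapshotLaw, Ex_bind (finite_support_samplerLaw n) fun c _ =>
    finite_support_bind (finite_support_of_finite _) fun b _ => finite_support_pure _]
  congr 1
  funext c
  rw [Ex_bind (finite_support_of_finite _) fun b _ => finite_support_pure _, Ex_eq_univ_sum]
  simp only [Ex_pure, born_toReal, smul_eq_mul]

theorem Gate.toMatrix_dagger {n : ℕ} (g : Gate n) : g.dagger.toMatrix = g.toMatrixᴴ := by
  cases g <;>
    simp only [Gate.dagger, Gate.toMatrix, Matrix.conjTranspose_submatrix,
      Matrix.conjTranspose_kronecker, Matrix.conjTranspose_one] <;> rfl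

theorem Circuit.toMatrix_dagger {n : ℕ} (c : Circuit n) : c.dagger.toMatrix = c.toMatrixᴴ := by
  unfold Circuit.dagger
  induction c with
  | nil => exact Matrix.conjTranspose_one.symm
  | cons g c ih =>
    rw [List.map_cons, List.reverse_cons, Circuit.toMatrix_append, ih,
      Circuit.toMatrix_singleton, Gate.toMatrix_dagger, Circuit.toMatrix, Matrix.conjTranspose_mul]

theorem Ex_born_basisState {n : ℕ} (b : Bits n) (c : Circuit n) (f : Bits n → ℝ) :
    Ex (born (basisState b) c) f =
      ((c.toMatrixᴴ * Matrix.diagonal (fun x => (f x : ℂ)) * c.toMatrix) b b).re := by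
  rw [Ex_eq_univ_sum]
  simp only [born_toReal, smul_eq_mul, diagOf, basisState]
  rw [Matrix.mul_apply, Complex.re_sum]
  refine Finset.sum_congr rfl fun x _ => ?_
  rw [Matrix.mul_diagonal, Matrix.mul_apply]
  simp only [Matrix.mul_diagonal, Matrix.conjTranspose_apply]
  rw [Finset.sum_eq_single b (fun y _ hy => by simp [hy]) (by simp)]
  simp
  ring

/-- The expectation of the reported label in a stored state. -/
theorem Ex_label {n : ℕ} (V : ObservableCircuit n) (b : Bits n) (c : Circuit n) :
    Ex (born (basisState b) (c.dagger ++ V.circuit)) V.label = diagOf V.observable c b := by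
  rw [Ex_born_basisState, Circuit.toMatrix_append, Circuit.toMatrix_dagger, diagOf,
    ObservableCircuit.observable]
  simp only [Matrix.conjTranspose_mul, Matrix.conjTranspose_conjTranspose, mul_assoc]

/-- The same circuit with squared labels implements the square of the observable, so the second
moment of a shot is again a quantum expectation. -/
theorem Ex_label_sq {n : ℕ} (V : ObservableCircuit n) (b : Bits n) (c : Circuit n) :
    Ex (born (basisState b) (c.dagger ++ V.circuit)) (fun x => V.label x ^ 2) =
      diagOf (V.observable * V.observable) c b := by
  have h : V.observable * V.observable = V.circuit.toMatrixᴴ *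
      Matrix.diagonal (fun x => ((V.label x ^ 2 : ℝ) : ℂ)) * V.circuit.toMatrix := by
    have := conj_mul_conj (conjTranspose_mem V.circuit.toMatrix_mem)
      (Matrix.diagonal fun x => (V.label x : ℂ)) (Matrix.diagonal fun x => (V.label x : ℂ))
    rw [Matrix.conjTranspose_conjTranspose, Matrix.diagonal_mul_diagonal] at this
    unfold ObservableCircuit.observable
    rw [this]
    congr 3
    funext x
    push_cast
    ring
  rw [Ex_born_basisState, Circuit.toMatrix_append, Circuit.toMatrix_dagger, diagOf, h]
  simp only [Matrix.conjTranspose_mul, Matrix.conjTranspose_conjTranspose, mul_assoc]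

theorem trace_observable {n : ℕ} (V : ObservableCircuit n) :
    V.observable.trace = ((∑ x, V.label x : ℝ) : ℂ) := by
  have := trace_conj (conjTranspose_mem V.circuit.toMatrix_mem)
    (Matrix.diagonal fun x => (V.label x : ℂ))
  rw [Matrix.conjTranspose_conjTranspose, Matrix.trace_diagonal] at this
  rw [ObservableCircuit.observable, this]
  push_cast
  rfl

/-- The law of `estimate`. -/
def estimateLaw {n : ℕ} (V : ObservableCircuit n) (t : ℝ) (s : Bits n × Circuit n) : PMF ℝ :=
  (prodLaw (2 * (2 ^ n + 1)) fun _ => (born (basisState s.1) (s.2 ++ V.circuit)).bind fun x =>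
    PMF.pure (V.label x)).bind fun v =>
      PMF.pure ((2 ^ n + 1) * ((∑ l, v l) / ((2 * (2 ^ n + 1) : ℕ) : ℝ)) - t)

theorem denotes_estimate {n : ℕ} (V : ObservableCircuit n) (t : ℝ) (s : Bits n × Circuit n) :
    Denotes (estimate V t s) (estimateLaw V t s) :=
  (Denotes.forFin fun _ => (Denotes.modify _ (.draw (finite_support_of_finite _))).bind
    fun _ => .tick _ (.pure _)).bind fun _ => .tick _ (.pure _)

/-! ### Sums of independent centered variables -/

theorem Ex_prodLaw_eval {α : Type} {k : ℕ} {μ : Fin k → PMF α} (hμ : ∀ i, (μ i).support.Finite)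
    (i : Fin k) (f : α → ℝ) : Ex (prodLaw k μ) (fun v => f (v i)) = Ex (μ i) f := by
  rw [← prodLaw_map_eval μ i, Ex_map (finite_support_prodLaw hμ)]

theorem Ex_prodLaw_sum {α : Type} {k : ℕ} {μ : Fin k → PMF α} (hμ : ∀ i, (μ i).support.Finite)
    (f : Fin k → α → ℝ) :
    Ex (prodLaw k μ) (fun v => ∑ i, f i (v i)) = ∑ i, Ex (μ i) (f i) := by
  rw [Ex_sum (finite_support_prodLaw hμ)]
  exact Finset.sum_congr rfl fun i _ => Ex_prodLaw_eval hμ i (f i)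

/-- Independence and centering make the cross terms vanish. -/
theorem Ex_prodLaw_sum_sq {α : Type} {k : ℕ} {μ : Fin k → PMF α}
    (hμ : ∀ i, (μ i).support.Finite) {f : Fin k → α → ℝ} (hf : ∀ i, Ex (μ i) (f i) = 0) :
    Ex (prodLaw k μ) (fun v => (∑ i, f i (v i)) ^ 2) = ∑ i, Ex (μ i) (fun x => f i x ^ 2) := by
  induction k with
  | zero => simp [prodLaw, Ex_pure]
  | succ k ih =>
    have hk := finite_support_prodLaw fun i => hμ (Fin.succ i)
    rw [Ex_prodLaw_succ hμ, Fin.sum_univ_succ, ← ih (fun i => hμ i.succ) fun i => hf i.succ]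
    have h : ∀ a, Ex (prodLaw k fun i => μ i.succ) (fun l => (∑ i, f i ((Fin.cons a l :
        Fin (k + 1) → α) i)) ^ 2) = f 0 a ^ 2 +
        Ex (prodLaw k fun i => μ i.succ) (fun l => (∑ i, f i.succ (l i)) ^ 2) := by
      intro a
      have e : (fun l => (∑ i, f i ((Fin.cons a l : Fin (k + 1) → α) i)) ^ 2) =
          fun l => (f 0 a ^ 2 + 2 * f 0 a * ∑ i, f i.succ (l i)) +
            (∑ i, f i.succ (l i)) ^ 2 := by
        funext l
        rw [Fin.sum_univ_succ]
        simp only [Fin.cons_zero, Fin.cons_succ]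
        ring
      rw [e, Ex_add hk, Ex_add hk, Ex_const hk, Ex_const_mul hk,
        Ex_prodLaw_sum (fun i => hμ i.succ) fun i => f i.succ]
      simp [hf]
    simp only [h]
    rw [Ex_add (hμ 0), Ex_const (hμ 0)]

/-! ### Mean and variance of an estimate -/

/-- Conditioned on the snapshot, the mean is the exact shadow estimate. The second summand of the
bound is the shot noise, with the variance of a shot bounded by its second moment. -/
theorem Ex_estimateLaw {n : ℕ} (V : ObservableCircuit n) (t o : ℝ) (b : Bits n) (c : Circuit n) :
    Ex (estimateLaw V t (b, c.dagger)) (fun y => y - o) =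
      (2 ^ n + 1) * diagOf V.observable c b - t - o ∧
    Ex (estimateLaw V t (b, c.dagger)) (fun y => (y - o) ^ 2) ≤
      ((2 ^ n + 1) * diagOf V.observable c b - t - o) ^ 2 +
        (2 ^ n + 1) / 2 * diagOf (V.observable * V.observable) c b := by
  set β := born (basisState b) (c.dagger ++ V.circuit) with hβ
  have hβf : β.support.Finite := finite_support_of_finite _
  set μ : PMF ℝ := β.bind fun x => PMF.pure (V.label x) with hμ
  have hμf : μ.support.Finite := finite_support_bind hβf fun _ _ => finite_support_pure _
  have hμE : ∀ f : ℝ → ℝ, Ex μ f = Ex β fun x => f (V.label x) := fun f => by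
    rw [hμ, Ex_bind hβf fun _ _ => finite_support_pure _]
    simp only [Ex_pure]
  set a := diagOf V.observable c b with ha
  set m : ℕ := 2 * (2 ^ n + 1) with hm
  have hmR : (m : ℝ) = 2 * (2 ^ n + 1) := by rw [hm]; push_cast; ring
  have hd : (0 : ℝ) < 2 ^ n + 1 := by positivity
  have hm0 : (m : ℝ) ≠ 0 := by rw [hmR]; positivity
  have hPf := finite_support_prodLaw (k := m) fun _ => hμf
  have hmean : Ex μ (fun x => x - a) = 0 := by
    rw [hμE, Ex_sub hβf, Ex_const hβf, Ex_label, sub_self]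
  have hvar : Ex μ (fun x => (x - a) ^ 2) ≤ diagOf (V.observable * V.observable) c b := by
    rw [← Ex_label_sq, hμE]
    have e : (fun x => (V.label x - a) ^ 2) =
        fun x => (V.label x ^ 2 - (2 * a) * V.label x) + a ^ 2 := by funext x; ring
    rw [e, Ex_add hβf, Ex_sub hβf, Ex_const_mul hβf, Ex_const hβf, Ex_label, ← ha]
    nlinarith [sq_nonneg a]
  have hE : ∀ f : ℝ → ℝ, Ex (estimateLaw V t (b, c.dagger)) f = Ex (prodLaw m fun _ => μ)
      fun v => f ((2 ^ n + 1) * ((∑ l, v l) / (m : ℝ)) - t) := fun f => by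
    rw [estimateLaw, Ex_bind hPf fun _ _ => finite_support_pure _]
    simp only [Ex_pure]
    rfl
  have hY : ∀ v : Fin m → ℝ, (2 ^ n + 1) * ((∑ l, v l) / (m : ℝ)) - t - o =
      ((2 ^ n + 1) * a - t - o) + ((2 ^ n + 1) / m) * ∑ l, (v l - a) := fun v => by
    rw [Finset.sum_sub_distrib, Finset.sum_const, Finset.card_univ, Fintype.card_fin, nsmul_eq_mul]
    field_simp
    ring
  have hs1 : Ex (prodLaw m fun _ => μ) (fun v => ∑ l, (v l - a)) = 0 := by
    rw [Ex_prodLaw_sum (fun _ => hμf) fun _ x => x - a]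
    simp [hmean]
  have hs2 : Ex (prodLaw m fun _ => μ) (fun v => (∑ l, (v l - a)) ^ 2) =
      m * Ex μ (fun x => (x - a) ^ 2) := by
    rw [Ex_prodLaw_sum_sq (f := fun _ x => x - a) (fun _ => hμf) fun _ => hmean]
    simp
  constructor
  · rw [hE]
    simp only [hY]
    rw [Ex_add hPf, Ex_const hPf, Ex_const_mul hPf, hs1, mul_zero, add_zero]
  · rw [hE]
    simp only [hY]
    set u := (2 ^ n + 1) * a - t - o with hu
    have e : (fun v : Fin m → ℝ => (u + (2 ^ n + 1) / m * ∑ l, (v l - a)) ^ 2) = fun v =>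
        (u ^ 2 + (2 * u * ((2 ^ n + 1) / m)) * ∑ l, (v l - a)) +
          ((2 ^ n + 1) / m) ^ 2 * (∑ l, (v l - a)) ^ 2 := by
      funext v; ring
    rw [e, Ex_add hPf, Ex_add hPf, Ex_const hPf, Ex_const_mul hPf, Ex_const_mul hPf, hs1, hs2,
      mul_zero, add_zero]
    -- With `m = 2 (d + 1)` shots, rescaling by `d + 1` leaves only one factor `d + 1`, with
    -- coefficient one half.
    have e2 : ((2 ^ n + 1) / (m : ℝ)) ^ 2 * (m * Ex μ (fun x => (x - a) ^ 2)) =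
        (2 ^ n + 1) / 2 * Ex μ (fun x => (x - a) ^ 2) := by
      rw [hmR]; field_simp
    rw [e2]
    gcongr

/-- The law of an estimate of an observable from a fresh snapshot. -/
def singleLaw {n : ℕ} (ρ : DensityMatrix n) (V : ObservableCircuit n) : PMF ℝ :=
  (snapshotLaw ρ).bind (estimateLaw V (∑ x, V.label x))

theorem finite_support_singleLaw {n : ℕ} (ρ : DensityMatrix n) (V : ObservableCircuit n) :
    (singleLaw ρ V).support.Finite :=
  finite_support_bind (finite_support_snapshotLaw ρ) fun _ _ => (denotes_estimate _ _ _).1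

theorem Ex_snapshotLaw_diagOf {n : ℕ} (ρ : DensityMatrix n) :
    Ex (samplerLaw n) (fun c => ∑ b, diagOf ρ.mat c b) = 1 := by
  have h := Ex_snapshotLaw ρ fun _ => 1
  rw [Ex_const (finite_support_snapshotLaw ρ)] at h
  simpa using h.symm

/-- The second-moment formula gives unbiasedness. The variance bound passes to the traceless part
`T`, since subtracting a multiple of the identity merely shifts the estimates by a constant;
otherwise `(tr O)²` would enter. -/
theorem singleLaw_moments {n : ℕ} (ρ : DensityMatrix n) (V : ObservableCircuit n)
    (hV : V.observable.IsHermitian) :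
    Ex (singleLaw ρ V) (fun y => y - (V.observable * ρ.mat).trace.re) = 0 ∧
    Ex (singleLaw ρ V) (fun y => (y - (V.observable * ρ.mat).trace.re) ^ 2) ≤
      4 * (V.observable * V.observable).trace.re := by
  set O := V.observable with hO
  set o := (O * ρ.mat).trace.re with ho
  set t := ∑ x, V.label x with ht
  have htr : O.trace = (t : ℂ) := trace_observable V
  have htre : O.trace.re = t := by rw [htr, Complex.ofReal_re]
  have hfs := finite_support_samplerLaw n
  have hd : (0 : ℝ) < 2 ^ n := by positivity
  have hE : ∀ f : ℝ → ℝ, Ex (singleLaw ρ V) f = Ex (samplerLaw n) fun c =>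
      ∑ b, diagOf ρ.mat c b * Ex (estimateLaw V t (b, c.dagger)) f := fun f => by
    rw [singleLaw, Ex_bind (finite_support_snapshotLaw ρ) fun _ _ => (denotes_estimate _ _ _).1,
      Ex_snapshotLaw]
  have h1 := Ex_snapshotLaw_diagOf ρ
  have hA := Ex_diagOf_mul ρ hV
  rw [htre] at hA
  have hS := Ex_diagOf_mul ρ (posSemidef_mul_self hV).isHermitian
  -- the traceless part
  set T : Op n := O - ((t / 2 ^ n : ℝ) : ℂ) • (1 : Op n) with hT
  have hsc : ((((t / 2 ^ n : ℝ) : ℂ)) • (1 : Op n)).IsHermitian := by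
    rw [Matrix.IsHermitian, Matrix.conjTranspose_smul, Matrix.conjTranspose_one,
      Complex.star_def, Complex.conj_ofReal]
  have hTh : T.IsHermitian := hV.sub hsc
  have hone : (1 : Op n).trace = 2 ^ n := by simp [Matrix.trace_one]
  have hT0 : T.trace = 0 := by
    rw [hT, Matrix.trace_sub, Matrix.trace_smul, hone, htr]
    push_cast
    rw [smul_eq_mul, div_mul_cancel₀ _ (by positivity), sub_self]
  have hdiag : ∀ c b, diagOf O c b = diagOf T c b + t / 2 ^ n := fun c b => by
    simp only [diagOf, hT, Matrix.mul_sub, Matrix.sub_mul, Matrix.mul_smul, Matrix.smul_mul,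
      mul_one, mul_conjTranspose_self_of_mem c.toMatrix_mem, Matrix.sub_apply, Matrix.smul_apply,
      Matrix.one_apply_eq, smul_eq_mul, Complex.sub_re, Complex.ofReal_re]
    ring
  have hTT : (T * T).trace.re = (O * O).trace.re - t ^ 2 / 2 ^ n := by
    have e : T * T = O * O - (2 * ((t / 2 ^ n : ℝ) : ℂ)) • O +
        (((t / 2 ^ n : ℝ) : ℂ) * ((t / 2 ^ n : ℝ) : ℂ)) • (1 : Op n) := by
      rw [hT, sub_mul, mul_sub, mul_sub]
      simp only [Matrix.mul_smul, Matrix.smul_mul, mul_one, one_mul]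
      module
    rw [e, Matrix.trace_add, Matrix.trace_sub, Matrix.trace_smul, Matrix.trace_smul, hone, htr]
    have e2 : (2 * ((t / 2 ^ n : ℝ) : ℂ)) • (t : ℂ) = ((2 * (t / 2 ^ n) * t : ℝ) : ℂ) := by
      push_cast; rw [smul_eq_mul]
    have e3 : (((t / 2 ^ n : ℝ) : ℂ) * ((t / 2 ^ n : ℝ) : ℂ)) • (2 ^ n : ℂ) =
        (((t / 2 ^ n) * (t / 2 ^ n) * 2 ^ n : ℝ) : ℂ) := by
      push_cast; rw [smul_eq_mul]
    rw [e2, e3, Complex.add_re, Complex.sub_re, Complex.ofReal_re, Complex.ofReal_re]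
    field_simp
    ring
  have hM2 := Ex_diagOf_mul_sq ρ hTh hT0
  have hTle := ρ.trace_mul_le (posSemidef_mul_self hTh)
  have hOle := ρ.trace_mul_le (posSemidef_mul_self hV)
  have hTnn := re_trace_nonneg (posSemidef_mul_self hTh)
  rw [Matrix.trace_mul_comm] at hS
  -- linear functionals of the snapshot
  set E1 := Ex (samplerLaw n) (fun c => ∑ b, diagOf ρ.mat c b * diagOf T c b) with hE1
  set E2 := Ex (samplerLaw n) (fun c => ∑ b, diagOf ρ.mat c b * diagOf T c b ^ 2) with hE2
  set E3 := Ex (samplerLaw n) (fun c => ∑ b, diagOf ρ.mat c b * diagOf (O * O) c b) with hE3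
  have hEA : Ex (samplerLaw n) (fun c => ∑ b, diagOf ρ.mat c b * diagOf O c b) =
      E1 + t / 2 ^ n := by
    have e : (fun c => ∑ b, diagOf ρ.mat c b * diagOf O c b) = fun c =>
        (∑ b, diagOf ρ.mat c b * diagOf T c b) + (t / 2 ^ n) * ∑ b, diagOf ρ.mat c b := by
      funext c
      rw [Finset.mul_sum, ← Finset.sum_add_distrib]
      exact Finset.sum_congr rfl fun b _ => by rw [hdiag]; ring
    rw [e, Ex_add hfs, Ex_const_mul hfs, h1, mul_one]
  rw [hEA] at hA
  constructor
  · rw [hE]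
    have e : (fun c => ∑ b, diagOf ρ.mat c b *
        Ex (estimateLaw V t (b, c.dagger)) (fun y => y - o)) = fun c =>
        (2 ^ n + 1) * (∑ b, diagOf ρ.mat c b * diagOf O c b) -
          (t + o) * ∑ b, diagOf ρ.mat c b := by
      funext c
      rw [Finset.mul_sum, Finset.mul_sum, ← Finset.sum_sub_distrib]
      exact Finset.sum_congr rfl fun b _ => by rw [(Ex_estimateLaw V t o b c).1]; ring
    rw [e, Ex_sub hfs, Ex_const_mul hfs, Ex_const_mul hfs, h1, hEA, hA]
    ring
  · have hle : Ex (singleLaw ρ V) (fun y => (y - o) ^ 2) ≤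
        (2 ^ n + 1) ^ 2 * E2 - 2 * ((2 ^ n + 1) * (o - t / 2 ^ n)) * E1 + (o - t / 2 ^ n) ^ 2 +
          (2 ^ n + 1) / 2 * E3 := by
      rw [hE]
      have e : Ex (samplerLaw n) (fun c => ((2 ^ n + 1) ^ 2 *
          (∑ b, diagOf ρ.mat c b * diagOf T c b ^ 2) - 2 * ((2 ^ n + 1) * (o - t / 2 ^ n)) *
          (∑ b, diagOf ρ.mat c b * diagOf T c b) + (o - t / 2 ^ n) ^ 2 * ∑ b, diagOf ρ.mat c b) +
          (2 ^ n + 1) / 2 * ∑ b, diagOf ρ.mat c b * diagOf (O * O) c b) =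
          (2 ^ n + 1) ^ 2 * E2 - 2 * ((2 ^ n + 1) * (o - t / 2 ^ n)) * E1 + (o - t / 2 ^ n) ^ 2 +
          (2 ^ n + 1) / 2 * E3 := by
        rw [Ex_add hfs, Ex_add hfs, Ex_sub hfs, Ex_const_mul hfs, Ex_const_mul hfs,
          Ex_const_mul hfs, Ex_const_mul hfs, h1, mul_one]
      rw [← e]
      refine Ex_mono hfs fun c _ => ?_
      rw [Finset.mul_sum, Finset.mul_sum, Finset.mul_sum, Finset.mul_sum,
        ← Finset.sum_sub_distrib, ← Finset.sum_add_distrib, ← Finset.sum_add_distrib]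
      refine Finset.sum_le_sum fun b _ => ?_
      have hnn : 0 ≤ diagOf ρ.mat c b := by
        rw [← born_toReal]; exact ENNReal.toReal_nonneg
      refine (mul_le_mul_of_nonneg_left (Ex_estimateLaw V t o b c).2 hnn).trans (le_of_eq ?_)
      rw [← hO, hdiag]
      field_simp
      ring
    refine hle.trans ?_
    have hE1' : (2 ^ n + 1) * E1 = o - t / 2 ^ n := by
      have e : (2 ^ n + 1) * (t / (2 : ℝ) ^ n) = t + t / 2 ^ n := by field_simp
      linear_combination hA - e
    -- The third moment gives `(d + 1) / (d + 2)` times `tr T² + 2 tr(ρ T²)`, and `tr(ρ T²) ≤ tr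
    -- T²`.
    have hE2' : (2 ^ n + 1) ^ 2 * E2 ≤ 3 * (T * T).trace.re := by
      have e : ((2 : ℝ) ^ n + 2) * ((2 ^ n + 1) ^ 2 * E2) ≤
          (2 ^ n + 2) * (3 * (T * T).trace.re) := by
        have : ((2 : ℝ) ^ n + 2) * ((2 ^ n + 1) ^ 2 * E2) =
          (2 ^ n + 1) * ((T * T).trace.re + 2 * (ρ.mat * (T * T)).trace.re) := by
          rw [← hM2]; ring
        rw [this]
        nlinarith
      exact le_of_mul_le_mul_left e (by positivity)
    have hTO : (T * T).trace.re ≤ (O * O).trace.re := by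
      rw [hTT]
      have : 0 ≤ t ^ 2 / 2 ^ n := by positivity
      linarith
    have e4 : 2 * ((2 ^ n + 1) * (o - t / 2 ^ n)) * E1 = 2 * (o - t / 2 ^ n) ^ 2 := by
      rw [← hE1']; ring
    have e5 : (2 ^ n + 1) / 2 * E3 = ((2 ^ n + 1) * E3) / 2 := by ring
    rw [e4, e5, hS]
    -- The shadow part contributes at most `3 tr O²` and the shot noise `(tr(ρ O²) + tr O²) / 2 ≤ tr
    -- O²`; the leftover square has a negative sign.
    nlinarith [sq_nonneg (o - t / 2 ^ n)]

/-! ### Selection -/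

/-- `v` is the element of index `k` of `l` in increasing order. -/
def IsKth (l : List ℝ) (k : ℕ) (v : ℝ) : Prop :=
  v ∈ l ∧ l.countP (fun x => decide (x < v)) ≤ k ∧ k < l.countP (fun x => decide (x ≤ v))

theorem insertT_perm (a : ℝ) (l : List ℝ) : (insertT a l).1.Perm (a :: l) := by
  induction l with
  | nil => exact .refl _
  | cons b l ih =>
    rw [insertT]
    split_ifs
    · exact .refl _
    · exact (ih.cons b).trans (.swap a b l)

theorem insertT_sorted (a : ℝ) {l : List ℝ} (h : l.Pairwise (· ≤ ·)) :
    (insertT a l).1.Pairwise (· ≤ ·) := by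
  induction l with
  | nil => simp [insertT]
  | cons b l ih =>
    rw [List.pairwise_cons] at h
    rw [insertT]
    split_ifs with hab
    · refine List.pairwise_cons.2 ⟨fun x hx => ?_, List.pairwise_cons.2 h⟩
      rcases List.mem_cons.1 hx with rfl | hx
      · exact hab
      · exact hab.trans (h.1 x hx)
    · refine List.pairwise_cons.2 ⟨fun x hx => ?_, ih h.2⟩
      rcases List.mem_cons.1 ((insertT_perm a l).mem_iff.1 hx) with rfl | hx
      · exact (not_le.1 hab).le
      · exact h.1 x hx

theorem insertT_steps (a : ℝ) (l : List ℝ) : (insertT a l).2 ≤ l.length + 1 := by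
  induction l with
  | nil => simp [insertT]
  | cons b l ih =>
    rw [insertT]
    split_ifs
    · simp
    · simpa using ih

theorem sortT_perm (l : List ℝ) : (sortT l).1.Perm l := by
  induction l with
  | nil => exact .refl _
  | cons a l ih => exact (insertT_perm a _).trans (ih.cons a)

theorem sortT_sorted (l : List ℝ) : (sortT l).1.Pairwise (· ≤ ·) := by
  induction l with
  | nil => simp [sortT]
  | cons a l ih => exact insertT_sorted a ih

theorem sortT_steps (l : List ℝ) : (sortT l).2 ≤ (l.length + 1) ^ 2 := by
  induction l with
  | nil => simp [sortT]
  | cons a l ih =>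
    have h := insertT_steps a (sortT l).1
    rw [(sortT_perm l).length_eq] at h
    simp only [sortT, List.length_cons]
    nlinarith

theorem isKth_of_sorted {s : List ℝ} (hs : s.Pairwise (· ≤ ·)) {k : ℕ} (hk : k < s.length) :
    IsKth s k (s.getD k 0) := by
  have hv : s.getD k 0 = s[k] := by simp [hk]
  have hsplit : s.take k ++ s[k] :: s.drop (k + 1) = s := by
    rw [← List.drop_eq_getElem_cons hk, List.take_append_drop]
  have hmem : s[k] ∈ s := List.getElem_mem hk
  rw [hv]
  generalize s[k] = v at hsplit hmem ⊢
  rw [← hsplit, List.pairwise_append, List.pairwise_cons] at hs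
  have h1 : (s.take k).countP (fun x => decide (x ≤ v)) = k := by
    rw [List.countP_eq_length.2, List.length_take, min_eq_left hk.le]
    intro x hx
    exact decide_eq_true (hs.2.2 x hx _ List.mem_cons_self)
  have h2 : (s.drop (k + 1)).countP (fun x => decide (x < v)) = 0 := by
    rw [List.countP_eq_zero]
    intro x hx
    simpa using hs.2.1.1 x hx
  refine ⟨hmem, ?_, ?_⟩
  · rw [← hsplit, List.countP_append, List.countP_cons, h2]
    have := (List.countP_le_length (p := fun x => decide (x < v)) (l := s.take k))
    rw [List.length_take] at this
    simp
    omega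
  · rw [← hsplit, List.countP_append, List.countP_cons, h1]
    simp

theorem IsKth.perm {l l' : List ℝ} (h : l.Perm l') {k : ℕ} {v : ℝ} (hv : IsKth l k v) :
    IsKth l' k v :=
  ⟨h.mem_iff.1 hv.1, by rw [← h.countP_eq]; exact hv.2.1, by rw [← h.countP_eq]; exact hv.2.2⟩

theorem sortT_five (a b c d e : ℝ) : ∃ x₀ x₁ x₂ x₃ x₄, (sortT [a, b, c, d, e]).1 =
    [x₀, x₁, x₂, x₃, x₄] ∧ x₀ ≤ x₁ ∧ x₁ ≤ x₂ ∧ x₂ ≤ x₃ ∧ x₃ ≤ x₄ := by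
  have hl := (sortT_perm [a, b, c, d, e]).length_eq
  have hs := sortT_sorted [a, b, c, d, e]
  match h : (sortT [a, b, c, d, e]).1, hl, hs with
  | [x₀, x₁, x₂, x₃, x₄], _, hs =>
    simp only [List.pairwise_cons, List.mem_cons] at hs
    exact ⟨x₀, x₁, x₂, x₃, x₄, rfl, hs.1 _ (by simp), hs.2.1 _ (by simp), hs.2.2.1 _ (by simp),
      hs.2.2.2.1 _ (by simp)⟩

/-- In a block whose median is at most `p`, three of the five entries are at most `p`, and
symmetrically from above. This makes the median of medians a balanced pivot. -/
theorem mediansOfFive_spec (l : List ℝ) :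
    (mediansOfFive l).1.length = l.length / 5 ∧ (mediansOfFive l).2 ≤ 8 * l.length + 1 ∧
    (∀ x ∈ (mediansOfFive l).1, x ∈ l) ∧
    (∀ p : ℝ, 3 * (mediansOfFive l).1.countP (fun x => decide (x ≤ p)) ≤
      l.countP (fun x => decide (x ≤ p))) ∧
    (∀ p : ℝ, 3 * (mediansOfFive l).1.countP (fun x => decide (p ≤ x)) ≤
      l.countP (fun x => decide (p ≤ x))) := by
  induction l using mediansOfFive.induct with
  | case1 a b c d e l ih =>
    obtain ⟨h1, h2, h3, h4, h5⟩ := ih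
    obtain ⟨x₀, x₁, x₂, x₃, x₄, hs, h01, h12, h23, h34⟩ := sortT_five a b c d e
    have hp := sortT_perm [a, b, c, d, e]
    have hsteps := sortT_steps [a, b, c, d, e]
    rw [hs] at hp
    have hcount : ∀ P : ℝ → Bool, (a :: b :: c :: d :: e :: l).countP P =
        [x₀, x₁, x₂, x₃, x₄].countP P + l.countP P := fun P => by
      rw [hp.countP_eq P, ← List.countP_append]; rfl
    rw [mediansOfFive, hs]
    simp only [List.length_cons, List.length_nil] at hsteps ⊢
    refine ⟨by omega, by omega, ?_, ?_, ?_⟩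
    · intro x hx
      rcases List.mem_cons.1 hx with hx | hx
      · have : x₂ ∈ [a, b, c, d, e] := hp.mem_iff.1 (by simp)
        simp only [List.mem_cons, List.not_mem_nil, or_false] at this
        simp only [List.getD_cons_succ, List.getD_cons_zero] at hx
        subst hx
        simp only [List.mem_cons]
        tauto
      · have := h3 x hx
        simp only [List.mem_cons]
        tauto
    · intro p
      have := h4 p
      rw [hcount]
      simp only [List.getD_cons_succ, List.getD_cons_zero, List.countP_cons, List.countP_nil]
      by_cases hp2 : x₂ ≤ p
      · have hp1 := h12.trans hp2
        have hp0 := h01.trans hp1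
        simp only [hp0, hp1, hp2, decide_true, if_true]
        omega
      · simp only [hp2, decide_false, Bool.false_eq_true, if_false]
        omega
    · intro p
      have := h5 p
      rw [hcount]
      simp only [List.getD_cons_succ, List.getD_cons_zero, List.countP_cons, List.countP_nil]
      by_cases hp2 : p ≤ x₂
      · have hp3 := hp2.trans h23
        have hp4 := hp3.trans h34
        simp only [hp3, hp4, hp2, decide_true, if_true]
        omega
      · simp only [hp2, decide_false, Bool.false_eq_true, if_false]
        omega
  | case2 l hl =>
    rw [mediansOfFive]
    · have : l.length < 5 := by
        by_contra h
        match l, h with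
        | a :: b :: c :: d :: e :: l, _ => exact hl a b c d e l rfl
        | [], h => simp at h
        | [_], h => simp at h
        | [_, _], h => simp at h
        | [_, _, _], h => simp at h
        | [_, _, _, _], h => simp at h
      simp
      omega
    · exact hl

theorem countP_le_add_countP_lt (l : List ℝ) (p : ℝ) :
    l.countP (fun x => decide (x ≤ p)) + l.countP (fun x => decide (p < x)) = l.length := by
  rw [List.length_eq_countP_add_countP (fun x => decide (x ≤ p))]
  congr 2
  funext x
  simp

theorem countP_lt_add_countP_le (l : List ℝ) (p : ℝ) :
    l.countP (fun x => decide (x < p)) + l.countP (fun x => decide (p ≤ x)) = l.length := by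
  rw [List.length_eq_countP_add_countP (fun x => decide (x < p))]
  congr 2
  funext x
  simp

theorem IsKth.of_filter_lt {l : List ℝ} {k : ℕ} {p v : ℝ}
    (h : IsKth (l.filter fun x => decide (x < p)) k v) : IsKth l k v := by
  obtain ⟨hm, h1, h2⟩ := h
  rw [List.mem_filter, decide_eq_true_iff] at hm
  rw [List.countP_filter] at h1 h2
  have e1 : (fun x => decide (x < v) && decide (x < p)) = fun x => decide (x < v) := by
    funext x
    by_cases hx : x < v
    · simp [hx, hx.trans hm.2]
    · simp [hx]
  rw [e1] at h1
  refine ⟨hm.1, h1, h2.trans_le (List.countP_mono_left fun x _ hx => ?_)⟩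
  simp only [Bool.and_eq_true] at hx
  exact hx.1

theorem IsKth.of_filter_gt {l : List ℝ} {k : ℕ} {p v : ℝ}
    (h : IsKth (l.filter fun x => decide (p < x)) k v) :
    IsKth l (k + l.countP fun x => decide (x ≤ p)) v := by
  obtain ⟨hm, h1, h2⟩ := h
  rw [List.mem_filter, decide_eq_true_iff] at hm
  have hsplit : ∀ P : ℝ → Bool, (∀ x, x ≤ p → P x = true) → l.countP P =
      (l.filter fun x => decide (p < x)).countP P + l.countP fun x => decide (x ≤ p) := by
    intro P hP
    rw [List.countP_eq_countP_filter_add l P fun x => decide (p < x)]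
    congr 1
    rw [List.countP_filter]
    refine List.countP_congr fun x _ => ?_
    by_cases hx : x ≤ p
    · simp [hx, hP x hx]
    · simp [hx, not_le.1 hx]
  refine ⟨hm.1, ?_, ?_⟩
  · rw [hsplit (fun x => decide (x < v)) fun x hx => by simpa using hx.trans_lt hm.2]
    omega
  · rw [hsplit (fun x => decide (x ≤ v)) fun x hx => by simpa using (hx.trans_lt hm.2).le]
    omega

/-- Selection by medians of medians is correct and takes linear time. -/
theorem selectT_spec (f : ℕ) (l : List ℝ) (k : ℕ) (hf : l.length ≤ f) (hk : k < l.length) :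
    IsKth l k (selectT f l k).1 ∧ (selectT f l k).2 ≤ 4000 * (l.length + 1) := by
  induction f generalizing l k with
  | zero => omega
  | succ f ih =>
    rw [selectT]
    split_ifs with hlen
    · refine ⟨(isKth_of_sorted (sortT_sorted l)
        (by rw [(sortT_perm l).length_eq]; exact hk)).perm (sortT_perm l), ?_⟩
      have h1 := sortT_steps l
      have h2 : (l.length + 1) ^ 2 ≤ 60 * (l.length + 1) := by
        rw [pow_two]; exact Nat.mul_le_mul_right _ (by omega)
      simp only
      omega
    · obtain ⟨hml, hms, hmm, hmle, hmge⟩ := mediansOfFive_spec l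
      obtain ⟨hp, hpt⟩ := ih (mediansOfFive l).1 ((mediansOfFive l).1.length / 2)
        (by omega) (by omega)
      simp only
      set p := (selectT f (mediansOfFive l).1 ((mediansOfFive l).1.length / 2)) with hpdef
      -- These counts bound both remaining lists by about seven tenths of the length. Together with
      -- the fifth used for the pivot this stays below one, and from length `60` on the slack pays
      -- for the linear overhead.
      have e1 := countP_le_add_countP_lt l p.1
      have e2 := countP_lt_add_countP_le l p.1
      have e3 := countP_lt_add_countP_le (mediansOfFive l).1 p.1
      have e4 := hmle p.1
      have e5 := hmge p.1
      have e6 := hp.2.1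
      have e7 := hp.2.2
      have hlo : (l.filter fun x => decide (x < p.1)).length =
        l.countP fun x => decide (x < p.1) := List.countP_eq_length_filter.symm
      have hhi : (l.filter fun x => decide (p.1 < x)).length =
        l.countP fun x => decide (p.1 < x) := List.countP_eq_length_filter.symm
      split_ifs with h1 h2
      · obtain ⟨hv, ht⟩ := ih (l.filter fun x => decide (x < p.1)) k (by omega) h1
        exact ⟨hv.of_filter_lt, by simp only; omega⟩
      · exact ⟨⟨hmm _ hp.1, by simp only; omega, by simp only; omega⟩, by simp only; omega⟩
      · obtain ⟨hv, ht⟩ := ih (l.filter fun x => decide (p.1 < x))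
          (k - (l.length - (l.filter fun x => decide (p.1 < x)).length)) (by omega) (by omega)
        refine ⟨?_, by simp only; omega⟩
        have := hv.of_filter_gt
        have e : k - (l.length - (l.filter fun x => decide (p.1 < x)).length) +
            (l.countP fun x => decide (x ≤ p.1)) = k := by omega
        rwa [e] at this

/-- If the median is off by more than `ε`, so is the majority of the values. -/
theorem IsKth.majority {l : List ℝ} {v o ε : ℝ} (h : IsKth l (l.length / 2) v)
    (hodd : Odd l.length) (hv : ε < |v - o|) :
    l.length < 2 * l.countP fun x => decide (ε < |x - o|) := by
  -- At most `l.length / 2` values lie below the median, so at least half lie at or above it;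
  -- oddness turns this into a strict majority.
  obtain ⟨j, hj⟩ := hodd
  rcases lt_abs.1 hv with hv | hv
  · have h1 := countP_lt_add_countP_le l v
    have h2 : (l.countP fun x => decide (v ≤ x)) ≤ l.countP fun x => decide (ε < |x - o|) :=
      List.countP_mono_left fun x _ hx => by
        simp only [decide_eq_true_eq] at hx ⊢
        exact lt_abs.2 (Or.inl (by linarith))
    have := h.2.1
    omega
  · have h2 : (l.countP fun x => decide (x ≤ v)) ≤ l.countP fun x => decide (ε < |x - o|) :=
      List.countP_mono_left fun x _ hx => by
        simp only [decide_eq_true_eq] at hx ⊢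
        exact lt_abs.2 (Or.inr (by linarith))
    have := h.2.2
    omega

/-! ### Accuracy of the procedure -/

/-- The law of the average of `B` estimates made from stored snapshots. -/
def meanLaw {n : ℕ} (V : ObservableCircuit n) (t : ℝ) (B : ℕ) (s : Fin B → Bits n × Circuit n) :
    PMF ℝ :=
  (prodLaw B fun i => estimateLaw V t (s i)).bind fun y => PMF.pure ((∑ i, y i) / B)

/-- The value computed by `median`. -/
def medianOf {k : ℕ} (v : Fin k → ℝ) : ℝ := (selectT k (List.ofFn v) (k / 2)).1

/-- The law of the output for one observable, given the snapshots. -/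
def outputLaw {n : ℕ} (V : ObservableCircuit n) (K B : ℕ)
    (s : Fin K → Fin B → Bits n × Circuit n) : PMF ℝ :=
  (prodLaw K fun k => meanLaw V (∑ x, V.label x) B (s k)).bind fun v => PMF.pure (medianOf v)

/-- The law of `clifford`. -/
def cliffordLaw {n M : ℕ} (ρ : DensityMatrix n) (obs : Fin M → ObservableCircuit n) (K B : ℕ) :
    PMF (Fin M → ℝ) :=
  (prodLaw K fun _ => prodLaw B fun _ => snapshotLaw ρ).bind fun s =>
    prodLaw M fun j => outputLaw (obs j) K B s

theorem denotes_clifford {n M : ℕ} (ρ : DensityMatrix n) (obs : Fin M → ObservableCircuit n)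
    (K B : ℕ) : Denotes (clifford ρ obs K B) (cliffordLaw ρ obs K B) := by
  refine (Denotes.forFin fun _ => Denotes.forFin fun _ => denotes_snapshot ρ).bind fun s =>
    Denotes.forFin fun j => ?_
  have ht : Denotes (traceOf (obs j)) (PMF.pure (∑ x, (obs j).label x)) := .tick _ (.pure _)
  have h := ht.bind (f := fun t => do
    let means ← forFin K (fun k => do
      let y ← forFin B (fun i => estimate (obs j) t (s k i))
      tick (B + 1)
      pure ((∑ i, y i) / B))
    median means) (ν := fun t => (prodLaw K fun k => meanLaw (obs j) t B (s k)).bind fun v =>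
      PMF.pure (medianOf v)) fun t =>
    (Denotes.forFin fun k => (Denotes.forFin fun i => denotes_estimate _ _ _).bind
      fun y => .tick _ (.pure _)).bind fun v => .tick _ (.pure _)
  rwa [PMF.pure_bind] at h

/-- The law of the average of `B` estimates made from fresh snapshots. -/
def groupLaw {n : ℕ} (ρ : DensityMatrix n) (V : ObservableCircuit n) (B : ℕ) : PMF ℝ :=
  (prodLaw B fun _ => singleLaw ρ V).bind fun y => PMF.pure ((∑ i, y i) / B)

theorem finite_support_groupLaw {n : ℕ} (ρ : DensityMatrix n) (V : ObservableCircuit n) (B : ℕ) :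
    (groupLaw ρ V B).support.Finite :=
  finite_support_bind (finite_support_prodLaw fun _ => finite_support_singleLaw ρ V)
    fun _ _ => finite_support_pure _

/-- For a single observable, storing the snapshots first is equivalent to taking each one when its
estimate is made. -/
theorem prodLaw_snapshot_bind_meanLaw {n : ℕ} (ρ : DensityMatrix n) (V : ObservableCircuit n)
    (B : ℕ) : (prodLaw B fun _ => snapshotLaw ρ).bind (meanLaw V (∑ x, V.label x) B) =
      groupLaw ρ V B := by
  unfold meanLaw groupLaw singleLaw
  rw [← PMF.bind_bind, prodLaw_bind (fun _ => snapshotLaw ρ)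
    fun _ s => estimateLaw V (∑ x, V.label x) s]

/-- For each observable the averages of the groups are independent. -/
theorem cliffordLaw_map_eval {n M : ℕ} (ρ : DensityMatrix n) (obs : Fin M → ObservableCircuit n)
    (K B : ℕ) (j : Fin M) : (cliffordLaw ρ obs K B).map (fun v => v j) =
      (prodLaw K fun _ => groupLaw ρ (obs j) B).map medianOf := by
  unfold cliffordLaw
  rw [PMF.map_bind]
  simp only [prodLaw_map_eval, ← prodLaw_snapshot_bind_meanLaw]
  rw [← prodLaw_bind (fun _ => prodLaw B fun _ => snapshotLaw ρ)
    fun _ s => meanLaw (obs j) (∑ x, (obs j).label x) B s, PMF.map_bind]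
  rfl

theorem Ex_groupLaw_sq {n : ℕ} (ρ : DensityMatrix n) (V : ObservableCircuit n)
    (hV : V.observable.IsHermitian) {B : ℕ} (hB : 0 < B) :
    Ex (groupLaw ρ V B) (fun y => (y - (V.observable * ρ.mat).trace.re) ^ 2) ≤
      4 * (V.observable * V.observable).trace.re / B := by
  obtain ⟨h1, h2⟩ := singleLaw_moments ρ V hV
  set o := (V.observable * ρ.mat).trace.re
  have hf := finite_support_prodLaw (k := B) fun _ => finite_support_singleLaw ρ V
  have hB0 : (B : ℝ) ≠ 0 := by positivity
  rw [groupLaw, Ex_bind hf fun _ _ => finite_support_pure _]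
  simp only [Ex_pure]
  have e : (fun y : Fin B → ℝ => ((∑ i, y i) / B - o) ^ 2) =
      fun y => (1 / (B : ℝ) ^ 2) * (∑ i, (y i - o)) ^ 2 := by
    funext y
    rw [Finset.sum_sub_distrib, Finset.sum_const, Finset.card_univ, Fintype.card_fin, nsmul_eq_mul]
    field_simp
  rw [e, Ex_const_mul hf, Ex_prodLaw_sum_sq (f := fun _ x => x - o)
    (fun _ => finite_support_singleLaw ρ V) fun _ => h1, Finset.sum_const, Finset.card_univ,
    Fintype.card_fin, nsmul_eq_mul]
  have e2 : 1 / (B : ℝ) ^ 2 * (B * Ex (singleLaw ρ V) fun x => (x - o) ^ 2) =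
      (Ex (singleLaw ρ V) fun x => (x - o) ^ 2) / B := by
    field_simp
  rw [e2]
  gcongr

/-- The weight that is used to bound the probability of a bad majority. -/
def weight (o ε x : ℝ) : ℝ := if ε < |x - o| then 4 else 1 / 4

theorem prod_weight (o ε : ℝ) (l : List ℝ) : (l.map (weight o ε)).prod =
    4 ^ (l.countP fun x => decide (ε < |x - o|)) *
      (1 / 4) ^ (l.length - l.countP fun x => decide (ε < |x - o|)) := by
  induction l with
  | nil => simp
  | cons a l ih =>
    have hle := List.countP_le_length (p := fun x => decide (ε < |x - o|)) (l := l)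
    rw [List.map_cons, List.prod_cons, ih, weight, List.countP_cons, List.length_cons]
    by_cases h : ε < |a - o|
    · simp only [h, if_true, decide_true]
      rw [Nat.add_sub_add_right, pow_succ]
      ring
    · simp only [h, if_false, decide_false, Bool.false_eq_true, add_zero]
      rw [Nat.succ_sub hle, pow_succ]
      ring

/-- A bad median forces a bad majority, so the factors `4` outnumber the factors `1 / 4` and the
product is at least one. -/
theorem indicator_le_prod_weight {K : ℕ} (hK : Odd K) (o ε : ℝ) (v : Fin K → ℝ) :
    (if ε < |medianOf v - o| then (1 : ℝ) else 0) ≤ ∏ k, weight o ε (v k) := by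
  have hprod : ∏ k, weight o ε (v k) = ((List.ofFn v).map (weight o ε)).prod := by
    rw [List.map_ofFn, List.prod_ofFn]
    rfl
  rw [hprod, prod_weight]
  split_ifs with h
  · have hs := (selectT_spec K (List.ofFn v) (K / 2) (by simp) (by
      rw [List.length_ofFn]; exact Nat.div_lt_self hK.pos (by norm_num))).1
    have hlen : (List.ofFn v).length = K := List.length_ofFn
    have hm := IsKth.majority (l := List.ofFn v) (v := medianOf v) (o := o) (ε := ε)
      (by rw [hlen]; exact hs) (by rw [hlen]; exact hK) h
    set a := (List.ofFn v).countP fun x => decide (ε < |x - o|)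
    have hle : (List.ofFn v).length - a ≤ a := by omega
    calc (1 : ℝ) = 4 ^ a * (1 / 4) ^ a := by rw [← mul_pow]; norm_num
      _ ≤ _ := by
        gcongr 4 ^ a * ?_
        exact pow_le_pow_of_le_one (by norm_num) (by norm_num) hle
  · positivity

/-- The weight is at most `4 (y - o)² / ε² + 1 / 4`. The mean square error is at most `4 tr O² / B`,
and the constant `64` makes the first term contribute at most `1 / 4`. -/
theorem Ex_weight_le {n : ℕ} (ρ : DensityMatrix n) (V : ObservableCircuit n)
    (hV : V.observable.IsHermitian) {B : ℕ} (hB : 0 < B) {ε : ℝ} (hε : 0 < ε)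
    (h : 64 * (V.observable * V.observable).trace.re ≤ B * ε ^ 2) :
    Ex (groupLaw ρ V B) (weight (V.observable * ρ.mat).trace.re ε) ≤ 1 / 2 := by
  have hf := finite_support_groupLaw ρ V B
  set o := (V.observable * ρ.mat).trace.re with ho
  have h1 := Ex_groupLaw_sq ρ V hV hB
  rw [← ho] at h1
  have hB0 : (0 : ℝ) < B := by exact_mod_cast hB
  have h2 : Ex (groupLaw ρ V B) (weight o ε) ≤ Ex (groupLaw ρ V B)
      (fun y => (4 / ε ^ 2) * (y - o) ^ 2 + 1 / 4) := by
    refine Ex_mono hf fun y _ => ?_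
    unfold weight
    split_ifs with hy
    · have : ε ^ 2 ≤ (y - o) ^ 2 := by
        rw [← sq_abs (y - o)]
        exact pow_le_pow_left₀ hε.le hy.le 2
      have : 4 ≤ 4 / ε ^ 2 * (y - o) ^ 2 := by
        rw [div_mul_eq_mul_div, le_div_iff₀ (by positivity)]
        linarith
      linarith
    · have : 0 ≤ 4 / ε ^ 2 * (y - o) ^ 2 := by positivity
      linarith
  refine h2.trans ?_
  rw [Ex_add hf, Ex_const hf, Ex_const_mul hf]
  have h3 : 4 / ε ^ 2 * Ex (groupLaw ρ V B) (fun y => (y - o) ^ 2) ≤ 1 / 4 := by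
    calc _ ≤ 4 / ε ^ 2 * (4 * (V.observable * V.observable).trace.re / B) := by gcongr
      _ ≤ 1 / 4 := by
        rw [div_mul_div_comm, div_le_div_iff₀ (by positivity) (by positivity)]
        linarith
  linarith

/-- Groups are independent for the fixed `j`, so the expected product of weights factorizes into `K`
factors of at most one half. -/
theorem Ex_bad_le {n M : ℕ} (ρ : DensityMatrix n) (obs : Fin M → ObservableCircuit n) (j : Fin M)
    (hV : (obs j).observable.IsHermitian) {K B : ℕ} (hK : Odd K) (hB : 0 < B) {ε : ℝ} (hε : 0 < ε)
    (h : 64 * ((obs j).observable * (obs j).observable).trace.re ≤ B * ε ^ 2) :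
    Ex (cliffordLaw ρ obs K B) (fun v =>
      if ε < |v j - ((obs j).observable * ρ.mat).trace.re| then (1 : ℝ) else 0) ≤
        (1 / 2) ^ K := by
  set o := ((obs j).observable * ρ.mat).trace.re
  have hf := (denotes_clifford ρ obs K B).1
  have hg : ∀ _k : Fin K, (groupLaw ρ (obs j) B).support.Finite :=
    fun _ => finite_support_groupLaw ρ (obs j) B
  have e := Ex_map hf (fun v => v j) fun x => if ε < |x - o| then (1 : ℝ) else 0
  rw [← e, cliffordLaw_map_eval, Ex_map (finite_support_prodLaw hg)]
  refine (Ex_mono (finite_support_prodLaw hg) fun v _ =>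
    indicator_le_prod_weight hK o ε v).trans ?_
  rw [Ex_prodLaw_prod hg fun _ => weight o ε, Finset.prod_const, Finset.card_univ,
    Fintype.card_fin]
  refine pow_le_pow_left₀ ?_ (Ex_weight_le ρ (obs j) hV hB hε h) K
  have h0 := Ex_mono (finite_support_groupLaw ρ (obs j) B) (f := fun _ => 0) (g := weight o ε)
    fun x _ => by unfold weight; split_ifs <;> norm_num
  rwa [Ex_const (finite_support_groupLaw ρ (obs j) B)] at h0

/-- A union bound over the observables, whose outputs are correlated through the shared snapshots.
-/
theorem clifford_accuracy {n M : ℕ} (ρ : DensityMatrix n) (obs : Fin M → ObservableCircuit n)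
    (hV : ∀ j, (obs j).observable.IsHermitian) {K B : ℕ} (hK : Odd K) (hB : 0 < B) {ε δ : ℝ}
    (hε : 0 < ε)
    (h : ∀ j, 64 * ((obs j).observable * (obs j).observable).trace.re ≤ B * ε ^ 2)
    (hδ : M * (1 / 2 : ℝ) ^ K ≤ δ) :
    ENNReal.ofReal (1 - δ) ≤ (clifford ρ obs K B).law.toOuterMeasure
      {o | ∀ j, |o.1 j - ((obs j).observable * ρ.mat).trace.re| ≤ ε} := by
  have hd := denotes_clifford ρ obs K B
  have h1 := hd.law_apply {v | ∀ j, |v j - ((obs j).observable * ρ.mat).trace.re| ≤ ε}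
  refine le_trans ?_ (le_of_eq h1.symm)
  rw [toOuterMeasure_eq_Ex hd.1]
  refine ENNReal.ofReal_le_ofReal ?_
  have h2 : Ex (cliffordLaw ρ obs K B) (fun v => 1 - ∑ j,
      if ε < |v j - ((obs j).observable * ρ.mat).trace.re| then (1 : ℝ) else 0) ≤
      Ex (cliffordLaw ρ obs K B) (Set.indicator
        {v | ∀ j, |v j - ((obs j).observable * ρ.mat).trace.re| ≤ ε} 1) := by
    refine Ex_mono hd.1 fun v _ => ?_
    have hnn : ∀ j ∈ (Finset.univ : Finset (Fin M)), (0 : ℝ) ≤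
        if ε < |v j - ((obs j).observable * ρ.mat).trace.re| then (1 : ℝ) else 0 := fun j _ => by
      split_ifs <;> norm_num
    by_cases hv : ∀ j, |v j - ((obs j).observable * ρ.mat).trace.re| ≤ ε
    · rw [Set.indicator_of_mem (Set.mem_ofPred_eq ▸ hv), Pi.one_apply]
      linarith [Finset.sum_nonneg hnn]
    · rw [Set.indicator_of_notMem (Set.mem_ofPred_eq ▸ hv)]
      push Not at hv
      obtain ⟨j, hj⟩ := hv
      have := Finset.single_le_sum hnn (Finset.mem_univ j)
      rw [if_pos hj] at this
      linarith
  refine le_trans ?_ h2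
  rw [Ex_sub hd.1, Ex_const hd.1, Ex_sum hd.1]
  have h3 : ∑ j, Ex (cliffordLaw ρ obs K B) (fun v =>
      if ε < |v j - ((obs j).observable * ρ.mat).trace.re| then (1 : ℝ) else 0) ≤
      ∑ _j : Fin M, (1 / 2 : ℝ) ^ K :=
    Finset.sum_le_sum fun j _ => Ex_bad_le ρ obs j (hV j) hK hB hε (h j)
  rw [Finset.sum_const, Finset.card_univ, Fintype.card_fin, nsmul_eq_mul] at h3
  linarith

/-! ### Worst-case resource bounds for programs -/

/-- In every run the result of `p` satisfies `Q`, and the run uses at most `c` copies, `t` steps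
and `g` gates. -/
def Cost {α : Type} (p : Prog α) (Q : α → Prop) (c t g : ℕ) : Prop :=
  ∀ s : Meter, ∀ o ∈ (StateT.run p s).support,
    Q o.1 ∧ o.2.copies ≤ s.copies + c ∧ o.2.steps ≤ s.steps + t ∧ o.2.gates ≤ s.gates + g

theorem Cost.pure {α : Type} {Q : α → Prop} {a : α} (h : Q a) :
    Cost (pure a : Prog α) Q 0 0 0 := by
  intro s o ho
  have : o = (a, s) := (PMF.mem_support_pure_iff _ _).1 ho
  subst this
  exact ⟨h, le_rfl, le_rfl, le_rfl⟩

/-- The postcondition `Q` passes data such as circuit lengths to the continuation, whose cost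
depends on them. -/
theorem Cost.bind {α β : Type} {p : Prog α} {f : α → Prog β} {Q : α → Prop} {R : β → Prop}
    {c t g c' t' g' : ℕ} (hp : Cost p Q c t g) (hf : ∀ a, Q a → Cost (f a) R c' t' g') :
    Cost (p >>= f) R (c + c') (t + t') (g + g') := by
  intro s o ho
  obtain ⟨x, hx, hxo⟩ := (PMF.mem_support_bind_iff (StateT.run p s)
    (fun o => StateT.run (f o.1) o.2) o).1 ho
  obtain ⟨h1, h2, h3, h4⟩ := hp s x hx
  obtain ⟨k1, k2, k3, k4⟩ := hf x.1 h1 x.2 o hxo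
  exact ⟨k1, by omega, by omega, by omega⟩

theorem Cost.weaken {α : Type} {p : Prog α} {Q R : α → Prop} {c t g c' t' g' : ℕ}
    (hp : Cost p Q c t g) (hQ : ∀ a, Q a → R a) (hc : c ≤ c') (ht : t ≤ t') (hg : g ≤ g') :
    Cost p R c' t' g' := by
  intro s o ho
  obtain ⟨h1, h2, h3, h4⟩ := hp s o ho
  exact ⟨hQ _ h1, by omega, by omega, by omega⟩

theorem Cost.le {α : Type} {p : Prog α} {Q : α → Prop} {c t g c' t' g' : ℕ}
    (hp : Cost p Q c t g) (hc : c ≤ c') (ht : t ≤ t') (hg : g ≤ g') : Cost p Q c' t' g' :=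
  hp.weaken (fun _ h => h) hc ht hg

theorem cost_tick (k : ℕ) : Cost (tick k) (fun _ => True) 0 k 0 := by
  intro s o ho
  have : o = ((), { s with steps := s.steps + k }) := (PMF.mem_support_pure_iff _ _).1 ho
  subst this
  exact ⟨trivial, le_rfl, le_rfl, le_rfl⟩

theorem cost_draw {α : Type} (μ : PMF α) : Cost (draw μ) (fun _ => True) 0 0 0 := by
  intro s o ho
  obtain ⟨x, -, hx⟩ := (PMF.mem_support_bind_iff μ (fun x => PMF.pure (x, s)) o).1 ho
  have : o = (x, s) := (PMF.mem_support_pure_iff _ _).1 hx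
  subst this
  exact ⟨trivial, le_rfl, le_rfl, le_rfl⟩

theorem cost_modify (c t g : ℕ) :
    Cost (modify fun s => ⟨s.copies + c, s.steps + t, s.gates + g⟩ : Prog PUnit)
      (fun _ => True) c t g := by
  intro s o ho
  have : o = (PUnit.unit, ⟨s.copies + c, s.steps + t, s.gates + g⟩) :=
    (PMF.mem_support_pure_iff _ _).1 ho
  subst this
  exact ⟨trivial, le_rfl, le_rfl, le_rfl⟩

theorem cost_forFin {α : Type} {Q : α → Prop} {c t g : ℕ} :
    ∀ {k : ℕ} {f : Fin k → Prog α}, (∀ i, Cost (f i) Q c t g) →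
      Cost (forFin k f) (fun v => ∀ i, Q (v i)) (k * c) (k * (t + 1)) (k * g)
  | 0, f, _ => (Cost.pure (Q := fun v : Fin 0 → α => ∀ i, Q (v i)) fun i => i.elim0).le
      (by simp) (by simp) (by simp)
  | k + 1, f, h => by
    refine Cost.le (c := 0 + (c + (k * c + 0))) (t := 1 + (t + (k * (t + 1) + 0)))
      (g := 0 + (g + (k * g + 0))) ?_ (by rw [Nat.succ_mul]; omega) (by rw [Nat.succ_mul]; omega)
      (by rw [Nat.succ_mul]; omega)
    refine (cost_tick 1).bind fun _ _ => (h 0).bind fun a ha =>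
      (cost_forFin fun i => h i.succ).bind fun l hl => Cost.pure ?_
    exact Fin.cases ha hl

theorem cost_rand (k : ℕ) : Cost (rand k) (fun _ => True) 0 k.size 0 :=
  (cost_tick _).bind fun _ _ => cost_draw _

theorem cost_coin : Cost coin (fun _ => True) 0 1 0 :=
  ((cost_rand 1).bind fun _ _ => Cost.pure trivial).le le_rfl (by simp) le_rfl

/-! ### Circuit lengths and costs of the subroutines -/

theorem length_gCNOT_le {n : ℕ} (i j : Fin n) : (gCNOT i j).length ≤ 1 := by
  unfold gCNOT; split_ifs <;> simp

theorem length_flatMap_le {α β : Type} (f : α → List β) (k : ℕ) (h : ∀ a, (f a).length ≤ k) :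
    ∀ l : List α, (l.flatMap f).length ≤ l.length * k
  | [] => by simp
  | a :: l => by
    have h1 := length_flatMap_le f k h l
    have h2 := h a
    rw [List.flatMap_cons, List.length_append, List.length_cons, Nat.succ_mul]
    omega

theorem length_zTo_le {n : ℕ} (a : Fin (n + 1) → Bool × Bool) :
    (zTo a).length ≤ 3 * (n + 1) + 3 := by
  unfold zTo
  extract_lets t
  simp only [List.length_append]
  have h1 := length_gCNOT_le 0 t
  have h2 := length_gCNOT_le t 0
  have h3 := length_flatMap_le (fun i => if (a i).1 || (a i).2 then gCNOT i t else []) 1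
    (fun i => by split_ifs <;> simp [length_gCNOT_le]) (List.finRange (n + 1))
  have h4 := length_flatMap_le (fun i =>
    if (a i).1 then (if (a i).2 then gH i ++ gS i else gH i) else []) 2
    (fun i => by split_ifs <;> simp [gH, gS]) (List.finRange (n + 1))
  rw [List.length_finRange] at h3 h4
  omega

theorem length_xTo_le {n : ℕ} (z : Bool) (q : Fin n → Bool × Bool) :
    (xTo z q).length ≤ 2 * n + 1 := by
  unfold xTo
  rw [List.length_append]
  refine add_le_add ((length_flatMap_le _ 2 (fun i => ?_) (List.finRange n)).trans
    (by rw [List.length_finRange]; omega)) (by split_ifs <;> simp [gS])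
  have := length_gCNOT_le 0 i.succ
  split <;> simp [gS, gH] <;> omega

theorem length_pauliZero_le {n : ℕ} (s t : Bool) :
    (pauliZero s t : Circuit (n + 1)).length ≤ 6 := by
  cases s <;> cases t <;> simp [pauliZero, gS, gH]

theorem cost_cliffordSampler : ∀ n : ℕ,
    Cost (cliffordSampler n) (fun c => c.length ≤ 13 * n ^ 2) 0 (26 * n ^ 3) 0
  | 0 => Cost.pure (by simp)
  | n + 1 => by
    have hsize : (4 ^ (n + 1) - 2).size ≤ 2 * (n + 1) := by
      rw [Nat.size_le, pow_mul]
      have : 0 < 4 ^ (n + 1) := by positivity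
      norm_num
    -- The nested sums mirror the sequence of binds in the sampler. The constant `26` is exactly
    -- what one qubit needs: `2` for the string, `3` coins, and `8 + 13` for writing the circuit.
    refine Cost.le (c := 0 + (n * (0 + (0 + 0)) + (0 + (0 + (0 + (0 + (0 + 0)))))))
      (t := (4 ^ (n + 1) - 2).size + (n * ((1 + (1 + 0)) + 1) + (1 + (1 + (1 + (26 * n ^ 3 +
        ((8 * (n + 1) + 13 * (n + 1) ^ 2) + 0)))))))
      (g := 0 + (n * (0 + (0 + 0)) + (0 + (0 + (0 + (0 + (0 + 0))))))) ?_ (by simp)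
      (by nlinarith) (by simp)
    refine (cost_rand _).bind fun r _ => (cost_forFin (Q := fun _ => True) fun _ =>
      cost_coin.bind fun _ _ => cost_coin.bind fun _ _ => Cost.pure trivial).bind fun q _ =>
      cost_coin.bind fun z _ => cost_coin.bind fun s _ => cost_coin.bind fun t _ =>
      (cost_cliffordSampler n).bind fun c hc => ?_
    dsimp only
    have hlen : (c.map Gate.shift ++ pauliZero s t ++ xTo z q ++ zTo (fun i : Fin (n + 1) =>
        ((r.val + 1).testBit (2 * i.val), (r.val + 1).testBit (2 * i.val + 1)))).length ≤
        13 * (n + 1) ^ 2 := by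
      simp only [List.length_append, List.length_map]
      have h1 := length_pauliZero_le (n := n) s t
      have h2 := length_xTo_le z q
      have h3 := length_zTo_le (fun i : Fin (n + 1) =>
        ((r.val + 1).testBit (2 * i.val), (r.val + 1).testBit (2 * i.val + 1)))
      nlinarith
    exact ((cost_tick _).le le_rfl (Nat.add_le_add_left hlen _) le_rfl).bind fun _ _ =>
      Cost.pure hlen

theorem length_dagger {n : ℕ} (c : Circuit n) : c.dagger.length = c.length := by
  simp [Circuit.dagger]

theorem cost_measureCopy {n : ℕ} (ρ : DensityMatrix n) (c : Circuit n) :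
    Cost (measureCopy ρ c) (fun _ => True) 1 1 (c.length + n) :=
  (cost_modify 1 1 (c.length + n)).bind fun _ _ => cost_draw _

theorem cost_measureBasis {n : ℕ} (b : Bits n) (c : Circuit n) :
    Cost (measureBasis b c) (fun _ => True) 0 1 (n + c.length + n) :=
  (cost_modify 0 1 (n + c.length + n)).bind fun _ _ => cost_draw _

theorem cost_snapshot {n : ℕ} (ρ : DensityMatrix n) :
    Cost (snapshot ρ) (fun s => s.2.length ≤ 13 * n ^ 2) 1 (26 * n ^ 3 + (1 + (n + 13 * n ^ 2)))
      (13 * n ^ 2 + n) := by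
  refine Cost.le (c := 0 + (1 + (0 + 0))) (t := 26 * n ^ 3 + (1 + ((n + 13 * n ^ 2) + 0)))
    (g := 0 + ((13 * n ^ 2 + n) + (0 + 0))) ?_ le_rfl le_rfl (by omega)
  refine (cost_cliffordSampler n).bind fun c hc =>
    ((cost_measureCopy ρ c).le le_rfl le_rfl (Nat.add_le_add_right hc n)).bind fun b _ =>
    ((cost_tick _).le le_rfl (Nat.add_le_add_left hc n) le_rfl).bind fun _ _ => Cost.pure ?_
  rwa [length_dagger]

theorem cost_estimate {n : ℕ} (V : ObservableCircuit n) (t : ℝ) (s : Bits n × Circuit n)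
    {L F : ℕ} (hs : s.2.length ≤ L) (hV : V.circuit.length ≤ F) :
    Cost (estimate V t s) (fun _ => True) 0 (4 * (2 * (2 ^ n + 1)) + 3)
      (2 * (2 ^ n + 1) * (n + (L + F) + n)) := by
  refine Cost.le (c := 2 * (2 ^ n + 1) * (0 + (0 + 0)) + (0 + 0))
    (t := 2 * (2 ^ n + 1) * ((1 + (1 + 0)) + 1) + (2 * (2 ^ n + 1) + 3 + 0))
    (g := 2 * (2 ^ n + 1) * ((n + (L + F) + n) + (0 + 0)) + (0 + 0)) ?_ (by simp)
    (by ring_nf; omega) (by simp)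
  refine (cost_forFin (Q := fun _ => True) fun _ => ?_).bind fun v _ =>
    (cost_tick _).bind fun _ _ => Cost.pure trivial
  refine ((cost_measureBasis s.1 (s.2 ++ V.circuit)).le le_rfl le_rfl ?_).bind fun x _ =>
    (cost_tick 1).bind fun _ _ => Cost.pure trivial
  rw [List.length_append]
  omega

theorem cost_traceOf {n : ℕ} (V : ObservableCircuit n) :
    Cost (traceOf V) (fun _ => True) 0 (2 * 2 ^ n) 0 :=
  (cost_tick _).bind fun _ _ => Cost.pure trivial

theorem cost_median {k : ℕ} (hk : 0 < k) (v : Fin k → ℝ) :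
    Cost (median v) (fun _ => True) 0 (k + 4000 * (k + 1)) 0 := by
  have h := (selectT_spec k (List.ofFn v) (k / 2) (by simp) (by simp; omega)).2
  rw [List.length_ofFn] at h
  exact ((cost_tick _).le le_rfl (Nat.add_le_add_left h k) le_rfl).bind fun _ _ =>
    Cost.pure trivial

theorem cost_clifford {n M : ℕ} (ρ : DensityMatrix n) (obs : Fin M → ObservableCircuit n)
    {K B F : ℕ} (hK : 0 < K) (hF : ∀ j, (obs j).circuit.length ≤ F) :
    Cost (clifford ρ obs K B) (fun _ => True) (K * B)
      (K * (B * (26 * n ^ 3 + (1 + (n + 13 * n ^ 2)) + 1) + 1) +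
        M * (2 * 2 ^ n + (K * (B * (4 * (2 * (2 ^ n + 1)) + 3 + 1) + (B + 1) + 1) +
          (K + 4000 * (K + 1))) + 1))
      (K * (B * (13 * n ^ 2 + n)) +
        M * (K * (B * (2 * (2 ^ n + 1) * (n + (13 * n ^ 2 + F) + n))))) := by
  refine Cost.le (c := K * (B * 1) + M * (0 + (K * (B * 0 + (0 + 0)) + 0)))
    (g := K * (B * (13 * n ^ 2 + n)) +
        M * (0 + (K * (B * (2 * (2 ^ n + 1) * (n + (13 * n ^ 2 + F) + n)) + (0 + 0)) + 0)))
    ?_ (by simp) le_rfl (by simp)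
  refine (cost_forFin fun _ => cost_forFin fun _ => cost_snapshot ρ).bind fun snaps hs =>
    (cost_forFin (Q := fun _ => True) fun j => (cost_traceOf (obs j)).bind fun t _ =>
      (cost_forFin (Q := fun _ => True) fun k =>
        (cost_forFin fun i => cost_estimate (obs j) t (snaps k i) (hs k i) (hF j)).bind fun y _ =>
          (cost_tick (B + 1)).bind fun _ _ => Cost.pure trivial).bind fun means _ =>
        cost_median hK means).weaken (fun _ _ => trivial) le_rfl le_rfl le_rfl

/-! ### Total resources and choice of parameters -/

theorem sq_le_two_mul_two_pow (n : ℕ) : n ^ 2 ≤ 2 * 2 ^ n := by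
  induction n with
  | zero => simp
  | succ n ih =>
    have := n.lt_two_pow_self
    rw [pow_succ 2 n]
    rcases Nat.lt_or_ge n 3 with h | h
    · interval_cases n <;> norm_num
    · nlinarith

theorem cube_le_four_mul_two_pow (n : ℕ) : n ^ 3 ≤ 4 * 2 ^ n := by
  induction n with
  | zero => simp
  | succ n ih =>
    rw [pow_succ 2 n]
    rcases Nat.lt_or_ge n 4 with h | h
    · interval_cases n <;> norm_num
    · nlinarith [mul_le_mul h h (by norm_num) (by omega), mul_le_mul h (le_refl (n ^ 2)) (by positivity) (by omega)]

theorem clifford_copies_steps_gates_le {n M : ℕ} (ρ : DensityMatrix n)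
    (obs : Fin M → ObservableCircuit n) {K B F : ℕ} (hK : 0 < K) (hB : 0 < B) (hM : 0 < M)
    (hF : ∀ j, (obs j).circuit.length ≤ F) (o : (Fin M → ℝ) × Meter)
    (ho : o ∈ (clifford ρ obs K B).law.support) :
    o.2.copies ≤ K * B ∧ o.2.steps ≤ 8200 * (2 ^ n * M * (K * B)) ∧
      o.2.gates ≤ 8200 * (2 ^ n * M * (K * B)) * (F + (n + 1) ^ 2) := by
  obtain ⟨-, h1, h2, h3⟩ := cost_clifford ρ obs (B := B) hK hF ⟨0, 0, 0⟩ o ho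
  have hd : 1 ≤ 2 ^ n := Nat.one_le_two_pow
  have e1 : n ≤ 2 ^ n := n.lt_two_pow_self.le
  have e2 := sq_le_two_mul_two_pow n
  have e3 := cube_le_four_mul_two_pow n
  set d := 2 ^ n
  simp only [zero_add] at h1 h2 h3
  refine ⟨h1, h2.trans ?_, h3.trans ?_⟩
  · have hKB : K ≤ K * B := Nat.le_mul_of_pos_right K hB
    have hX : K * B ≤ d * M * (K * B) := Nat.le_mul_of_pos_left _ (by positivity)
    -- The snapshot phase is polynomial in `n` per copy, so it is absorbed by `d`.
    have a1 : K * (B * (26 * n ^ 3 + (1 + (n + 13 * n ^ 2)) + 1) + 1) ≤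
        134 * (d * M * (K * B)) := by
      calc _ ≤ K * (B * (26 * (4 * d) + (1 * d + (d + 13 * (2 * d))) + 1 * d) + 1 * B * d) := by
            gcongr <;> nlinarith
        _ = 134 * (d * 1 * (K * B)) := by ring
        _ ≤ _ := by gcongr; exact hM
    -- Most of `8027` comes from the constant `4000` of selection; with the `134` of the snapshots
    -- it stays below `8200`.
    have a2 : M * (2 * d + (K * (B * (4 * (2 * (d + 1)) + 3 + 1) + (B + 1) + 1) +
          (K + 4000 * (K + 1))) + 1) ≤ 8027 * (d * M * (K * B)) := by
      have b1 : 1 ≤ K * B := Nat.mul_pos hK hB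
      calc _ ≤ M * (2 * d * (K * B) + (K * (B * (4 * (2 * (d + d)) + 3 * d + d) + (B * d + B * d)
              + B * d) + (K * B * d + 4000 * (K * B * d + K * B * d))) + K * B * d) := by
            have b2 : 1 ≤ B * d := Nat.mul_pos hB hd
            have b3 : K ≤ K * B * d := by rw [mul_assoc]; exact Nat.le_mul_of_pos_right K b2
            have b4 : 1 ≤ K * B * d := Nat.mul_pos b1 hd
            have b5 : B ≤ B * d := Nat.le_mul_of_pos_right B hd
            have b6 : 2 * d ≤ 2 * d * (K * B) := Nat.le_mul_of_pos_right _ b1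
            gcongr
            omega
        _ = 8027 * (d * M * (K * B)) := by ring
    omega
  · have c1 : 13 * n ^ 2 + n ≤ 13 * (F + (n + 1) ^ 2) := by nlinarith
    have c2 : n + (13 * n ^ 2 + F) + n ≤ 13 * (F + (n + 1) ^ 2) := by nlinarith
    calc _ ≤ K * (B * (13 * (F + (n + 1) ^ 2))) * (d * M) +
          M * (K * (B * (2 * (d + d) * (13 * (F + (n + 1) ^ 2))))) := by
          refine add_le_add (le_trans ?_ (Nat.le_mul_of_pos_right _ (by positivity))) ?_ <;>
            gcongr
      _ = 65 * (d * M * (K * B)) * (F + (n + 1) ^ 2) := by ring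
      _ ≤ _ := by gcongr; norm_num

theorem trace_mul_eq_re {ι : Type} [Fintype ι] {A B : Matrix ι ι ℂ} (hA : A.IsHermitian)
    (hB : B.IsHermitian) : (A * B).trace = ((A * B).trace.re : ℂ) := by
  refine (Complex.conj_eq_iff_re.1 ?_).symm
  rw [starRingEnd_apply, ← Matrix.trace_conjTranspose, Matrix.conjTranspose_mul, hA.eq, hB.eq,
    Matrix.trace_mul_comm]

theorem DensityMatrix.isHermitian {n : ℕ} (ρ : DensityMatrix n) : ρ.mat.IsHermitian :=
  ρ.posSemidef.isHermitian

/-- Since `e ≤ 2²`, twice the natural logarithm of `M / δ` is enough as an exponent of two; the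
extra `1` keeps the number of groups odd. -/
theorem mul_half_pow_le {M : ℕ} {δ : ℝ} (hM : 0 < M) (hδ : 0 < δ) :
    M * (1 / 2 : ℝ) ^ (2 * ⌈Real.log (M / δ)⌉₊ + 1) ≤ δ := by
  have hM' : (0 : ℝ) < M := by exact_mod_cast hM
  have h1 : (M / δ : ℝ) ≤ 2 ^ (2 * ⌈Real.log (M / δ)⌉₊ + 1) := by
    calc (M / δ : ℝ) = Real.exp (Real.log (M / δ)) := (Real.exp_log (by positivity)).symm
      _ ≤ Real.exp ⌈Real.log (M / δ)⌉₊ := Real.exp_le_exp.2 (Nat.le_ceil _)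
      _ = Real.exp 1 ^ ⌈Real.log (M / δ)⌉₊ := by rw [← Real.exp_nat_mul, mul_one]
      _ ≤ (2 ^ 2) ^ ⌈Real.log (M / δ)⌉₊ := by
        gcongr
        linarith [Real.exp_one_lt_d9]
      _ = 2 ^ (2 * ⌈Real.log (M / δ)⌉₊) := by rw [pow_mul]
      _ ≤ _ := by gcongr <;> norm_num
  rw [one_div, inv_pow, ← div_eq_mul_inv, div_le_iff₀ (by positivity), mul_comm,
    ← div_le_iff₀ hδ]
  exact h1

end QCQC

end

theorem mainTheorem3 :
    -- the first phase of the procedure uses uniformly random Clifford unitaries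
    (∀ n : ℕ, QCQC.IsUniformClifford (QCQC.cliffordSampler n)) ∧
    -- with an absolute constant `C`, the procedure solves shadow tomography
    ∃ C : ℝ, 0 < C ∧
      ∀ (M r : ℕ) (lam ε δ : ℝ), 2 ≤ M → 0 < ε → 0 < δ → δ < 1 →
        -- the number of groups and their size depend on these parameters alone
        ∃ K B : ℕ, Odd K ∧ 0 < B ∧
          ∀ (n F : ℕ) (O : Fin M → QCQC.Op n) (hO : ∀ j, (O j).IsHermitian),
            (∀ j, (O j).rank ≤ r) →
            (∀ j i, |(hO j).eigenvalues i| ≤ lam) →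
            ∀ obs : Fin M → QCQC.ObservableCircuit n,
              (∀ j, (obs j).observable = O j) →
              (∀ j, (obs j).circuit.length ≤ F) →
              ∀ ρ : QCQC.DensityMatrix n,
                -- accuracy
                ENNReal.ofReal (1 - δ) ≤
                    (QCQC.clifford ρ obs K B).law.toOuterMeasure
                      {o | ∀ j, ‖((o.1 j : ℝ) : ℂ) - (O j * ρ.mat).trace‖ ≤ ε} ∧
                -- resources, in every run
                ∀ o ∈ (QCQC.clifford ρ obs K B).law.support,
                  (o.2.copies : ℝ) ≤
                    C * (max 1 (r * lam ^ 2 / ε ^ 2) * Real.log (M / δ)) ∧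
                  (o.2.steps : ℝ) ≤
                    C * (2 ^ n * max 1 (r * lam ^ 2 / ε ^ 2) * M * Real.log (M / δ)) ∧
                  (o.2.gates : ℝ) ≤
                    C * (2 ^ n * max 1 (r * lam ^ 2 / ε ^ 2) * M * Real.log (M / δ)) *
                      (F + (n + 1) ^ 2) := by
  -- The constant rounds up `8200 * 455`, where `455 = 7 * 65` comes from the bounds on `K` and `B`.
  refine ⟨QCQC.isUniformClifford_cliffordSampler, 4000000, by norm_num, ?_⟩
  intro M r lam ε δ hM hε hδ hδ1
  have hM2 : (2 : ℝ) ≤ M := by exact_mod_cast hM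
  set R : ℝ := max 1 (r * lam ^ 2 / ε ^ 2)
  set L : ℝ := Real.log (M / δ)
  have hR : 1 ≤ R := le_max_left _ _
  -- Two observables and `δ < 1` give `M / δ ≥ 2`. A positive lower bound on `L` is needed to absorb
  -- the rounding in `K` into a multiple of `L`.
  have hL : 0.69 ≤ L := by
    refine (by linarith [Real.log_two_gt_d9] : (0.69 : ℝ) ≤ Real.log 2).trans
      (Real.log_le_log (by norm_num) ?_)
    rw [le_div_iff₀ hδ]
    nlinarith
  have hK : ((2 * ⌈L⌉₊ + 1 : ℕ) : ℝ) ≤ 7 * L := by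
    push_cast
    linarith [Nat.ceil_lt_add_one (show 0 ≤ L by linarith)]
  have hB : (⌈64 * R⌉₊ : ℝ) ≤ 65 * R := by
    linarith [Nat.ceil_lt_add_one (show 0 ≤ 64 * R by linarith)]
  have hB0 : 0 < ⌈64 * R⌉₊ := Nat.ceil_pos.2 (by linarith)
  refine ⟨2 * ⌈L⌉₊ + 1, ⌈64 * R⌉₊, odd_two_mul_add_one _, hB0, ?_⟩
  intro n F O hO hr hlam obs hobs hF ρ
  obtain rfl : (fun j => (obs j).observable) = O := funext hobs
  constructor
  · convert QCQC.clifford_accuracy ρ obs hO (odd_two_mul_add_one _) hB0 hε (fun j => ?_)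
      (QCQC.mul_half_pow_le (by omega) hδ) using 4 with o
    · refine forall_congr' fun j => ?_
      rw [QCQC.trace_mul_eq_re (hO j) ρ.isHermitian, ← Complex.ofReal_sub,
        Complex.norm_real, Real.norm_eq_abs, Complex.ofReal_re]
    -- The group size meets the requirement of `clifford_accuracy` because `tr O² ≤ r λ² ≤ R ε²`.
    · have h1 := QCQC.trace_mul_self_le_of_rank (hO j) (hr j) (hlam j)
      have h2 : r * lam ^ 2 ≤ R * ε ^ 2 := (div_le_iff₀ (by positivity)).1 (le_max_right _ _)
      have h3 : 64 * R ≤ ⌈64 * R⌉₊ := Nat.le_ceil _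
      calc _ ≤ 64 * R * ε ^ 2 := by linarith
        _ ≤ _ := by gcongr
  · intro o ho
    obtain ⟨h1, h2, h3⟩ := QCQC.clifford_copies_steps_gates_le ρ obs (Nat.succ_pos _) hB0
      (by omega) hF o ho
    have hKB : ((2 * ⌈L⌉₊ + 1 : ℕ) : ℝ) * (⌈64 * R⌉₊ : ℝ) ≤ 455 * (R * L) := by
      calc _ ≤ 7 * L * (65 * R) := by gcongr
        _ = _ := by ring
    have hRL : 0 ≤ R * L := by positivity
    have hX : (8200 : ℝ) * (2 ^ n * M * (((2 * ⌈L⌉₊ + 1 : ℕ) : ℝ) * (⌈64 * R⌉₊ : ℝ))) ≤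
        4000000 * (2 ^ n * R * M * L) := by
      calc _ ≤ (8200 : ℝ) * (2 ^ n * M * (455 * (R * L))) := by gcongr
        _ = 3731000 * (2 ^ n * R * M * L) := by ring
        _ ≤ _ := by
          gcongr
          norm_num
    refine ⟨?_, ?_, ?_⟩
    · have h1' : (o.2.copies : ℝ) ≤ ((2 * ⌈L⌉₊ + 1 : ℕ) : ℝ) * (⌈64 * R⌉₊ : ℝ) := by
        exact_mod_cast h1
      linarith
    · refine le_trans ?_ hX
      exact_mod_cast h2
    · refine le_trans ?_ (mul_le_mul_of_nonneg_right hX (by positivity))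
      exact_mod_cast h3
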